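/- Let $s\ge 1$. A mixed-integer multilevel linear problem $P$ with $s+1$ levels $0,1,\dots,s$ (level $0$ is the top level $\mathcal U$, level $i\ge1$ is the lower level $\mathcal L_i$) has rational data. Level $i$ controls a vector $y_i$ of integer variables, each with given finite integer lower and upper bounds, and real variables, and it minimizes a linear function $f_i(y_0,\dots,y_s)$ subject to finitely many constraints $g_{i,k}(y_0,\dots,y_s)\le b_{i,k}$, with $g_{i,k}$ linear. The continuous variables of a level do not appear in the objective or the constraints of the levels deciding after it. Feasibility is optimistic and defined from the bottom up: given $y_0,\dots,y_{i-1}$, the tuple $(y_i,\dots,y_s)$ is feasible for level $i$ if it satisfies the bounds and constraints of level $i$ and, when $i<s$, $(y_{i+1},\dots,y_s)$ minimizes $f_{i+1}$ among the tuples feasible for level $i+1$ given $y_0,\dots,y_i$. Let $\mathcal C$ be any class of such problems with $s+1$ levels, and consider the following decision problems, with inputs in binary. * Canonical problem: given $P\in\mathcal C$ and $\Gamma\in\mathbb Q$, is there $(x,v)$, with $x=y_0$ and $v=(y_1,\dots,y_s)$, feasible for level $0$ with $f_0(x,v)\le\Gamma$? * $(\mathrm{NOMIMLP}_s)$: given $P\in\mathcal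 C$, a tolerance $\delta\in\mathbb Q$, $\delta\ge0$, and $\Gamma\in\mathbb Q$, is there $(x,v)$ feasible for level $0$ with $f_0(x,v)\le\Gamma$ such that $g_{0,k}(x,z)\le b_{0,k}$ for all $k$ and all $z\in\mathcal Z(x;\delta)$, where $\mathcal Z(x;\delta)$ is the set of all $z=(z_1,\dots,z_s)$ feasible for $\mathcal L_1$ given $x$ with $f_1(x,z)\le f_1(x,v)+\delta$? * $\mathcal L_1$: given $P\in\mathcal C$, the integer part of a top-level decision $x$ within its bounds (the continuous part does not appear in the lower levels) and $\gamma\in\mathbb Q$, is there $z$ feasible for $\mathcal L_1$ given $x$ with $f_1(x,z)\le\gamma$? Say that $\mathcal L_1$ is in $\Sigma_s^{P*}[\mathcal H_L]$, with $\mathcal H_L$ the linear functions of the lower-level variables, if the decision problem $\mathcal L_1$ is in $\Sigma_s^P$, and so is the problem obtained from it by adding one linear constraint $a(z)\le b$ and replacing the objective by some $h\in\mathcal H_L$, where $a,h$ (with rational coefficients) and $b\in\mathbb Q$ are part of the input and $a,h$ are linear functions of the lower-level variables $z$. Here $\Sigma_0^P=\mathcal P$, $\Sigma_1^P=\mathcal{NP}$,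 and $\Sigma_{n+1}^P$, $n\ge1$, consists of the problems solvable in nondeterministic polynomial time with an oracle for a problem in $\Sigma_n^P$. If $\mathcal L_1$ is in $\Sigma_s^{P*}[\mathcal H_L]$, then the decision problem $(\mathrm{NOMIMLP}_s)$ is in $\Sigma_{s+1}^P$, and so is the canonical multilevel problem. -/

import Mathlib

/-! ### Machine model with step count, and the polynomial hierarchy

Programs work on finitely many stacks of bits.  Every elementary operation touches the top of one
stack and costs one step (two stacks simulate a tape, so this is the multitape Turing machine model
up to polynomial overhead).  `guess` is the nondeterministic choice of a bit and `query` is a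
one-step call to an oracle. -/

/-- Nondeterministic oracle programs over stacks of bits, indexed by natural numbers. -/
inductive StackProgram : Type
  | skip : StackProgram
  | push (k : ℕ) (b : Bool) : StackProgram
  | pop (k : ℕ) : StackProgram
  | seq (p q : StackProgram) : StackProgram
  /-- branch according to the top of stack `k`: empty, `false` or `true` -/
  | branch (k : ℕ) (pEmpty pFalse pTrue : StackProgram) : StackProgram
  /-- repeat while stack `k` is nonempty -/
  | loop (k : ℕ) (p : StackProgram) : StackProgram
  /-- push a nondeterministically chosen bit on stack `k` -/
  | guess (k : ℕ) : StackProgram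
  /-- push on stack `l` the answer to: is the content of stack `k` in the oracle? -/
  | query (k l : ℕ) : StackProgram

/-- The contents of all stacks, top of the stack first. -/
abbrev StackState : Type := ℕ → List Bool

/-- `StackProgram.Run O p σ τ t`: with oracle `O`, the program `p` started in the state `σ` has a
computation that halts in the state `τ` after exactly `t` steps. -/
inductive StackProgram.Run (O : Language Bool) :
    StackProgram → StackState → StackState → ℕ → Prop
  | skip (σ : StackState) : Run O .skip σ σ 1
  | push (σ : StackState) (k : ℕ) (b : Bool) :
      Run O (.push k b) σ (Function.update σ k (b :: σ k)) 1
  | pop (σ : StackState) (k : ℕ) :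
      Run O (.pop k) σ (Function.update σ k (σ k).tail) 1
  | seq (p q : StackProgram) (σ τ υ : StackState) (t u : ℕ) :
      Run O p σ τ t → Run O q τ υ u → Run O (.seq p q) σ υ (t + u)
  | branch_empty (k : ℕ) (p q r : StackProgram) (σ τ : StackState) (t : ℕ) :
      (σ k).head? = none → Run O p σ τ t → Run O (.branch k p q r) σ τ (t + 1)
  | branch_false (k : ℕ) (p q r : StackProgram) (σ τ : StackState) (t : ℕ) :
      (σ k).head? = some false → Run O q σ τ t → Run O (.branch k p q r) σ τ (t + 1)
  | branch_true (k : ℕ) (p q r : StackProgram) (σ τ : StackState) (t : ℕ) :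
      (σ k).head? = some true → Run O r σ τ t → Run O (.branch k p q r) σ τ (t + 1)
  | loop_exit (k : ℕ) (p : StackProgram) (σ : StackState) :
      σ k = [] → Run O (.loop k p) σ σ 1
  | loop_step (k : ℕ) (p : StackProgram) (σ τ υ : StackState) (t u : ℕ) :
      σ k ≠ [] → Run O p σ τ t → Run O (.loop k p) τ υ u → Run O (.loop k p) σ υ (t + u + 1)
  | guess (σ : StackState) (k : ℕ) (b : Bool) :
      Run O (.guess k) σ (Function.update σ k (b :: σ k)) 1
  | query_yes (σ : StackState) (k l : ℕ) :
      σ k ∈ O → Run O (.query k l) σ (Function.update σ l (true :: σ l)) 1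
  | query_no (σ : StackState) (k l : ℕ) :
      σ k ∉ O → Run O (.query k l) σ (Function.update σ l (false :: σ l)) 1

/-- Programs without nondeterministic choices and without oracle calls. -/
def StackProgram.Deterministic : StackProgram → Prop
  | .skip => True
  | .push _ _ => True
  | .pop _ => True
  | .seq p q => p.Deterministic ∧ q.Deterministic
  | .branch _ p q r => p.Deterministic ∧ q.Deterministic ∧ r.Deterministic
  | .loop _ p => p.Deterministic
  | .guess _ => False
  | .query _ _ => False

/-- The initial state: the input on stack `0`, all other stacks empty. -/
def StackState.init (w : List Bool) : StackState := fun k => if k = 0 then w else []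

/-- A halting state is accepting if the bit `true` is on top of stack `0`. -/
def StackState.Accepting (σ : StackState) : Prop := (σ 0).head? = some true

/-- The class P: languages decided by a deterministic program in polynomial time. -/
def ClassP : Set (Language Bool) :=
  {L | ∃ (p : StackProgram) (time : Polynomial ℕ), p.Deterministic ∧
    ∀ w : List Bool, ∃ (τ : StackState) (t : ℕ),
      p.Run ⊥ (StackState.init w) τ t ∧ t ≤ time.eval w.length ∧ (w ∈ L ↔ τ.Accepting)}

/-- The class NP relative to the oracle `O`: `w` belongs to the language iff some computation on
`w` accepts within a polynomial number of steps. -/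
def ClassNP (O : Language Bool) : Set (Language Bool) :=
  {L | ∃ (p : StackProgram) (time : Polynomial ℕ),
    ∀ w : List Bool, w ∈ L ↔ ∃ (τ : StackState) (t : ℕ),
      p.Run O (StackState.init w) τ t ∧ t ≤ time.eval w.length ∧ τ.Accepting}

/-- The polynomial hierarchy: `SigmaP 0 = P`, `SigmaP 1 = NP`, and the languages of
`SigmaP (n + 2)` are those in NP relative to an oracle from `SigmaP (n + 1)`. -/
def SigmaP : ℕ → Set (Language Bool)
  | 0 => ClassP
  | 1 => ClassNP ⊥
  | n + 2 => {L | ∃ O ∈ SigmaP (n + 1), L ∈ ClassNP O}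

/-! ### Self-delimiting binary encodings -/

/-- Binary digits, each preceded by `true`; closed by `false`. -/
def encodeNat (n : ℕ) : List Bool := n.bits.flatMap (fun b => [true, b]) ++ [false]

def encodeInt (z : ℤ) : List Bool := decide (z < 0) :: encodeNat z.natAbs

def encodeRat (q : ℚ) : List Bool := encodeInt q.num ++ encodeNat q.den

/-- Entries, each preceded by `true`; closed by `false`. -/
def encodeList {α : Type} (f : α → List Bool) (l : List α) : List Bool :=
  l.flatMap (fun a => true :: f a) ++ [false]

/-- The list of the given (already encoded) entries. -/
def encodeFamily {n : ℕ} (g : Fin n → List Bool) : List Bool := encodeList id (List.ofFn g)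

/-! ### Mixed-integer multilevel linear problems -/

/-- The numbers of integer and of continuous variables of each of the `s + 1` levels
(level `0` is the top level, level `i ≥ 1` is the `i`-th lower level). -/
structure LevelDims (s : ℕ) where
  nInt : Fin (s + 1) → ℕ
  nCont : Fin (s + 1) → ℕ

/-- A joint decision of all levels. -/
structure JointPoint {s : ℕ} (d : LevelDims s) where
  int : ∀ j : Fin (s + 1), Fin (d.nInt j) → ℤ
  cont : ∀ j : Fin (s + 1), Fin (d.nCont j) → ℝ

/-- A linear form with rational coefficients in the variables of all levels. -/
structure LinForm {s : ℕ} (d : LevelDims s) where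
  cInt : ∀ j : Fin (s + 1), Fin (d.nInt j) → ℚ
  cCont : ∀ j : Fin (s + 1), Fin (d.nCont j) → ℚ

/-- The value of a linear form at a joint decision. -/
noncomputable def LinForm.eval {s : ℕ} {d : LevelDims s} (c : LinForm d) (y : JointPoint d) : ℝ :=
  ∑ j, (∑ k, (c.cInt j k : ℝ) * (y.int j k : ℝ) + ∑ k, (c.cCont j k : ℝ) * y.cont j k)

/-- The linear form involves only variables of the lower levels (it is a linear function on the
space of lower-level variables). -/
def LinForm.IsLower {s : ℕ} {d : LevelDims s} (c : LinForm d) : Prop :=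
  c.cInt 0 = 0 ∧ c.cCont 0 = 0

def LinForm.encode {s : ℕ} {d : LevelDims s} (c : LinForm d) : List Bool :=
  encodeFamily (fun j => encodeFamily fun k => encodeRat (c.cInt j k)) ++
    encodeFamily (fun j => encodeFamily fun k => encodeRat (c.cCont j k))

/-- A mixed-integer multilevel linear problem with a top level and `s` lower levels, all data
rational: level `i` minimizes `obj i` subject to its linear constraints `c.1 ≤ c.2`,
`c ∈ cons i`, and to bounds on its integer variables.  The objective and the constraints of a
level may involve the variables of all levels, except that the continuous variables of a level do
not appear in the problems of the levels deciding after it. -/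
structure MIMLP (s : ℕ) where
  dims : LevelDims s
  lo : ∀ j : Fin (s + 1), Fin (dims.nInt j) → ℤ
  hi : ∀ j : Fin (s + 1), Fin (dims.nInt j) → ℤ
  obj : Fin (s + 1) → LinForm dims
  cons : Fin (s + 1) → List (LinForm dims × ℚ)
  obj_cont : ∀ i j : Fin (s + 1), j < i → (obj i).cCont j = 0
  cons_cont : ∀ i : Fin (s + 1), ∀ c ∈ cons i, ∀ j : Fin (s + 1), j < i → c.1.cCont j = 0

namespace MIMLP

variable {s : ℕ}

def encode (P : MIMLP s) : List Bool :=
  encodeFamily (fun j => encodeNat (P.dims.nInt j)) ++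
    encodeFamily (fun j => encodeNat (P.dims.nCont j)) ++
    encodeFamily (fun j => encodeFamily fun k => encodeInt (P.lo j k)) ++
    encodeFamily (fun j => encodeFamily fun k => encodeInt (P.hi j k)) ++
    encodeFamily (fun i => (P.obj i).encode) ++
    encodeFamily (fun i => encodeList (fun c => c.1.encode ++ encodeRat c.2) (P.cons i))

/-- The integer decision `x` of level `i` respects its bounds. -/
def InBox (P : MIMLP s) (i : Fin (s + 1)) (x : Fin (P.dims.nInt i) → ℤ) : Prop :=
  ∀ k, P.lo i k ≤ x k ∧ x k ≤ P.hi i k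

/-- The linear constraints of level `i`. -/
def SatisfiesCons (P : MIMLP s) (i : Fin (s + 1)) (y : JointPoint P.dims) : Prop :=
  ∀ c ∈ P.cons i, c.1.eval y ≤ (c.2 : ℝ)

/-- The two joint decisions agree on all levels deciding before level `i`. -/
def AgreeBefore (P : MIMLP s) (i : Fin (s + 1)) (y z : JointPoint P.dims) : Prop :=
  ∀ j : Fin (s + 1), j < i → y.int j = z.int j ∧ y.cont j = z.cont j

/-- `P.Feas i y`: given the decisions in `y` of the levels before `i`, the decisions in `y` of the
levels `i, i + 1, …, s` are feasible for the problem of level `i` (optimistic convention): the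
constraints of level `i` hold, and the decisions of the levels `i + 1, …, s` are optimal for the
problem of level `i + 1`. -/
def Feas (P : MIMLP s) (i : Fin (s + 1)) (y : JointPoint P.dims) : Prop :=
  P.InBox i (y.int i) ∧ P.SatisfiesCons i y ∧
    ∀ j : Fin (s + 1), j.val = i.val + 1 →
      P.Feas j y ∧ ∀ z : JointPoint P.dims, P.AgreeBefore j y z → P.Feas j z →
        (P.obj j).eval y ≤ (P.obj j).eval z
termination_by s - i.val
decreasing_by all_goals omega

/-- `y` is feasible for the canonical problem, and the top-level constraints hold for every
feasible decision `z` of the first lower level and of the levels below it whose value for the first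
lower level exceeds that of `y` by at most `δ`. -/
def NearOptFeas (P : MIMLP s) (δ : ℚ) (y : JointPoint P.dims) : Prop :=
  P.Feas 0 y ∧ ∀ z : JointPoint P.dims, P.AgreeBefore 1 y z → P.Feas 1 z →
    (P.obj 1).eval z ≤ (P.obj 1).eval y + (δ : ℝ) → P.SatisfiesCons 0 z

end MIMLP

/-! ### Decision problems of a class of multilevel problems -/

/-- The canonical multilevel problem: given a problem of the class and a bound, is there a feasible
solution whose top-level objective is at least as good as the bound? -/
def canonicalProblem {s : ℕ} (C : Set (MIMLP s)) : Language Bool :=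
  {w | ∃ P ∈ C, ∃ Γ : ℚ, w = P.encode ++ encodeRat Γ ∧
    ∃ y, P.Feas 0 y ∧ (P.obj 0).eval y ≤ (Γ : ℝ)}

/-- The near-optimal robust version: given a problem of the class, a tolerance `δ ≥ 0` and a
bound, is there a near-optimal robust solution whose objective is at least as good as the bound? -/
def nearOptRobustProblem {s : ℕ} (C : Set (MIMLP s)) : Language Bool :=
  {w | ∃ P ∈ C, ∃ δ Γ : ℚ, 0 ≤ δ ∧ w = P.encode ++ encodeRat δ ++ encodeRat Γ ∧
    ∃ y, P.NearOptFeas δ y ∧ (P.obj 0).eval y ≤ (Γ : ℝ)}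

/-- The problem of the first lower level, parameterized by a top-level decision: given a problem of
the class, the integer part `x` of a top-level decision (the continuous part does not appear in the
lower levels) and a bound, is there a feasible decision of the lower levels whose objective value
is at least as good as the bound? -/
def firstLowerProblem {s : ℕ} (C : Set (MIMLP s)) : Language Bool :=
  {w | ∃ P ∈ C, ∃ (x : Fin (P.dims.nInt 0) → ℤ) (γ : ℚ), P.InBox 0 x ∧
    w = P.encode ++ encodeFamily (fun k => encodeInt (x k)) ++ encodeRat γ ∧
    ∃ y, y.int 0 = x ∧ P.Feas 1 y ∧ (P.obj 1).eval y ≤ (γ : ℝ)}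

/-- The problem of the first lower level with an additional linear constraint `a ≤ b` and with its
objective replaced by a linear function `h` of the lower-level variables. -/
def firstLowerProblemModified {s : ℕ} (C : Set (MIMLP s)) : Language Bool :=
  {w | ∃ P ∈ C, ∃ (x : Fin (P.dims.nInt 0) → ℤ) (a : LinForm P.dims) (b : ℚ)
      (h : LinForm P.dims) (γ : ℚ), P.InBox 0 x ∧ a.IsLower ∧ h.IsLower ∧
    w = P.encode ++ encodeFamily (fun k => encodeInt (x k)) ++ a.encode ++ encodeRat b ++
      h.encode ++ encodeRat γ ∧
    ∃ y, y.int 0 = x ∧ P.Feas 1 y ∧ a.eval y ≤ (b : ℝ) ∧ h.eval y ≤ (γ : ℝ)}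

/-- The first lower level of the problems of the class `C` is in the starred class of the `r`-th
level of the polynomial hierarchy with respect to linear functions: it is in `SigmaP r`, and so is
the problem with an additional linear constraint and an arbitrary linear objective. -/
def FirstLowerInSigmaPStar (r : ℕ) {s : ℕ} (C : Set (MIMLP s)) : Prop :=
  firstLowerProblem C ∈ SigmaP r ∧ firstLowerProblemModified C ∈ SigmaP r

/-! Let O be `firstLowerProblemModified C`, a problem in Σ_s. Both problems are shown to lie in NP
relative to O: a decision y is guessed and then verified with oracle calls. This needs solutions of
polynomial size for all solvable instances, and a verification by questions to O, each of which may
impose only one extra linear constraint and one objective bound on the lower-level variables.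

Size of solutions. The continuous variables of a level are invisible to later levels, so the optimal
value of level j depends only on the integer variables decided before it (`Feas.obj_le`). Once all
integer variables are fixed, feasibility for level i is thus a linear system in the continuous
variables: the constraints of the levels from i on, and f_j ≤ (optimal value of level j) for j > i
(`feas_of_forall`). By Cramer's rule the relevant vertices have polynomially many bits
(`exists_small_vertex`). Induction from the last level upwards then bounds the bits of all optimal
values (`Feas.isSmall_obj`), and a linear function on such a system is either unbounded or does at
least as well at a small point as at a given one (`Feas.exists_bounded`). The number of levels is
fixed, so the nested bounds stay polynomial. In the robust problem each top-level constraint must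
hold for the worst near-optimal z; the worst value of its lower-level part is again a small
rational, so robustness adds one small linear constraint per top-level constraint
(`NearOptFeas.exists_solution`).

Verification. Let K be a computable number with polynomially many bits that exceeds the relevant
bounds (`PolyFun.exists_large`). Bounds and constraints of all levels are checked directly. For a
level i ≥ 2 one needs a z feasible for level 1 that has the integer variables of y and satisfies
f_i(y) ≤ f_i(z). All these integer variables are tested at once through the isolating form I, which
weights those of the lower levels by distinct powers of K: the two inequalities I(z) ≤ I(y) and
-f_i(z) - K·I(z) ≤ -f_i(y) - K·I(y) suffice, since I(z) < I(y) would make f_i(z) - f_i(y) at least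
K. Optimality for level 1 and robustness are negative answers to questions with slack 1/(K+1); a
violation, if there is one, can be found at a vertex or is unbounded, so it exceeds this slack
(`Certified.feas`, `CertifiedRobust.nearOptFeas`).

The class C is arbitrary, so membership in it cannot be tested directly; a positive answer of O
certifies it (`exists_raw_of_checkFeasible`).

On the machine side, `NPRel` and `PolyFun` form a calculus of stack programs in which a function may
be computed by guessing its value and verifying it (`PolyFun.of_graph`). This suffices for NP and
avoids division and gcd algorithms. `mem_classNP` passes from this calculus to languages. -/

/-! ### Runs of stack programs -/

namespace StackProgram

variable {O : Language Bool}

theorem run_seq_iff {p q : StackProgram} {σ υ : StackState} {t : ℕ} :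
    Run O (.seq p q) σ υ t ↔ ∃ τ t₁ t₂, Run O p σ τ t₁ ∧ Run O q τ υ t₂ ∧ t = t₁ + t₂ := by
  constructor
  · rintro (_ | _)
    exact ⟨_, _, _, ‹_›, ‹_›, rfl⟩
  · rintro ⟨τ, t₁, t₂, h₁, h₂, rfl⟩
    exact .seq _ _ _ _ _ _ _ h₁ h₂

theorem Run.push' {k : ℕ} {b : Bool} {σ τ : StackState} (h : τ = Function.update σ k (b :: σ k)) :
    Run O (.push k b) σ τ 1 := h ▸ .push σ k b

theorem Run.pop' {k : ℕ} {σ τ : StackState} (h : τ = Function.update σ k (σ k).tail) :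
    Run O (.pop k) σ τ 1 := h ▸ .pop σ k

theorem Run.seq' {p q : StackProgram} {σ τ υ : StackState} {t u : ℕ} (h₁ : Run O p σ τ t)
    (h₂ : Run O q τ υ u) : Run O (.seq p q) σ υ (t + u) := .seq _ _ _ _ _ _ _ h₁ h₂

theorem run_branch_iff {k : ℕ} {p q r : StackProgram} {σ τ : StackState} {t : ℕ} :
    Run O (.branch k p q r) σ τ t ↔ ∃ u, t = u + 1 ∧
      (((σ k).head? = none ∧ Run O p σ τ u) ∨ ((σ k).head? = some false ∧ Run O q σ τ u) ∨
        ((σ k).head? = some true ∧ Run O r σ τ u)) := by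
  constructor
  · intro h
    cases h with
    | branch_empty _ _ _ _ _ _ t h h' => exact ⟨t, rfl, .inl ⟨h, h'⟩⟩
    | branch_false _ _ _ _ _ _ t h h' => exact ⟨t, rfl, .inr (.inl ⟨h, h'⟩)⟩
    | branch_true _ _ _ _ _ _ t h h' => exact ⟨t, rfl, .inr (.inr ⟨h, h'⟩)⟩
  · rintro ⟨u, rfl, ⟨h, h'⟩ | ⟨h, h'⟩ | ⟨h, h'⟩⟩
    · exact .branch_empty _ _ _ _ _ _ _ h h'
    · exact .branch_false _ _ _ _ _ _ _ h h'
    · exact .branch_true _ _ _ _ _ _ _ h h'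

/-- Programs without nondeterministic choices. -/
def GuessFree : StackProgram → Prop
  | .skip => True
  | .push _ _ => True
  | .pop _ => True
  | .seq p q => p.GuessFree ∧ q.GuessFree
  | .branch _ p q r => p.GuessFree ∧ q.GuessFree ∧ r.GuessFree
  | .loop _ p => p.GuessFree
  | .guess _ => False
  | .query _ _ => True

/-- Turns the existence of one explicit halting run into a statement about all halting runs, which
is what soundness of a nondeterministic program requires. -/
theorem Run.unique {p : StackProgram} (hp : p.GuessFree) {σ τ τ' : StackState} {t t' : ℕ}
    (h : Run O p σ τ t) (h' : Run O p σ τ' t') : τ = τ' := by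
  induction h generalizing τ' t' with
  | skip => cases h'; rfl
  | push => cases h'; rfl
  | pop => cases h'; rfl
  | seq p q σ τ υ t u _ _ ih₁ ih₂ =>
    obtain ⟨_, _, _, h₁, h₂, _⟩ := run_seq_iff.1 h'
    obtain rfl := ih₁ hp.1 h₁
    exact ih₂ hp.2 h₂
  | branch_empty k p q r σ τ t hk _ ih =>
    obtain ⟨u, -, ⟨_, h⟩ | ⟨h, _⟩ | ⟨h, _⟩⟩ := run_branch_iff.1 h'
    · exact ih hp.1 h
    all_goals simp_all
  | branch_false k p q r σ τ t hk _ ih =>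
    obtain ⟨u, -, ⟨h, _⟩ | ⟨_, h⟩ | ⟨h, _⟩⟩ := run_branch_iff.1 h'
    · simp_all
    · exact ih hp.2.1 h
    · simp_all
  | branch_true k p q r σ τ t hk _ ih =>
    obtain ⟨u, -, ⟨h, _⟩ | ⟨h, _⟩ | ⟨_, h⟩⟩ := run_branch_iff.1 h'
    · simp_all
    · simp_all
    · exact ih hp.2.2 h
  | loop_exit k p σ hk =>
    cases h' with
    | loop_exit => rfl
    | loop_step => contradiction
  | loop_step k p σ τ υ t u hk _ _ ih₁ ih₂ =>
    cases h' with
    | loop_exit => contradiction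
    | loop_step _ _ _ _ _ _ _ _ h₁ h₂ =>
      obtain rfl := ih₁ hp h₁
      exact ih₂ hp h₂
  | guess => exact hp.elim
  | query_yes =>
    cases h' with
    | query_yes => rfl
    | query_no => contradiction
  | query_no =>
    cases h' with
    | query_yes => contradiction
    | query_no => rfl

/-! ### Stacks untouched by a program. -/

/-- The program does not touch the stack `c`. -/
def Avoids (c : ℕ) : StackProgram → Prop
  | .skip => True
  | .push k _ => k ≠ c
  | .pop k => k ≠ c
  | .seq p q => p.Avoids c ∧ q.Avoids c
  | .branch k p q r => k ≠ c ∧ p.Avoids c ∧ q.Avoids c ∧ r.Avoids c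
  | .loop k p => k ≠ c ∧ p.Avoids c
  | .guess k => k ≠ c
  | .query k l => k ≠ c ∧ l ≠ c

/-- A program mentions finitely many stacks. A fresh one serves as the flag that keeps a loop around
`p` running; `N` keeps it away from the stacks used by the surrounding code. -/
theorem exists_avoids (p : StackProgram) (N : ℕ) : ∃ c, N ≤ c ∧ p.Avoids c := by
  suffices h : ∃ M, ∀ c, M ≤ c → p.Avoids c by
    obtain ⟨M, hM⟩ := h
    exact ⟨max M N, le_max_right _ _, hM _ (le_max_left _ _)⟩
  induction p with
  | skip => exact ⟨0, fun _ _ => trivial⟩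
  | push k b => exact ⟨k + 1, fun c hc => show k ≠ c by omega⟩
  | pop k => exact ⟨k + 1, fun c hc => show k ≠ c by omega⟩
  | guess k => exact ⟨k + 1, fun c hc => show k ≠ c by omega⟩
  | query k l => exact ⟨k + l + 1, fun c hc => show k ≠ c ∧ l ≠ c by omega⟩
  | seq p q hp hq =>
    obtain ⟨M, hM⟩ := hp
    obtain ⟨N, hN⟩ := hq
    exact ⟨M + N, fun c hc => ⟨hM c (by omega), hN c (by omega)⟩⟩
  | loop k p hp =>
    obtain ⟨M, hM⟩ := hp
    exact ⟨M + k + 1, fun c hc => ⟨show k ≠ c by omega, hM c (by omega)⟩⟩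
  | branch k p q r hp hq hr =>
    obtain ⟨M, hM⟩ := hp
    obtain ⟨N, hN⟩ := hq
    obtain ⟨L, hL⟩ := hr
    exact ⟨M + N + L + k + 1, fun c hc => ⟨show k ≠ c by omega, hM c (by omega), hN c (by omega),
      hL c (by omega)⟩⟩

theorem Run.eq_of_avoids {p : StackProgram} {c : ℕ} (hp : p.Avoids c) {σ τ : StackState} {t : ℕ}
    (h : Run O p σ τ t) : τ c = σ c := by
  induction h with
  | skip => rfl
  | push σ k b => exact Function.update_of_ne (Ne.symm hp) _ _
  | pop σ k => exact Function.update_of_ne (Ne.symm hp) _ _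
  | guess σ k => exact Function.update_of_ne (Ne.symm hp) _ _
  | query_yes σ k l => exact Function.update_of_ne (Ne.symm hp.2) _ _
  | query_no σ k l => exact Function.update_of_ne (Ne.symm hp.2) _ _
  | seq _ _ _ _ _ _ _ _ _ ih₁ ih₂ => rw [ih₂ hp.2, ih₁ hp.1]
  | branch_empty _ _ _ _ _ _ _ _ _ ih => exact ih hp.2.1
  | branch_false _ _ _ _ _ _ _ _ _ ih => exact ih hp.2.2.1
  | branch_true _ _ _ _ _ _ _ _ _ ih => exact ih hp.2.2.2
  | loop_exit => rfl
  | loop_step _ _ _ _ _ _ _ _ _ _ ih₁ ih₂ => rw [ih₂ hp, ih₁ hp.2]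

theorem Run.frame {p : StackProgram} {c : ℕ} (hp : p.Avoids c) {σ τ : StackState} {t : ℕ}
    (h : Run O p σ τ t) (v : List Bool) :
    Run O p (Function.update σ c v) (Function.update τ c v) t := by
  induction h with
  | skip => exact .skip _
  | push σ k b =>
    refine .push' ?_
    rw [Function.update_of_ne hp, Function.update_comm (Ne.symm hp)]
  | pop σ k =>
    refine .pop' ?_
    rw [Function.update_of_ne hp, Function.update_comm (Ne.symm hp)]
  | guess σ k b =>
    rw [Function.update_comm hp]
    convert Run.guess (O := O) (Function.update σ c v) k b using 3
    rw [Function.update_of_ne hp]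
  | query_yes σ k l h =>
    rw [Function.update_comm hp.2]
    convert Run.query_yes (O := O) (Function.update σ c v) k l ?_ using 3
    · rw [Function.update_of_ne hp.2]
    · rwa [Function.update_of_ne hp.1]
  | query_no σ k l h =>
    rw [Function.update_comm hp.2]
    convert Run.query_no (O := O) (Function.update σ c v) k l ?_ using 3
    · rw [Function.update_of_ne hp.2]
    · rwa [Function.update_of_ne hp.1]
  | seq _ _ _ _ _ _ _ _ _ ih₁ ih₂ => exact .seq' (ih₁ hp.1) (ih₂ hp.2)
  | branch_empty _ _ _ _ _ _ _ h _ ih =>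
    exact .branch_empty _ _ _ _ _ _ _ (by rwa [Function.update_of_ne hp.1]) (ih hp.2.1)
  | branch_false _ _ _ _ _ _ _ h _ ih =>
    exact .branch_false _ _ _ _ _ _ _ (by rwa [Function.update_of_ne hp.1]) (ih hp.2.2.1)
  | branch_true _ _ _ _ _ _ _ h _ ih =>
    exact .branch_true _ _ _ _ _ _ _ (by rwa [Function.update_of_ne hp.1]) (ih hp.2.2.2)
  | loop_exit _ _ _ h => exact .loop_exit _ _ _ (by rwa [Function.update_of_ne hp.1])
  | loop_step _ _ _ _ _ _ _ h _ _ ih₁ ih₂ =>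
    exact .loop_step _ _ _ _ _ _ _ (by rwa [Function.update_of_ne hp.1]) (ih₁ hp.2) (ih₂ hp)

/-! ### Transferring and clearing stacks. -/

/-- Move the content of stack `i` to stack `j`, reversing it. -/
def pour (i j : ℕ) : StackProgram :=
  .loop i (.branch i .skip (.seq (.pop i) (.push j false)) (.seq (.pop i) (.push j true)))

theorem Run.congr {p : StackProgram} {σ τ τ' : StackState} {t t' : ℕ} (h : Run O p σ τ t)
    (hτ : τ = τ') (ht : t = t') : Run O p σ τ' t' := hτ ▸ ht ▸ h

theorem pour_run {i j : ℕ} (hij : i ≠ j) (l : List Bool) : ∀ σ : StackState, σ i = l →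
    Run O (pour i j) σ (Function.update (Function.update σ i []) j (l.reverse ++ σ j))
      (4 * l.length + 1) := by
  induction l with
  | nil =>
    intro σ h
    have h' : Function.update σ i [] = σ := by rw [← h, Function.update_eq_self]
    exact (Run.loop_exit (O := O) i _ σ h).congr (by simp [h']) (by simp)
  | cons b l ih =>
    intro σ h
    have h₁ := ih (Function.update (Function.update σ i l) j (b :: σ j)) (by simp [hij])
    refine (Run.loop_step i _ σ _ _ 3 _ (by simp [h]) ?_ h₁).congr ?_ (by simp; ring)
    · have h₂ : ∀ b', b' = b → Run O (.seq (.pop i) (.push j b')) σ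
          (Function.update (Function.update σ i l) j (b :: σ j)) 2 := by
        rintro b' rfl
        exact .seq' (.pop' rfl) (.push' (by simp [h, hij.symm]))
      cases b
      · exact .branch_false _ _ _ _ _ _ 2 (by simp [h]) (h₂ _ rfl)
      · exact .branch_true _ _ _ _ _ _ 2 (by simp [h]) (h₂ _ rfl)
    · funext k
      by_cases hj : k = j
      · subst hj; simp
      · by_cases hi : k = i
        · subst hi; simp [hij]
        · simp [hi, hj]

/-- Move the content of stack `i` to the stacks `j` and `k`, reversing it. -/
def pour₂ (i j k : ℕ) : StackProgram :=
  .loop i (.branch i .skip (.seq (.pop i) (.seq (.push j false) (.push k false)))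
    (.seq (.pop i) (.seq (.push j true) (.push k true))))

theorem pour₂_run {i j k : ℕ} (hij : i ≠ j) (hik : i ≠ k) (hjk : j ≠ k) (l : List Bool) :
    ∀ σ : StackState, σ i = l →
    Run O (pour₂ i j k) σ (Function.update (Function.update (Function.update σ i []) j
      (l.reverse ++ σ j)) k (l.reverse ++ σ k)) (5 * l.length + 1) := by
  induction l with
  | nil =>
    intro σ h
    have h' : Function.update σ i [] = σ := by rw [← h, Function.update_eq_self]
    exact (Run.loop_exit (O := O) i _ σ h).congr (by simp [h']) (by simp)
  | cons b l ih =>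
    intro σ h
    have h₁ := ih (Function.update (Function.update (Function.update σ i l) j (b :: σ j)) k
      (b :: σ k)) (by simp [hij, hik])
    refine (Run.loop_step i _ σ _ _ 4 _ (by simp [h]) ?_ h₁).congr ?_ (by simp; ring)
    · have h₂ : ∀ b', b' = b →
          Run O (.seq (.pop i) (.seq (.push j b') (.push k b'))) σ
          (Function.update (Function.update (Function.update σ i l) j (b :: σ j)) k
            (b :: σ k)) 3 := by
        rintro b' rfl
        exact .seq' (.pop' rfl) (.seq' (.push' rfl)
          (.push' (by simp [h, hij.symm, hik.symm, hjk.symm])))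
      cases b
      · exact .branch_false _ _ _ _ _ _ 3 (by simp [h]) (h₂ _ rfl)
      · exact .branch_true _ _ _ _ _ _ 3 (by simp [h]) (h₂ _ rfl)
    · funext m
      by_cases hk : m = k
      · subst hk; simp [hjk]
      · by_cases hj : m = j
        · subst hj; simp [hjk]
        · by_cases hi : m = i
          · subst hi; simp [hij, hik]
          · simp [hi, hj, hk]

/-- Empty stack `i`. -/
def clear (i : ℕ) : StackProgram := .loop i (.pop i)

theorem clear_run {i : ℕ} (l : List Bool) : ∀ σ : StackState, σ i = l →
    Run O (clear i) σ (Function.update σ i []) (2 * l.length + 1) := by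
  induction l with
  | nil =>
    intro σ h
    exact (Run.loop_exit (O := O) i _ σ h).congr (by simp [← h]) (by simp)
  | cons b l ih =>
    intro σ h
    have h₁ := ih (Function.update σ i l) (by simp)
    exact (Run.loop_step i _ σ _ _ 1 _ (by simp [h]) (.pop' (by simp [h])) h₁).congr
      (by simp) (by simp; ring)

/-- A program that never halts. -/
def diverge : StackProgram := .seq (.push 1 true) (.loop 1 .skip)

theorem not_run_diverge {σ τ : StackState} {t : ℕ} : ¬ Run O diverge σ τ t := by
  intro h
  obtain ⟨ρ, t₁, t₂, h₁, h₂, -⟩ := run_seq_iff.1 h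
  have hρ : ρ 1 ≠ [] := by cases h₁; simp
  clear h h₁
  generalize hp : StackProgram.loop 1 .skip = p at h₂
  induction h₂ with
  | loop_exit => cases hp; contradiction
  | loop_step k p σ τ υ t u _ h₁ _ _ ih =>
    cases hp
    cases h₁
    exact ih hρ rfl
  | _ => cases hp

/-- The state with given contents of the first four stacks. -/
def stk (a b c d : List Bool) : StackState
  | 0 => a
  | 1 => b
  | 2 => c
  | 3 => d
  | _ => []

section
variable (a b c d x : List Bool)
@[simp] theorem stk_zero : stk a b c d 0 = a := rfl
@[simp] theorem stk_one : stk a b c d 1 = b := rfl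
@[simp] theorem stk_two : stk a b c d 2 = c := rfl
@[simp] theorem stk_three : stk a b c d 3 = d := rfl
@[simp] theorem stk_update_zero : Function.update (stk a b c d) 0 x = stk x b c d := by
  funext k; rcases k with _ | _ | _ | _ | k <;> rfl
@[simp] theorem stk_update_one : Function.update (stk a b c d) 1 x = stk a x c d := by
  funext k; rcases k with _ | _ | _ | _ | k <;> rfl
@[simp] theorem stk_update_two : Function.update (stk a b c d) 2 x = stk a b x d := by
  funext k; rcases k with _ | _ | _ | _ | k <;> rfl
@[simp] theorem stk_update_three : Function.update (stk a b c d) 3 x = stk a b c x := by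
  funext k; rcases k with _ | _ | _ | _ | k <;> rfl

theorem stk_of_le {k : ℕ} (hk : 4 ≤ k) : stk a b c d k = [] := by
  obtain ⟨k, rfl⟩ := Nat.exists_eq_add_of_le' hk
  rfl

theorem init_eq_stk : StackState.init a = stk a [] [] [] := by
  funext k; rcases k with _ | _ | _ | _ | k <;> rfl
end

section
variable (a b c d : List Bool)

theorem pour_one_two : Run O (pour 1 2) (stk a b c d) (stk a [] (b.reverse ++ c) d)
    (4 * b.length + 1) := by
  simpa using pour_run (O := O) (i := 1) (j := 2) (by decide) b (stk a b c d) rfl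

theorem pour_two_three : Run O (pour 2 3) (stk a b c d) (stk a b [] (c.reverse ++ d))
    (4 * c.length + 1) := by
  simpa using pour_run (O := O) (i := 2) (j := 3) (by decide) c (stk a b c d) rfl

theorem pour_three_zero : Run O (pour 3 0) (stk a b c d) (stk (d.reverse ++ a) b c [])
    (4 * d.length + 1) := by
  simpa using pour_run (O := O) (i := 3) (j := 0) (by decide) d (stk a b c d) rfl

theorem pour_one_zero : Run O (pour 1 0) (stk a b c d) (stk (b.reverse ++ a) [] c d)
    (4 * b.length + 1) := by
  simpa using pour_run (O := O) (i := 1) (j := 0) (by decide) b (stk a b c d) rfl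

theorem pour_two_one : Run O (pour 2 1) (stk a b c d) (stk a (c.reverse ++ b) [] d)
    (4 * c.length + 1) := by
  simpa using pour_run (O := O) (i := 2) (j := 1) (by decide) c (stk a b c d) rfl

theorem pour₂_one_zero_two : Run O (pour₂ 1 0 2) (stk a b c d)
    (stk (b.reverse ++ a) [] (b.reverse ++ c) d) (5 * b.length + 1) := by
  simpa using pour₂_run (O := O) (i := 1) (j := 0) (k := 2) (by decide) (by decide) (by decide) b
    (stk a b c d) rfl

theorem clear_one : Run O (clear 1) (stk a b c d) (stk a [] c d) (2 * b.length + 1) := by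
  simpa using clear_run (O := O) (i := 1) b (stk a b c d) rfl

theorem clear_two : Run O (clear 2) (stk a b c d) (stk a b [] d) (2 * c.length + 1) := by
  simpa using clear_run (O := O) (i := 2) c (stk a b c d) rfl

end

end StackProgram

/-! ### Prefix-free codes that can be read off a stack. -/

section

open StackProgram

theorem Polynomial.eval_le_eval_of_le (p : Polynomial ℕ) {a b : ℕ} (h : a ≤ b) :
    p.eval a ≤ p.eval b := by
  rw [Polynomial.eval_eq_sum, Polynomial.eval_eq_sum]
  exact Finset.sum_le_sum fun i _ => Nat.mul_le_mul_left _ (Nat.pow_le_pow_left h i)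

/-- Types with a prefix-free binary encoding whose code words can be read off a stack. -/
class StackData (α : Type) where
  enc : α → List Bool
  enc_inj : ∀ {a b : α} {r r' : List Bool}, enc a ++ r = enc b ++ r' → a = b ∧ r = r'
  exists_mover : ∃ p : StackProgram, p.GuessFree ∧ ∃ T : Polynomial ℕ,
    ∀ (O : Language Bool) (a : α) (r s u v : List Bool), ∃ t ≤ T.eval (enc a).length,
      Run O p (stk (enc a ++ r) s u v) (stk r ((enc a).reverse ++ s) u v) t

namespace StackData

variable {α β : Type} [StackData α] [StackData β]

/-- The length of the code word. -/
def sz (a : α) : ℕ := (enc a).length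

theorem enc_injective : Function.Injective (enc : α → List Bool) := fun a b h =>
  (enc_inj (r := []) (r' := []) (by simpa using h)).1

/-- An encoding obtained from an injection. -/
@[reducible] def induced {α β : Type} [StackData β] (f : α → β) (hf : Function.Injective f) : StackData α where
  enc a := enc (f a)
  enc_inj h := ⟨hf (enc_inj h).1, (enc_inj h).2⟩
  exists_mover := by
    obtain ⟨p, hp, T, h⟩ := exists_mover (α := β)
    exact ⟨p, hp, T, fun O a => h O (f a)⟩

instance : StackData Unit where
  enc _ := []
  enc_inj h := ⟨rfl, by simpa using h⟩
  exists_mover := ⟨.skip, trivial, 1, fun O a r s u v => ⟨1, by simp, .skip _⟩⟩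

theorem run_move_bit {O : Language Bool} (b : Bool) (r s u v : List Bool) :
    Run O (.branch 0 .skip (.seq (.pop 0) (.push 1 false)) (.seq (.pop 0) (.push 1 true)))
      (stk (b :: r) s u v) (stk r (b :: s) u v) 3 := by
  have h : ∀ b', Run O (.seq (.pop 0) (.push 1 b'))
      (stk (b :: r) s u v) (stk r (b' :: s) u v) 2 := fun b' =>
    .seq' (.pop' rfl) (.push' (by simp))
  cases b
  · exact .branch_false _ _ _ _ _ _ 2 (by simp) (h _)
  · exact .branch_true _ _ _ _ _ _ 2 (by simp) (h _)

instance : StackData Bool where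
  enc b := [b]
  enc_inj h := by simpa using h
  exists_mover := ⟨.branch 0 .skip (.seq (.pop 0) (.push 1 false)) (.seq (.pop 0) (.push 1 true)),
    by simp [GuessFree], 3, fun O b r s u v => ⟨3, by simp, by simpa using run_move_bit b r s u v⟩⟩

instance : StackData (α × β) where
  enc a := enc a.1 ++ enc a.2
  enc_inj h := by
    rw [List.append_assoc, List.append_assoc] at h
    obtain ⟨h₁, h⟩ := enc_inj h
    obtain ⟨h₂, h⟩ := enc_inj h
    exact ⟨Prod.ext h₁ h₂, h⟩
  exists_mover := by
    obtain ⟨p, hp, T, h⟩ := exists_mover (α := α)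
    obtain ⟨q, hq, U, h'⟩ := exists_mover (α := β)
    refine ⟨.seq p q, ⟨hp, hq⟩, T + U, fun O a r s u v => ?_⟩
    obtain ⟨t, ht, h⟩ := h O a.1 (enc a.2 ++ r) s u v
    obtain ⟨t', ht', h'⟩ := h' O a.2 r ((enc a.1).reverse ++ s) u v
    refine ⟨t + t', ?_, ?_⟩
    · rw [Polynomial.eval_add]
      exact Nat.add_le_add (ht.trans (Polynomial.eval_le_eval_of_le _ (by simp)))
        (ht'.trans (Polynomial.eval_le_eval_of_le _ (by simp)))
    · simpa using Run.seq' h h'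

instance : StackData (α ⊕ β) where
  enc := Sum.elim (fun a => true :: enc a) (fun b => false :: enc b)
  enc_inj := by
    rintro (a | a) (b | b) r r' h
    · simpa using enc_inj (List.cons.inj h).2
    · simp at h
    · simp at h
    · simpa using enc_inj (List.cons.inj h).2
  exists_mover := by
    obtain ⟨p, hp, T, h⟩ := exists_mover (α := α)
    obtain ⟨q, hq, U, h'⟩ := exists_mover (α := β)
    refine ⟨.branch 0 .skip (.seq (.pop 0) (.seq (.push 1 false) q))
      (.seq (.pop 0) (.seq (.push 1 true) p)), by simp [GuessFree, hp, hq], T + U + 3, ?_⟩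
    rintro O (a | a) r s u v
    · obtain ⟨t, ht, h⟩ := h O a r (true :: s) u v
      refine ⟨1 + (1 + t) + 1, ?_, .branch_true _ _ _ _ _ _ _ (by simp)
        (.seq' (.pop' rfl) (.seq' (.push' rfl) ?_))⟩
      · have := T.eval_le_eval_of_le (Nat.le_succ (enc a).length)
        simp only [Nat.succ_eq_add_one] at this
        simp; omega
      · simpa using h
    · obtain ⟨t, ht, h⟩ := h' O a r (false :: s) u v
      refine ⟨1 + (1 + t) + 1, ?_, .branch_false _ _ _ _ _ _ _ (by simp)
        (.seq' (.pop' rfl) (.seq' (.push' rfl) ?_))⟩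
      · have := U.eval_le_eval_of_le (Nat.le_succ (enc a).length)
        simp only [Nat.succ_eq_add_one] at this
        simp; omega
      · simpa using h

theorem encodeList_nil {α : Type} (f : α → List Bool) : encodeList f [] = [false] := rfl

theorem encodeList_cons {α : Type} (f : α → List Bool) (a : α) (l : List α) :
    encodeList f (a :: l) = true :: (f a ++ encodeList f l) := by
  simp [encodeList]

theorem length_lt_length_encodeList {α : Type} (f : α → List Bool) (l : List α) :
    l.length < (encodeList f l).length := by
  induction l with
  | nil => simp [encodeList_nil]
  | cons a l ih => simp [encodeList_cons]; omega

instance : StackData (List α) where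
  enc := encodeList enc
  enc_inj := by
    intro a
    induction a with
    | nil => rintro (_ | ⟨b, l⟩) r r' h <;> simp_all [encodeList_nil, encodeList_cons]
    | cons a k ih =>
      rintro (_ | ⟨b, l⟩) r r' h
      · simp [encodeList_nil, encodeList_cons] at h
      · simp only [encodeList_cons, List.cons_append, List.append_assoc, List.cons.injEq,
          true_and] at h
        obtain ⟨rfl, h'⟩ := enc_inj h
        obtain ⟨rfl, rfl⟩ := ih h'
        simp
  exists_mover := by
    obtain ⟨p, hp, T, h⟩ := exists_mover (α := α)
    -- The loop is driven by a flag on a fresh stack, not by stack 0, where the rest `r` follows the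
    -- code word; the closing `false` removes the flag.
    obtain ⟨c, hc, hpc⟩ := p.exists_avoids 4
    refine ⟨.seq (.push c true) (.loop c (.branch 0 .skip
      (.seq (.pop 0) (.seq (.push 1 false) (.pop c)))
      (.seq (.pop 0) (.seq (.push 1 true) p)))), by simp [GuessFree, hp],
      Polynomial.X * (T + 4) + 7, fun O l r s u v => ?_⟩
    have key : ∀ (N : ℕ) (l : List α) (s : List Bool), (encodeList enc l).length ≤ N →
        ∃ t ≤ l.length * (T.eval N + 4) + 6, Run O (.loop c (.branch 0 .skip
          (.seq (.pop 0) (.seq (.push 1 false) (.pop c)))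
          (.seq (.pop 0) (.seq (.push 1 true) p))))
          (Function.update (stk (encodeList enc l ++ r) s u v) c [true])
          (stk r ((encodeList enc l).reverse ++ s) u v) t := by
      intro N l
      have c0 : c ≠ 0 := by omega
      have c1 : c ≠ 1 := by omega
      induction l with
      | nil =>
        intro s hN
        refine ⟨_, ?_, .loop_step _ _ _ (stk r (false :: s) u v) _ 4 1 (by simp)
          (.branch_false _ _ _ _ _ _ _ ?_ (.seq' (.pop' rfl) (.seq' (.push' rfl) (.pop' ?_))))
          (.loop_exit _ _ _ (stk_of_le _ _ _ _ hc))⟩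
        · simp
        · simp [encodeList_nil, c0.symm]
        · simp only [encodeList_nil, ne_eq, c0.symm, not_false_eq_true, Function.update_of_ne,
            stk_zero, c1.symm, c1, Function.update_self, Function.update_comm c0,
            Function.update_comm c1, stk_update_zero, stk_update_one, stk_one, one_ne_zero, Function.update_idem, List.tail, List.cons_append, List.nil_append]
          rw [← stk_of_le r (false :: s) u v hc, Function.update_eq_self]
      | cons a l ih =>
        intro s hN
        obtain ⟨t, ht, h₁⟩ := h O a (encodeList enc l ++ r) (true :: s) u v
        obtain ⟨t', ht', h₂⟩ := ih ((enc a).reverse ++ true :: s)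
          (le_trans (by simp [encodeList_cons]; omega) hN)
        refine ⟨1 + (1 + t) + 1 + t' + 1, ?_, ?_⟩
        · have := T.eval_le_eval_of_le (a := (enc a).length) (b := N)
            (le_trans (by simp [encodeList_cons]; omega) hN)
          rw [List.length_cons, add_mul, one_mul]
          omega
        · refine .loop_step _ _ _ _ _ _ _ (by simp)
            (.branch_true _ _ _ _ _ _ _ ?_ (.seq' (.pop' rfl) (.seq' (.push' rfl) ?_)))
            (h₂.congr ?_ rfl)
          · simp [encodeList_cons, c0.symm]
          · convert h₁.frame hpc [true] using 1
            simp [encodeList_cons, c0.symm, c1.symm, Function.update_comm c0,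
              Function.update_comm c1]
          · simp [encodeList_cons]
    obtain ⟨t, ht, h⟩ := key _ l s le_rfl
    refine ⟨1 + t, ?_, .seq' (.push' (by rw [stk_of_le _ _ _ _ hc])) h⟩
    have h₁ := Nat.mul_le_mul_right (T.eval (encodeList enc l).length + 4)
      (length_lt_length_encodeList enc l).le
    simp
    omega

end StackData

end

/-! ### Relations and functions computed by nondeterministic programs. -/

set_option linter.unusedSectionVars false

section

open StackProgram StackData

variable {O : Language Bool} {α β γ δ : Type}
  [StackData α] [StackData β] [StackData γ] [StackData δ]

theorem StackProgram.Run.length_le {O : Language Bool} {p : StackProgram} {σ τ : StackState}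
    {t : ℕ} (h : Run O p σ τ t) (k : ℕ) : (τ k).length ≤ (σ k).length + t := by
  induction h with
  | skip => simp
  | push σ j b => by_cases h : k = j <;> [subst h; skip] <;> simp [*]
  | pop σ j => by_cases h : k = j <;> [subst h; skip] <;> simp [*]; omega
  | guess σ j b => by_cases h : k = j <;> [subst h; skip] <;> simp [*]
  | query_yes σ i j _ => by_cases h : k = j <;> [subst h; skip] <;> simp [*]
  | query_no σ i j _ => by_cases h : k = j <;> [subst h; skip] <;> simp [*]
  | loop_exit => simp
  | _ => omega

/-- The relation `R` is computed by a nondeterministic program acting on the top of stack `0`: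
the results of the halting computations on `a` are exactly the `b` with `R a b`, and each of them is
reached in time polynomial in the sizes of `a` and `b`. -/
def NPRel (O : Language Bool) {α β : Type} [StackData α] [StackData β] (R : α → β → Prop) : Prop :=
  ∃ (p : StackProgram) (T : Polynomial ℕ), ∀ (a : α) (r : List Bool),
    (∀ τ t, Run O p (.init (enc a ++ r)) τ t → ∃ b, R a b ∧ τ = .init (enc b ++ r)) ∧
    ∀ b, R a b → ∃ t ≤ T.eval (sz a + sz b), Run O p (.init (enc a ++ r)) (.init (enc b ++ r)) t

/-- The function `f` is computable in (unambiguous nondeterministic) polynomial time. -/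
@[fun_prop]
def PolyFun (O : Language Bool) {α β : Type} [StackData α] [StackData β] (f : α → β) : Prop :=
  NPRel O (fun a b => b = f a) ∧ ∃ Q : Polynomial ℕ, ∀ a, sz (f a) ≤ Q.eval (sz a)

/-- The predicate `P` is recognized by a nondeterministic polynomial time program. -/
def NPPred (O : Language Bool) {α : Type} [StackData α] (P : α → Prop) : Prop :=
  NPRel O (fun a (_ : Unit) => P a)

/-- Every element of the type can be guessed in polynomial time. -/
class Guessable (O : Language Bool) (α : Type) [StackData α] : Prop where
  guess : NPRel O (fun (_ : Unit) (_ : α) => True)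

namespace NPRel

theorem congr {R S : α → β → Prop} (h : NPRel O R) (hRS : ∀ a b, R a b ↔ S a b) : NPRel O S := by
  have : R = S := funext fun a => funext fun b => propext (hRS a b)
  exact this ▸ h

/-- The running time depends on the guessed intermediate result. Only the existence of one fast run
is demanded, so it is enough that a pair in the composite has some intermediate result of polynomial
size. -/
theorem comp {R : α → β → Prop} {S : β → γ → Prop} (hR : NPRel O R) (hS : NPRel O S)
    (Q : Polynomial ℕ) (hQ : ∀ a b c, R a b → S b c →
      ∃ b', R a b' ∧ S b' c ∧ sz b' ≤ Q.eval (sz a + sz c)) :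
    NPRel O (fun a c => ∃ b, R a b ∧ S b c) := by
  obtain ⟨p, T, hp⟩ := hR
  obtain ⟨q, U, hq⟩ := hS
  refine ⟨.seq p q, T.comp (Polynomial.X + Q) + U.comp (Polynomial.X + Q), fun a r => ⟨?_, ?_⟩⟩
  · intro τ t h
    obtain ⟨ρ, t₁, t₂, h₁, h₂, -⟩ := run_seq_iff.1 h
    obtain ⟨b, hb, rfl⟩ := (hp a r).1 _ _ h₁
    obtain ⟨c, hc, rfl⟩ := (hq b r).1 _ _ h₂
    exact ⟨c, ⟨b, hb, hc⟩, rfl⟩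
  · rintro c ⟨b, hb, hc⟩
    obtain ⟨b, hb, hc, hs⟩ := hQ a b c hb hc
    obtain ⟨t₁, ht₁, h₁⟩ := (hp a r).2 b hb
    obtain ⟨t₂, ht₂, h₂⟩ := (hq b r).2 c hc
    refine ⟨t₁ + t₂, ?_, .seq' h₁ h₂⟩
    simp only [Polynomial.eval_add, Polynomial.eval_comp, Polynomial.eval_X]
    exact Nat.add_le_add (ht₁.trans (Polynomial.eval_le_eval_of_le _ (by omega)))
      (ht₂.trans (Polynomial.eval_le_eval_of_le _ (by omega)))

/-- The same program works: the code of the second component is absorbed into the rest of stack 0,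
about which `NPRel` is uniform. -/
theorem first {R : α → β → Prop} (h : NPRel O R) :
    NPRel O (fun (x : α × γ) (y : β × γ) => R x.1 y.1 ∧ y.2 = x.2) := by
  obtain ⟨p, T, hp⟩ := h
  refine ⟨p, T, fun x r => ⟨fun τ t h => ?_, ?_⟩⟩
  · obtain ⟨b, hb, rfl⟩ := (hp x.1 (enc x.2 ++ r)).1 τ t (by simpa [enc] using h)
    exact ⟨(b, x.2), ⟨hb, rfl⟩, by simp [enc]⟩
  · rintro ⟨b, c⟩ ⟨hb, rfl⟩
    obtain ⟨t, ht, h⟩ := (hp x.1 (enc x.2 ++ r)).2 b hb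
    refine ⟨t, ht.trans (Polynomial.eval_le_eval_of_le _ ?_), by simpa [enc] using h⟩
    simp [sz, enc]
    omega

theorem sum {R : α → γ → Prop} {S : β → γ → Prop} (hR : NPRel O R) (hS : NPRel O S) :
    NPRel O (fun (x : α ⊕ β) => Sum.elim R S x) := by
  obtain ⟨p, T, hp⟩ := hR
  obtain ⟨q, U, hq⟩ := hS
  refine ⟨.branch 0 .skip (.seq (.pop 0) q) (.seq (.pop 0) p), T + U + 2, fun x r => ⟨?_, ?_⟩⟩
  · intro τ t h
    obtain ⟨u, -, h⟩ := run_branch_iff.1 h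
    obtain x | x := x
    · obtain ⟨ρ, t₁, t₂, h₁, h₂, -⟩ := run_seq_iff.1
        (by simpa [enc, StackState.init] using h : Run O (.seq (.pop 0) p) _ _ _)
      cases h₁
      exact (hp x r).1 _ _ (by simpa [enc, init_eq_stk] using h₂)
    · obtain ⟨ρ, t₁, t₂, h₁, h₂, -⟩ := run_seq_iff.1
        (by simpa [enc, StackState.init] using h : Run O (.seq (.pop 0) q) _ _ _)
      cases h₁
      exact (hq x r).1 _ _ (by simpa [enc, init_eq_stk] using h₂)
  · intro c hc
    obtain x | x := x
    · obtain ⟨t, ht, h⟩ := (hp x r).2 c hc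
      refine ⟨1 + t + 1, ?_, .branch_true _ _ _ _ _ _ _ rfl (.seq' (.pop' rfl) ?_)⟩
      · have := T.eval_le_eval_of_le (a := sz x + sz c) (b := sz (Sum.inl x : α ⊕ β) + sz c)
          (by simp [sz, enc])
        simp; omega
      · simpa [enc, init_eq_stk] using h
    · obtain ⟨t, ht, h⟩ := (hq x r).2 c hc
      refine ⟨1 + t + 1, ?_, .branch_false _ _ _ _ _ _ _ rfl (.seq' (.pop' rfl) ?_)⟩
      · have := U.eval_le_eval_of_le (a := sz x + sz c) (b := sz (Sum.inr x : α ⊕ β) + sz c)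
          (by simp [sz, enc])
        simp; omega
      · simpa [enc, init_eq_stk] using h

theorem false : NPRel O (fun (_ : α) (_ : β) => False) :=
  ⟨diverge, 0, fun _ _ => ⟨fun _ _ h => (not_run_diverge h).elim, fun _ h => h.elim⟩⟩

end NPRel

/-- The output size needs no separate hypothesis, since each step lengthens a stack by at most one
bit. -/
theorem PolyFun.of_run {f : α → β} (p : StackProgram) (hp : p.GuessFree) (T : Polynomial ℕ)
    (h : ∀ a r, ∃ t ≤ T.eval (sz a),
      Run O p (stk (enc a ++ r) [] [] []) (stk (enc (f a) ++ r) [] [] []) t) : PolyFun O f := by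
  simp only [← init_eq_stk] at h
  refine ⟨⟨p, T, fun a r => ⟨fun τ t h' => ?_, ?_⟩⟩, Polynomial.X + T, fun a => ?_⟩
  · obtain ⟨u, -, hu⟩ := h a r
    exact ⟨_, rfl, h'.unique hp hu⟩
  · rintro _ rfl
    obtain ⟨u, hu, hu'⟩ := h a r
    exact ⟨u, hu.trans (Polynomial.eval_le_eval_of_le _ (by omega)), hu'⟩
  · obtain ⟨u, hu, hu'⟩ := h a []
    have := hu'.length_le 0
    simp only [StackState.init, List.append_nil, if_true] at this
    simp [sz] at hu ⊢
    omega

/-- A function that does not change the encoding. -/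
theorem PolyFun.of_enc_eq {f : α → β} (h : ∀ a, enc (f a) = enc a) : PolyFun O f :=
  .of_run .skip trivial 1 fun a r => ⟨1, by simp, by rw [h]; exact .skip _⟩


@[fun_prop]
theorem PolyFun.id : PolyFun O (fun a : α => a) := .of_enc_eq fun _ => rfl

theorem NPRel.comap {R : β → γ → Prop} (hR : NPRel O R) {f : α → β} (hf : PolyFun O f) :
    NPRel O (fun a c => R (f a) c) := by
  obtain ⟨h, Q, hQ⟩ := hf
  refine (h.comp hR Q ?_).congr fun a c => by simp
  rintro a _ c rfl h
  exact ⟨_, rfl, h, (hQ a).trans (Q.eval_le_eval_of_le (by omega))⟩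

@[fun_prop]
theorem PolyFun.comp {g : β → γ} {f : α → β} (hg : PolyFun O g) (hf : PolyFun O f) :
    PolyFun O (fun a => g (f a)) := by
  refine ⟨hg.1.comap hf, ?_⟩
  obtain ⟨-, Q, hQ⟩ := hf
  obtain ⟨-, Q', hQ'⟩ := hg
  refine ⟨Q'.comp Q, fun a => ?_⟩
  rw [Polynomial.eval_comp]
  exact (hQ' _).trans (Q'.eval_le_eval_of_le (hQ a))

namespace PolyFun

theorem first {f : α → β} (h : PolyFun O f) : PolyFun O (fun x : α × γ => (f x.1, x.2)) := by
  obtain ⟨h, Q, hQ⟩ := h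
  refine ⟨h.first.congr fun x y => by rw [Prod.ext_iff], Q + .X, fun a => ?_⟩
  have h₁ := hQ a.1
  have h₂ := Q.eval_le_eval_of_le (a := sz a.1) (b := sz a) (by simp [sz, enc])
  simp [sz, enc] at *
  omega

theorem dup : PolyFun O (fun a : α => (a, a)) := by
  obtain ⟨p, hp, T, h⟩ := exists_mover (α := α)
  refine .of_run (.seq p (.seq (pour₂ 1 0 2) (.seq (pour 2 1) (pour 1 0))))
    (by simp [GuessFree, hp, pour, pour₂]) (T + 13 * .X + 3) fun a r => ?_
  obtain ⟨t, ht, h⟩ := h O a r [] [] []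
  refine ⟨_, ?_, .seq' h (.seq' (pour₂_one_zero_two _ _ _ _) (.seq' (pour_two_one _ _ _ _)
    ((pour_one_zero _ _ _ _).congr (by simp [enc]) rfl)))⟩
  simp [sz]
  omega

/-- Every transfer reverses. The first code word passes through the stacks 1, 2 and 3 and returns to
stack 0 in its original order; the second waits reversed on stack 1 and is put on top last. -/
theorem swap : PolyFun O (fun a : α × β => (a.2, a.1)) := by
  obtain ⟨p, hp, T, h⟩ := exists_mover (α := α)
  obtain ⟨q, hq, U, h'⟩ := exists_mover (α := β)
  refine .of_run (.seq p (.seq (pour 1 2) (.seq q (.seq (pour 2 3) (.seq (pour 3 0) (pour 1 0))))))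
    (by simp [GuessFree, hp, hq, pour]) (T + U + 16 * .X + 4) fun a r => ?_
  obtain ⟨t, ht, h⟩ := h O a.1 (enc a.2 ++ r) [] [] []
  obtain ⟨u, hu, h'⟩ := h' O a.2 r [] (enc a.1) []
  have h₁ := T.eval_le_eval_of_le (a := (enc a.1).length) (b := sz a) (by simp [sz, enc])
  have h₂ := U.eval_le_eval_of_le (a := (enc a.2).length) (b := sz a) (by simp [sz, enc])
  refine ⟨_, ?_, .seq' (by simpa [enc] using h) (.seq' ((pour_one_two _ _ _ _).congr
    (τ' := stk (enc a.2 ++ r) [] (enc a.1) []) (by simp) rfl) (.seq' h' (.seq'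
    (pour_two_three _ _ _ _) (.seq' (pour_three_zero _ _ _ _)
    ((pour_one_zero _ _ _ _).congr (by simp [enc]) rfl)))))⟩
  simp [sz, enc] at *
  omega

theorem drop : PolyFun O (fun _ : α => ()) := by
  obtain ⟨p, hp, T, h⟩ := exists_mover (α := α)
  refine .of_run (.seq p (clear 1)) (by simp [GuessFree, hp, clear]) (T + 2 * .X + 1) fun a r => ?_
  obtain ⟨t, ht, h⟩ := h O a r [] [] []
  refine ⟨_, ?_, .seq' h ((clear_one _ _ _ _).congr (by simp [enc]) rfl)⟩
  simp [sz]
  omega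

/-- Push a constant word on stack `0`. -/
def _root_.StackProgram.pushes : List Bool → StackProgram
  | [] => .skip
  | b :: l => .seq (pushes l) (.push 0 b)

theorem _root_.StackProgram.pushes_guessFree (l : List Bool) : (pushes l).GuessFree := by
  induction l with
  | nil => trivial
  | cons b l ih => exact ⟨ih, trivial⟩

theorem _root_.StackProgram.pushes_run (l a b c d : List Bool) :
    Run O (pushes l) (stk a b c d) (stk (l ++ a) b c d) (l.length + 1) := by
  induction l with
  | nil => exact .skip _
  | cons x l ih => exact (Run.seq' ih (.push' rfl)).congr (by simp) (by simp)

theorem const_unit (b : β) : PolyFun O (fun _ : Unit => b) :=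
  .of_run (pushes (enc b)) (pushes_guessFree _) (.C ((enc b).length + 1)) fun a r =>
    ⟨(enc b).length + 1, by simp, by simpa [enc] using pushes_run (enc b) r [] [] []⟩


@[fun_prop]
theorem const (b : β) : PolyFun O (fun _ : α => b) := (const_unit b).comp drop


@[fun_prop]
theorem prodMk {f : α → β} {g : α → γ} (hf : PolyFun O f) (hg : PolyFun O g) :
    PolyFun O (fun a => (f a, g a)) :=
  swap.comp (hg.first.comp (swap.comp (hf.first.comp dup)))

theorem punit_prod : PolyFun O (fun a : α => ((), a)) := .of_enc_eq fun _ => rfl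

theorem snd' : PolyFun O (fun a : α × β => a.2) := by
  have : PolyFun O (fun a : Unit × β => a.2) := .of_enc_eq fun _ => rfl
  exact this.comp (drop (α := α)).first


@[fun_prop]
theorem fst {f : α → β × γ} (hf : PolyFun O f) : PolyFun O (fun a => (f a).1) :=
  (snd'.comp swap).comp hf


@[fun_prop]
theorem snd {f : α → β × γ} (hf : PolyFun O f) : PolyFun O (fun a => (f a).2) :=
  snd'.comp hf

end PolyFun

theorem StackData.sz_inl (a : α) : sz (Sum.inl a : α ⊕ β) = sz a + 1 := rfl

theorem StackData.sz_inr (b : β) : sz (Sum.inr b : α ⊕ β) = sz b + 1 := rfl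

theorem StackData.sz_prod (a : α × β) : sz a = sz a.1 + sz a.2 := by simp [sz, enc]

theorem StackData.sz_cons (a : α) (l : List α) : sz (a :: l) = sz a + sz l + 1 := by
  simp [sz, enc, encodeList_cons]

theorem StackData.sz_nil : sz ([] : List α) = 1 := rfl

theorem StackData.sz_bool (b : Bool) : sz b = 1 := rfl

/-- Iteration of a relation: `inl` means to go on, `inr` to stop. -/
theorem NPRel.iterate {R : α → α ⊕ β → Prop} (hR : NPRel O R) (F : α → β → Prop)
    (m e : α → β → ℕ) (M E : Polynomial ℕ)
    (sound_inl : ∀ a a' b, R a (.inl a') → F a' b → F a b)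
    (sound_inr : ∀ a b, R a (.inr b) → F a b)
    (complete : ∀ a b, F a b → R a (.inr b) ∨
      ∃ a', R a (.inl a') ∧ F a' b ∧ m a' b < m a b ∧ e a' b ≤ e a b)
    (he : ∀ a b, F a b → sz a ≤ e a b) (hM : ∀ a b, F a b → m a b ≤ M.eval (sz a + sz b))
    (hE : ∀ a b, F a b → e a b ≤ E.eval (sz a + sz b)) : NPRel O F := by
  obtain ⟨p, T, hp⟩ := hR
  obtain ⟨c, hc, hpc⟩ := p.exists_avoids 4
  have hinit : ∀ w, StackState.init w c = [] := fun w => by simp [StackState.init]; omega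
  have c0 : c ≠ 0 := by omega
  -- After `p` the tag of the sum is on top of stack 0: for `inl` only the tag is removed, for `inr`
  -- also the flag on the fresh stack `c`, which ends the loop.
  set body : StackProgram := .seq p (.branch 0 .skip (.seq (.pop 0) (.pop c)) (.pop 0)) with hbody
  refine ⟨.seq (.push c true) (.loop c body),
    (M + 1) * (T.comp (2 * (E + .X + 2)) + 5) + 2, fun a r => ⟨?_, ?_⟩⟩
  · intro τ t h₀
    obtain ⟨ρ, t₁, t₂, h₁, h, -⟩ := run_seq_iff.1 h₀
    have hρ : ρ = Function.update (StackState.init (enc a ++ r)) c [true] := by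
      cases h₁; rw [hinit]
    clear h₁ h₀
    generalize hq : StackProgram.loop c body = q at h
    induction h generalizing a with
    | loop_exit k p' σ hk => cases hq; simp [hρ] at hk
    | loop_step k p' σ τ υ t u hk h₁ h₂ _ ih =>
      cases hq
      obtain ⟨π, _, _, h₁, h₃, -⟩ := run_seq_iff.1 h₁
      subst hρ
      have hπc := h₁.eq_of_avoids hpc
      have h₁' := h₁.frame hpc []
      rw [Function.update_idem, ← hinit (enc a ++ r), Function.update_eq_self] at h₁'
      obtain ⟨x, hx, hx'⟩ := (hp a r).1 _ _ h₁'
      have hπ : π = Function.update (StackState.init (enc x ++ r)) c [true] := by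
        rw [← hx', Function.update_idem]
        conv_lhs => rw [← Function.update_eq_self c π, hπc]
        simp
      subst hπ
      obtain ⟨_, -, h₃⟩ := run_branch_iff.1 h₃
      obtain x | x := x
      · simp only [Function.update_of_ne c0.symm, StackState.init, if_true, enc, Sum.elim_inl,
          List.cons_append, List.head?_cons, Option.some.injEq, reduceCtorEq, false_and, false_or,
          true_and, Bool.true_eq_false] at h₃
        obtain ⟨b, hb, hb'⟩ := ih x (by
          cases h₃
          rw [Function.update_comm c0]
          congr 1
          funext k
          by_cases hk : k = 0 <;> simp [hk, StackState.init, c0.symm]) rfl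
        exact ⟨b, sound_inl _ _ _ hx hb, hb'⟩
      · simp only [Function.update_of_ne c0.symm, StackState.init, if_true, enc, Sum.elim_inr,
          List.cons_append, List.head?_cons, Option.some.injEq, reduceCtorEq, false_and, false_or,
          true_and, Bool.false_eq_true, or_false] at h₃
        have hτ : τ = .init (enc x ++ r) := by
          obtain ⟨_, _, _, h₃, h₄, -⟩ := run_seq_iff.1 h₃
          cases h₃
          cases h₄
          funext k
          by_cases hk : k = c
          · subst hk; simp [StackState.init, c0, c0.symm]
          · by_cases hk' : k = 0
            · subst hk'; simp [StackState.init, c0, c0.symm]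
            · simp [StackState.init, hk, hk']
        subst hτ
        cases h₂ with
        | loop_exit => exact ⟨x, sound_inr _ _ hx, rfl⟩
        | loop_step _ _ _ _ _ _ _ h => exact absurd (hinit _) h
    | _ => cases hq
  · intro b hb
    -- `n` bounds the remaining rounds and `N` the sizes of all states on the chosen path, so each
    -- round costs at most the same amount.
    have key : ∀ (N n : ℕ) (a : α), F a b → m a b < n → e a b ≤ N → ∃ t ≤ n *
        (T.eval (2 * (N + sz b + 2)) + 5) + 1, Run O (.loop c body)
          (Function.update (StackState.init (enc a ++ r)) c [true]) (.init (enc b ++ r)) t := by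
      intro N n
      induction n with
      | zero => intro a _ h; omega
      | succ n ih =>
        intro a ha hm hN
        have hsa := (he a b ha).trans hN
        obtain h | ⟨a', h, ha', hm', he'⟩ := complete a b ha
        · obtain ⟨t, ht, hrun⟩ := (hp a r).2 _ h
          have ht' := ht.trans (T.eval_le_eval_of_le (b := 2 * (N + sz b + 2))
            (by rw [sz_inr]; omega))
          refine ⟨t + 3 + 1 + 1, ?_, .loop_step _ _ _ _ _ _ _ (by simp)
            (.seq' (hrun.frame hpc [true]) (.branch_false _ _ _ _ _ _ 2 ?_
              (.seq' (.pop' rfl) (.pop' rfl)))) ((Run.loop_exit _ _ _ ?_).congr ?_ rfl)⟩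
          · rw [add_mul, one_mul]; omega
          · simp [c0.symm, StackState.init, enc]
          · simp [c0]
          · funext k
            by_cases hk : k = c
            · subst hk; simp [StackState.init, c0, c0.symm]
            · by_cases hk' : k = 0
              · subst hk'; simp [StackState.init, c0, c0.symm, enc]
              · simp [StackState.init, hk, hk']
        · obtain ⟨t, ht, hrun⟩ := (hp a r).2 _ h
          obtain ⟨u, hu, hloop⟩ := ih a' ha' (by omega) (by omega)
          have ht' := ht.trans (T.eval_le_eval_of_le (b := 2 * (N + sz b + 2))
            (by rw [sz_inl]; have := he a' b ha'; omega))
          refine ⟨t + 2 + u + 1, ?_, .loop_step _ _ _ _ _ _ _ (by simp)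
            (.seq' (hrun.frame hpc [true]) (.branch_true _ _ _ _ _ _ 1 ?_ (.pop' ?_))) hloop⟩
          · rw [add_mul, one_mul]; omega
          · simp [c0.symm, StackState.init, enc]
          · rw [Function.update_comm c0]
            congr 1
            funext k
            by_cases hk : k = 0 <;> simp [hk, StackState.init, c0.symm, enc]
    obtain ⟨t, ht, h⟩ := key _ _ a hb (Nat.lt_succ_self _) le_rfl
    refine ⟨1 + t, ?_, .seq' (.push' (by rw [hinit])) h⟩
    have h₁ : T.eval (2 * (e a b + sz b + 2)) ≤ T.eval (2 * (E.eval (sz a + sz b) +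
      (sz a + sz b) + 2)) := T.eval_le_eval_of_le (by have := hE a b hb; omega)
    have h₂ := Nat.mul_le_mul (Nat.succ_le_succ (hM a b hb)) (Nat.add_le_add_right h₁ 5)
    simp only [Polynomial.eval_add, Polynomial.eval_mul, Polynomial.eval_comp, Polynomial.eval_X,
      Polynomial.eval_one, Polynomial.eval_ofNat, Nat.succ_eq_add_one] at h₂ ht ⊢
    omega

/-- The value `f` is a loop invariant, so the iterated relation is its graph. The output arises by
one step of `g` from a state of size at most `e`, whence its size bound. -/
theorem PolyFun.iterate {g : α → α ⊕ β} (hg : PolyFun O g) (f : α → β) (m e : α → ℕ)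
    (M E : Polynomial ℕ)
    (hinl : ∀ a a', g a = .inl a' → f a' = f a ∧ m a' < m a ∧ e a' ≤ e a)
    (hinr : ∀ a b, g a = .inr b → f a = b) (he : ∀ a, sz a ≤ e a)
    (hM : ∀ a, m a ≤ M.eval (sz a)) (hE : ∀ a, e a ≤ E.eval (sz a)) : PolyFun O f := by
  constructor
  · refine hg.1.iterate _ (fun a _ => m a) (fun a _ => e a) M E ?_ ?_ ?_ (fun a _ _ => he a)
      (fun a _ _ => (hM a).trans (M.eval_le_eval_of_le (by omega)))
      (fun a _ _ => (hE a).trans (E.eval_le_eval_of_le (by omega)))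
    · rintro a a' b h rfl
      exact (hinl a a' h.symm).1
    · rintro a b h
      exact (hinr a b h.symm).symm
    · rintro a b rfl
      cases h : g a with
      | inl a' => exact .inr ⟨a', rfl, (hinl a a' h).1.symm, (hinl a a' h).2⟩
      | inr b => exact .inl (by rw [hinr a b h])
  · obtain ⟨-, Q, hQ⟩ := hg
    refine ⟨Q.comp E, fun a => ?_⟩
    rw [Polynomial.eval_comp]
    suffices h : ∀ n a, m a < n → sz (f a) ≤ Q.eval (e a) from
      (h _ a (Nat.lt_succ_self _)).trans (Q.eval_le_eval_of_le (hE a))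
    intro n
    induction n with
    | zero => intro a h; omega
    | succ n ih =>
      intro a hm
      cases h : g a with
      | inl a' =>
        obtain ⟨h₁, h₂, h₃⟩ := hinl a a' h
        rw [← h₁]
        exact (ih a' (by omega)).trans (Q.eval_le_eval_of_le h₃)
      | inr b =>
        rw [hinr a b h]
        have := hQ a
        rw [h, sz_inr] at this
        exact (Nat.le_succ _).trans (this.trans (Q.eval_le_eval_of_le (he a)))

/-! ### Constructors, case distinctions and oracle calls. -/

namespace PolyFun

@[fun_prop]
theorem inl {f : γ → α} (hf : PolyFun O f) : PolyFun O (fun c => (Sum.inl (f c) : α ⊕ β)) := by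
  have : PolyFun O (fun a : α => (Sum.inl a : α ⊕ β)) :=
    .of_run (.push 0 true) trivial 1 fun a r => ⟨1, by simp, .push' (by simp [enc])⟩
  exact this.comp hf

@[fun_prop]
theorem inr {f : γ → β} (hf : PolyFun O f) : PolyFun O (fun c => (Sum.inr (f c) : α ⊕ β)) := by
  have : PolyFun O (fun a : β => (Sum.inr a : α ⊕ β)) :=
    .of_run (.push 0 false) trivial 1 fun a r => ⟨1, by simp, .push' (by simp [enc])⟩
  exact this.comp hf

@[fun_prop]
theorem cons {f : γ → α} {g : γ → List α} (hf : PolyFun O f) (hg : PolyFun O g) :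
    PolyFun O (fun c => f c :: g c) := by
  have : PolyFun O (fun a : α × List α => a.1 :: a.2) :=
    .of_run (.push 0 true) trivial 1 fun a r =>
      ⟨1, by simp, .push' (by simp [enc, encodeList_cons])⟩
  exact this.comp (hf.prodMk hg)

theorem sum {f : α → γ} {g : β → γ} (hf : PolyFun O f) (hg : PolyFun O g) :
    PolyFun O (Sum.elim f g) := by
  refine ⟨(hf.1.sum hg.1).congr fun a c => by cases a <;> rfl, ?_⟩
  obtain ⟨-, Q, hQ⟩ := hf
  obtain ⟨-, Q', hQ'⟩ := hg
  refine ⟨Q + Q', ?_⟩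
  rintro (a | a)
  · rw [Polynomial.eval_add, sz_inl]
    have := (hQ a).trans (Q.eval_le_eval_of_le (Nat.le_succ _))
    exact this.trans (Nat.le_add_right _ _)
  · rw [Polynomial.eval_add, sz_inr]
    have := (hQ' a).trans (Q'.eval_le_eval_of_le (Nat.le_succ _))
    exact this.trans (Nat.le_add_left _ _)

/-- The tag comes first in the code, so distributing the product over the sum leaves the code
unchanged and costs nothing. -/
theorem sumElim {f : γ → α ⊕ β} {g : γ → α → δ} {h : γ → β → δ} (hf : PolyFun O f)
    (hg : PolyFun O (fun x : α × γ => g x.2 x.1)) (hh : PolyFun O (fun x : β × γ => h x.2 x.1)) :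
    PolyFun O (fun c => Sum.elim (g c) (h c) (f c)) := by
  have h₁ : PolyFun O (fun x : (α ⊕ β) × γ =>
      (Sum.elim (fun a => .inl (a, x.2)) (fun b => .inr (b, x.2)) x.1 : (α × γ) ⊕ (β × γ))) :=
    .of_enc_eq fun ⟨x, c⟩ => by cases x <;> simp [enc]
  have h₂ := (hg.sum hh).comp (h₁.comp (hf.prodMk .id))
  refine (congrArg (PolyFun O) (funext fun c => ?_)).mp h₂
  cases f c <;> rfl

theorem congr {f g : α → β} (h : PolyFun O f) (hfg : ∀ a, f a = g a) : PolyFun O g :=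
  (funext hfg : f = g) ▸ h

@[fun_prop]
theorem cond {f : γ → Bool} {g h : γ → δ} (hf : PolyFun O f) (hg : PolyFun O g)
    (hh : PolyFun O h) : PolyFun O (fun c => bif f c then g c else h c) := by
  have h₁ : PolyFun O (fun b : Bool => (bif b then .inl () else .inr () : Unit ⊕ Unit)) :=
    .of_enc_eq fun b => by cases b <;> rfl
  have h₂ : PolyFun O (fun x : Unit × γ => g x.2) := hg.comp (by fun_prop)
  have h₃ : PolyFun O (fun x : Unit × γ => h x.2) := hh.comp (by fun_prop)
  refine (sumElim (g := fun c _ => g c) (h := fun c _ => h c) (h₁.comp hf) h₂ h₃).congr fun c => ?_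
  cases f c <;> rfl

@[fun_prop]
theorem and {f g : γ → Bool} (hf : PolyFun O f) (hg : PolyFun O g) :
    PolyFun O (fun c => f c && g c) :=
  (hf.cond hg (const false)).congr fun c => by cases f c <;> rfl

@[fun_prop]
theorem not {f : γ → Bool} (hf : PolyFun O f) : PolyFun O (fun c => !f c) :=
  (hf.cond (const false) (const true)).congr fun c => by cases f c <;> rfl

/-- Case distinction on a list. -/
def _root_.List.caseNilCons {α β : Type} (l : List α) (n : β) (c : α → List α → β) : β :=
  match l with
  | [] => n
  | a :: l => c a l

/-- A list has literally the same code as an element of `(α × List α) ⊕ Unit`, so the case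
distinction is one on a sum. -/
theorem listCase {l : γ → List α} {n : γ → δ} {c : γ → α → List α → δ} (hl : PolyFun O l)
    (hn : PolyFun O n) (hc : PolyFun O (fun x : (α × List α) × γ => c x.2 x.1.1 x.1.2)) :
    PolyFun O (fun y => (l y).caseNilCons (n y) (c y)) := by
  have h₁ : PolyFun O (fun l : List α =>
      (l.caseNilCons (.inr ()) fun a t => .inl (a, t) : (α × List α) ⊕ Unit)) :=
    .of_enc_eq fun l => by cases l <;> simp [enc, List.caseNilCons, encodeList_nil, encodeList_cons]
  have h₂ : PolyFun O (fun x : Unit × γ => n x.2) := hn.comp (by fun_prop)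
  refine (sumElim (g := fun y x => c y x.1 x.2) (h := fun y _ => n y) (h₁.comp hl) hc
    h₂).congr fun y => ?_
  cases l y <;> rfl

@[fun_prop]
theorem headD {l : γ → List α} {d : γ → α} (hl : PolyFun O l) (hd : PolyFun O d) :
    PolyFun O (fun y => (l y).headD (d y)) :=
  (listCase (c := fun _ a _ => a) hl hd (by fun_prop)).congr fun y => by cases l y <;> rfl

@[fun_prop]
theorem tail {l : γ → List α} (hl : PolyFun O l) : PolyFun O (fun y => (l y).tail) :=
  (listCase (c := fun _ _ t => t) hl (const []) (by fun_prop)).congr fun y => by cases l y <;> rfl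

/-- The code word of an element. -/
theorem code : PolyFun O (fun a : α => enc a) := by
  obtain ⟨p, hp, T, h⟩ := exists_mover (α := α)
  have hloop : ∀ (l a : List Bool), Run O (.loop 1 (.branch 1 .skip
      (.seq (.pop 1) (.seq (.push 0 false) (.push 0 true)))
      (.seq (.pop 1) (.seq (.push 0 true) (.push 0 true)))))
      (stk a l [] []) (stk (l.reverse.flatMap (fun b => [true, b]) ++ a) [] [] [])
      (5 * l.length + 1) := by
    intro l
    induction l with
    | nil => exact fun a => .loop_exit _ _ _ rfl
    | cons b l ih =>
      intro a
      refine (Run.loop_step 1 _ _ (stk (true :: b :: a) l [] []) _ 4 _ (by simp) ?_ (ih _)).congr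
        (by simp) (by simp; ring)
      have : ∀ b', Run O (.seq (.pop 1) (.seq (.push 0 b') (.push 0 true))) (stk a (b :: l) [] [])
        (stk (true :: b' :: a) l [] []) 3 := fun b' =>
        .seq' (.pop' rfl) (.seq' (.push' rfl) (.push' (by simp)))
      cases b
      · exact .branch_false _ _ _ _ _ _ 3 rfl (this _)
      · exact .branch_true _ _ _ _ _ _ 3 rfl (this _)
  refine .of_run (.seq p (.seq (.push 0 false) (.loop 1 (.branch 1 .skip
      (.seq (.pop 1) (.seq (.push 0 false) (.push 0 true)))
      (.seq (.pop 1) (.seq (.push 0 true) (.push 0 true)))))))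
      (by simp [GuessFree, hp]) (T + 5 * .X + 2) fun a r => ?_
  obtain ⟨t, ht, h⟩ := h O a r [] [] []
  refine ⟨_, ?_, .seq' h (.seq' ((Run.push' rfl).congr (τ' := stk (false :: r) (enc a).reverse [] []) (by simp) rfl)
    ((hloop _ _).congr (by simp [enc, encodeList]) rfl))⟩
  simp [sz]
  omega

/-- The answer of the oracle. -/
theorem oracle [DecidablePred (· ∈ O)] : PolyFun O (fun w : List Bool => decide (w ∈ O)) := by
  -- The argument is stored with a marker before each bit, whereas a query reads a bare word. The
  -- loop strips the markers; stack 3 holds the flag.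
  have hloop : ∀ (l s r : List Bool), Run O (.loop 3 (.branch 0 .skip (.seq (.pop 0) (.pop 3))
      (.seq (.pop 0) (.branch 0 .skip (.seq (.pop 0) (.push 1 false))
        (.seq (.pop 0) (.push 1 true))))))
      (stk (enc l ++ r) s [] [true]) (stk r (l.reverse ++ s) [] []) (6 * l.length + 5) := by
    intro l
    induction l with
    | nil =>
      exact fun s r => .loop_step _ _ _ _ _ 3 1 (by simp)
        (.branch_false _ _ _ _ _ _ 2 rfl (.seq' (.pop' rfl) (.pop' rfl)))
        ((Run.loop_exit _ _ _ (by simp)).congr (by simp [enc, encodeList_nil]) rfl)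
    | cons b l ih =>
      intro s r
      refine (Run.loop_step 3 _ _ (stk (enc l ++ r) (b :: s) [] [true]) _ 5 _ (by simp)
        (.branch_true _ _ _ _ _ _ 4 (by simp [enc, encodeList_cons])
          (.seq' (t := 1) (u := 3) (.pop' rfl) ?_)) (ih _ _)).congr
        (by simp) (by simp; ring)
      simpa [enc, encodeList_cons] using run_move_bit b (enc l ++ r) s [] [true]
  refine .of_run (.seq (.push 3 true) (.seq (.loop 3 (.branch 0 .skip (.seq (.pop 0) (.pop 3))
      (.seq (.pop 0) (.branch 0 .skip (.seq (.pop 0) (.push 1 false))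
        (.seq (.pop 0) (.push 1 true)))))) (.seq (pour 1 2) (.seq (.query 2 3) (.seq (clear 2)
        (pour 3 0))))))
      (by simp [GuessFree, pour, clear]) (12 * .X + 14) fun l r => ?_
  have hq : Run O (.query 2 3) (stk r [] l []) (stk r [] l [decide (l ∈ O)]) 1 := by
    by_cases h : l ∈ O
    · simpa [h] using Run.query_yes (O := O) (stk r [] l []) 2 3 h
    · simpa [h] using Run.query_no (O := O) (stk r [] l []) 2 3 h
  have hl := length_lt_length_encodeList (enc (α := Bool)) l
  refine ⟨_, ?_, .seq' ((Run.push' rfl).congr (by simp) rfl) (.seq' (hloop l [] r)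
    (.seq' ((pour_one_two _ _ _ _).congr (τ' := stk r [] l []) (by simp) rfl) (.seq' hq (.seq'
    (clear_two _ _ _ _) ((pour_three_zero _ _ _ _).congr (by simp [enc]) rfl)))))⟩
  simp [sz, enc] at *
  omega

end PolyFun

namespace PolyFun

theorem boolToSum :
    PolyFun O (fun b : Bool => (bif b then .inl () else .inr () : Unit ⊕ Unit)) :=
  .of_enc_eq fun b => by cases b <;> rfl

end PolyFun

theorem NPPred.of_bool {f : α → Bool} (hf : PolyFun O f) : NPPred O (fun a => f a = true) := by
  have h : NPRel O (fun (_ : Unit) (_ : Unit) => True) := PolyFun.id.1.congr fun _ _ => by simp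
  refine ((h.sum (NPRel.false (α := Unit))).comap (PolyFun.boolToSum.comp hf)).congr fun a c => ?_
  rcases Bool.eq_false_or_eq_true (f a) with h | h <;> simp [h]

theorem NPPred.comap {P : β → Prop} (hP : NPPred O P) {f : α → β} (hf : PolyFun O f) :
    NPPred O (fun a => P (f a)) := NPRel.comap hP hf

theorem NPPred.congr {P Q : α → Prop} (hP : NPPred O P) (h : ∀ a, P a ↔ Q a) : NPPred O Q :=
  NPRel.congr hP fun a _ => h a

/-- Testing `P` consumes its argument, so the test runs on a copy. -/
theorem NPPred.guard {P : α → Prop} {R : α → β → Prop} (hP : NPPred O P) (hR : NPRel O R) :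
    NPRel O (fun a b => P a ∧ R a b) := by
  have h₁ : NPRel O (fun (a : α) (y : Unit × α) => P a ∧ y.2 = a) := hP.first.comap PolyFun.dup
  refine (h₁.comp (hR.comap PolyFun.snd') .X ?_).congr fun a b => ?_
  · rintro a ⟨_, _⟩ b ⟨h, rfl⟩ hb
    exact ⟨_, ⟨h, rfl⟩, hb, by simp [sz, enc]⟩
  · constructor
    · rintro ⟨⟨_, _⟩, ⟨h, rfl⟩, hb⟩
      exact ⟨h, hb⟩
    · rintro ⟨h, hb⟩
      exact ⟨((), a), ⟨h, rfl⟩, hb⟩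

/-- Guess a witness on top of the input and go on. Witnesses of any size may be guessed; `hQ` says
that a small one exists whenever some witness does. -/
theorem NPRel.exists [Guessable O β] {R : β → α → γ → Prop}
    (hR : NPRel O (fun (x : β × α) c => R x.1 x.2 c)) (Q : Polynomial ℕ)
    (hQ : ∀ a b c, R b a c → ∃ b', R b' a c ∧ sz b' ≤ Q.eval (sz a + sz c)) :
    NPRel O (fun a c => ∃ b, R b a c) := by
  have h₁ := (Guessable.guess (O := O) (α := β)).first.comap (PolyFun.punit_prod (α := α))
  refine (h₁.comp hR (.X + Q) ?_).congr fun a c => ?_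
  · rintro a ⟨b, _⟩ c ⟨_, rfl⟩ h
    obtain ⟨b', hb', hs⟩ := hQ _ b c h
    refine ⟨(b', _), ⟨trivial, rfl⟩, hb', ?_⟩
    simp only [sz_prod, Polynomial.eval_add, Polynomial.eval_X] at hs ⊢
    omega
  · constructor
    · rintro ⟨⟨b, _⟩, ⟨_, rfl⟩, h⟩
      exact ⟨b, h⟩
    · rintro ⟨b, h⟩
      exact ⟨(b, a), ⟨trivial, rfl⟩, h⟩

theorem NPPred.exists [Guessable O β] {P : β → α → Prop}
    (hP : NPPred O (fun x : β × α => P x.1 x.2)) (Q : Polynomial ℕ)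
    (hQ : ∀ a b, P b a → ∃ b', P b' a ∧ sz b' ≤ Q.eval (sz a)) :
    NPPred O (fun a => ∃ b, P b a) :=
  NPRel.exists (R := fun b a _ => P b a) hP Q fun a b _ h => by simpa [sz, enc] using hQ a b h

/-- A function whose graph is recognizable and whose values can be guessed is computable. -/
theorem PolyFun.of_graph [Guessable O β] {f : α → β} {P : β → α → Prop}
    (h : NPPred O (fun x : β × α => P x.1 x.2)) (hP : ∀ a b, P b a ↔ b = f a)
    (Q : Polynomial ℕ) (hQ : ∀ a, sz (f a) ≤ Q.eval (sz a)) : PolyFun O f := by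
  refine ⟨((h.guard (PolyFun.fst .id).1).exists (R := fun b a c => P b a ∧ c = b) .X ?_).congr ?_,
    Q, hQ⟩
  · rintro a b c ⟨h, rfl⟩
    exact ⟨_, ⟨h, rfl⟩, by simp⟩
  · simp [hP]

theorem NPRel.toSum {R : α → β → Prop} {g : β → γ} (hR : NPRel O R) (hg : PolyFun O g)
    (Q : Polynomial ℕ) (hQ : ∀ b, sz b ≤ Q.eval (sz (g b))) :
    NPRel O (fun a c => ∃ b, R a b ∧ c = g b) :=
  hR.comp hg.1 Q fun a b c h hc => ⟨b, h, hc, (hQ b).trans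
    (Q.eval_le_eval_of_le (by rw [hc]; omega))⟩

/-! ### Guessing elements of encoded types. -/

namespace Guessable

instance : Guessable O Unit := ⟨PolyFun.id.1.congr fun _ _ => by simp⟩

instance : Guessable O Bool :=
  ⟨⟨.guess 0, 1, fun a r => ⟨fun τ t h => by
      cases h with
      | guess _ _ b => exact ⟨b, trivial, by simp [init_eq_stk, enc]⟩,
    fun b _ => ⟨1, by simp, by
      have := Run.guess (O := O) (stk r [] [] []) 0 b
      simpa [init_eq_stk, enc] using this⟩⟩⟩⟩

instance [Guessable O α] [Guessable O β] : Guessable O (α × β) := by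
  have h₁ : NPRel O (fun (x : β × α × Unit) (c : α × β) => c = (x.2.1, x.1)) :=
    PolyFun.prodMk (by fun_prop) (by fun_prop) |>.1
  have h₂ : NPRel O (fun (x : α × Unit) (c : α × β) => ∃ b : β, c = (x.1, b)) :=
    h₁.exists (R := fun (b : β) (x : α × Unit) c => c = (x.1, b)) .X (by
      rintro x b _ rfl
      refine ⟨_, rfl, ?_⟩
      simp only [sz_prod, Polynomial.eval_X]
      omega)
  refine ⟨(h₂.exists (R := fun (a : α) (_ : Unit) c => ∃ b : β, c = (a, b)) .X ?_).congr
    fun _ c => ?_⟩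
  · rintro _ a _ ⟨b, rfl⟩
    refine ⟨_, ⟨_, rfl⟩, ?_⟩
    simp only [sz_prod, Polynomial.eval_X]
    omega
  · simp only [iff_true]
    exact ⟨c.1, c.2, rfl⟩

instance [Guessable O α] [Guessable O β] : Guessable O (α ⊕ β) := by
  have h₁ := (guess (O := O) (α := α)).toSum (PolyFun.inl (β := β) .id) .X
    (by simp [sz_inl])
  have h₂ := (guess (O := O) (α := β)).toSum (PolyFun.inr (α := α) .id) .X
    (by simp [sz_inr])
  have h₃ := (h₁.sum h₂).comap (PolyFun.boolToSum.comp (PolyFun.fst (γ := Unit) .id))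
  refine ⟨(h₃.exists (β := Bool) (R := fun b (_ : Unit) c => Sum.elim
    (fun _ c => ∃ a : α, True ∧ c = Sum.inl a) (fun _ c => ∃ b : β, True ∧ c = Sum.inr b)
    (bif b then Sum.inl () else Sum.inr () : Unit ⊕ Unit) c) 1 ?_).congr ?_⟩
  · exact fun a b c h => ⟨b, h, by simp [sz_bool]⟩
  · rintro a (c | c)
    · simp only [iff_true]
      exact ⟨true, c, trivial, rfl⟩
    · simp only [iff_true]
      exact ⟨false, c, trivial, rfl⟩

theorem _root_.StackData.length_le_sz (l : List α) : l.length ≤ sz l :=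
  (length_lt_length_encodeList enc l).le

theorem _root_.StackData.sz_append (l k : List α) : sz (l ++ k) + 1 = sz l + sz k := by
  induction l with
  | nil => simp [sz_nil, add_comm]
  | cons a l ih => rw [List.cons_append, sz_cons, sz_cons]; omega

instance [Guessable O α] : Guessable O (List α) := by
  have h₁ : PolyFun O (fun x : (α ⊕ Unit) × List α =>
      (Sum.elim (fun a => .inl (a :: x.2)) (fun _ => .inr x.2) x.1 : List α ⊕ List α)) :=
    .sumElim (g := fun (x : (α ⊕ Unit) × List α) a => (Sum.inl (a :: x.2) : List α ⊕ List α))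
      (h := fun x _ => (Sum.inr x.2 : List α ⊕ List α))
      (by fun_prop) (by fun_prop) (by fun_prop)
  have h₂ := h₁.1.exists (R := fun (b : α ⊕ Unit) (l : List α) c => c =
    (Sum.elim (fun a => .inl (a :: l)) (fun _ => .inr l) b : List α ⊕ List α)) (.X + 1) (by
      rintro l (a | a) _ rfl
      · refine ⟨_, rfl, ?_⟩
        simp only [Sum.elim_inl, sz_inl, sz_cons, Polynomial.eval_add, Polynomial.eval_X,
          Polynomial.eval_one]
        omega
      · refine ⟨_, rfl, ?_⟩
        simp [sz, enc])
  -- The target list `k` is built from its end, so the states on the way to it are exactly its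
  -- suffixes.
  have h₃ := h₂.iterate (fun l k => l <:+ k) (fun l k => k.length - l.length) (fun _ k => sz k)
    .X .X ?_ ?_ ?_ ?_ ?_ ?_
  · refine ⟨(h₃.comap (PolyFun.const [])).congr ?_⟩
    simp
  · rintro l l' k ⟨a | a, h⟩ hk
    · obtain rfl : l' = a :: l := Sum.inl_injective h
      exact (List.suffix_cons a l).trans hk
    · simp at h
  · rintro l k ⟨a | a, h⟩
    · simp at h
    · obtain rfl : k = l := Sum.inr_injective h
      exact List.suffix_rfl
  · rintro l k ⟨k', rfl⟩
    induction k' using List.reverseRecOn with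
    | nil => exact .inl ⟨.inr (), rfl⟩
    | append_singleton k' a =>
      refine .inr ⟨a :: l, ⟨.inl a, rfl⟩, ⟨k', by simp⟩, ?_, le_rfl⟩
      simp
      omega
  · rintro l k ⟨k', rfl⟩
    have := sz_append k' l
    have : 1 ≤ sz k' := (length_lt_length_encodeList enc k').trans_le' (by omega)
    omega
  · rintro l k -
    have := length_le_sz k
    simp only [Polynomial.eval_X]
    omega
  · rintro l k -
    simp

/-- Guessing elements of a type encoded through an injection with recognizable range. -/
theorem of_range [Guessable O β] (f : α → β) (hf : ∀ a, enc (f a) = enc a)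
    (h : NPPred O (fun b => ∃ a, f a = b)) : Guessable O α := by
  obtain ⟨p, T, hp⟩ := (h.guard PolyFun.id.1).comap (PolyFun.snd' (O := O) (α := β) (β := β))
  have h₁ := ((h.guard PolyFun.id.1).comap (PolyFun.fst (γ := Unit) .id)).exists
    (R := fun b _ c => (∃ a, f a = b) ∧ c = b) .X (by
      rintro _ b _ ⟨h, rfl⟩
      exact ⟨_, ⟨h, rfl⟩, by simp⟩)
  obtain ⟨p, T, hp⟩ := h₁
  refine ⟨p, T, fun u r => ⟨fun τ t h => ?_, fun a _ => ?_⟩⟩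
  · obtain ⟨b, ⟨_, ⟨a, rfl⟩, rfl⟩, rfl⟩ := (hp u r).1 τ t h
    exact ⟨a, trivial, by rw [hf]⟩
  · simpa [hf, sz] using (hp u r).2 (f a) ⟨f a, ⟨a, rfl⟩, rfl⟩

end Guessable

/-! ### Recognizing languages -/

namespace StackProgram

/-- Check that stacks `0` and `2` agree, emptying them. -/
def matchLoop : StackProgram :=
  .loop 2 (.branch 2 .skip (.seq (.pop 2) (.branch 0 diverge (.pop 0) diverge))
    (.seq (.pop 2) (.branch 0 diverge diverge (.pop 0))))

theorem matchLoop_run (l w : List Bool) :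
    Run O matchLoop (stk (l ++ w) [] l []) (stk w [] [] []) (5 * l.length + 1) := by
  induction l with
  | nil => exact .loop_exit _ _ _ rfl
  | cons b l ih =>
    refine (Run.loop_step 2 _ _ (stk (l ++ w) [] l []) _ 4 _ (by simp) ?_ ih).congr rfl
      (by simp; ring)
    cases b
    · exact .branch_false _ _ _ _ _ _ 3 rfl (.seq' (t := 1) (u := 2) (.pop' rfl)
        (.branch_false _ _ _ _ _ _ 1 rfl (.pop' (by simp))))
    · exact .branch_true _ _ _ _ _ _ 3 rfl (.seq' (t := 1) (u := 2) (.pop' rfl)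
        (.branch_true _ _ _ _ _ _ 1 rfl (.pop' (by simp))))

theorem exists_of_matchLoop_run {l w : List Bool} {τ : StackState} {t : ℕ}
    (h : Run O matchLoop (stk w [] l []) τ t) : ∃ w', w = l ++ w' ∧ τ = stk w' [] [] [] := by
  induction l generalizing w t with
  | nil =>
    cases h with
    | loop_exit => exact ⟨w, rfl, rfl⟩
    | loop_step _ _ _ _ _ _ _ h => simp at h
  | cons b l ih =>
    cases h with
    | loop_exit _ _ _ h => simp at h
    | loop_step _ _ _ ρ _ _ _ _ h₁ h₂ =>
      suffices h : ∃ w', w = b :: w' ∧ ρ = stk w' [] l [] by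
        obtain ⟨w', rfl, rfl⟩ := h
        obtain ⟨w'', rfl, rfl⟩ := ih h₂
        exact ⟨w'', rfl, rfl⟩
      obtain ⟨u, -, h₁⟩ := run_branch_iff.1 h₁
      rcases b with _ | _ <;>
      · simp only [stk_two, List.head?_cons, reduceCtorEq, Option.some.injEq, false_and, true_and,
          false_or, or_false, Bool.false_eq_true, Bool.true_eq_false] at h₁
        obtain ⟨π, _, _, h₃, h₄, -⟩ := run_seq_iff.1 h₁
        cases h₃
        obtain ⟨_, -, ⟨_, h⟩ | ⟨h₅, h⟩ | ⟨h₅, h⟩⟩ := run_branch_iff.1 h₄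
        · exact (not_run_diverge h).elim
        · first
          | exact (not_run_diverge h).elim
          | cases h
            obtain ⟨w', rfl⟩ : ∃ w', w = _ :: w' := List.head?_eq_some_iff.1 (by simpa using h₅)
            exact ⟨w', rfl, by simp⟩
        · first
          | exact (not_run_diverge h).elim
          | cases h
            obtain ⟨w', rfl⟩ : ∃ w', w = _ :: w' := List.head?_eq_some_iff.1 (by simpa using h₅)
            exact ⟨w', rfl, by simp⟩

end StackProgram

/-- The input is never parsed: an element satisfying `P` is guessed, its code is written above the
input, and the two words are compared. Malformed inputs match no guess. For a correct guess the size
equals the input length, so the time is polynomial. -/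
theorem mem_classNP [Guessable O α] {L : Language Bool} {P : α → Prop} (hP : NPPred O P)
    (hL : ∀ w, w ∈ L ↔ ∃ a, w = enc a ∧ P a) : L ∈ ClassNP O := by
  obtain ⟨p, T, hp⟩ := ((hP.guard PolyFun.id.1).comap (PolyFun.fst (γ := Unit) .id)).exists
    (R := fun b _ c => P b ∧ c = b) .X (by
      rintro _ b _ ⟨h, rfl⟩
      exact ⟨_, ⟨h, rfl⟩, by simp⟩)
  obtain ⟨q, hq, U, hmove⟩ := exists_mover (α := α)
  refine ⟨.seq p (.seq q (.seq (pour 1 2) (.seq matchLoop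
    (.branch 0 (.push 0 true) diverge diverge)))), T + U + 9 * .X + 4, fun w => ?_⟩
  rw [hL]
  constructor
  · rintro ⟨a, rfl, ha⟩
    obtain ⟨t, ht, h₁⟩ := (hp () (enc a)).2 a ⟨a, ha, rfl⟩
    obtain ⟨u, hu, h₂⟩ := hmove O a (enc a) [] [] []
    refine ⟨_, _, .seq' h₁ (.seq' (by simpa [init_eq_stk] using h₂) (.seq'
      ((pour_one_two _ _ _ _).congr (τ' := stk (enc a ++ []) [] (enc a) []) (by simp) rfl)
      (.seq' (matchLoop_run _ _) (.branch_empty _ _ _ _ _ _ _ rfl (.push' rfl))))), ?_, rfl⟩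
    simp [sz, enc] at *
    omega
  · rintro ⟨τ, t, h, -, hτ⟩
    obtain ⟨_, _, _, h₁, h, -⟩ := run_seq_iff.1 h
    obtain ⟨a, ⟨_, ha, rfl⟩, rfl⟩ := (hp () w).1 _ _ (by simpa [enc] using h₁)
    refine ⟨a, ?_, ha⟩
    obtain ⟨_, _, _, h₁, h, -⟩ := run_seq_iff.1 h
    obtain ⟨u, hu, h₂⟩ := hmove O a w [] [] []
    rw [← init_eq_stk] at h₂
    obtain rfl := h₂.unique hq h₁
    obtain ⟨_, _, _, h₁, h, -⟩ := run_seq_iff.1 h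
    obtain rfl := (pour_one_two _ _ _ _).unique (by simp [pour, GuessFree]) h₁
    obtain ⟨_, _, _, h₁, h, -⟩ := run_seq_iff.1 h
    obtain ⟨w', hw, rfl⟩ := exists_of_matchLoop_run h₁
    obtain ⟨_, -, ⟨h, _⟩ | ⟨_, h⟩ | ⟨_, h⟩⟩ := run_branch_iff.1 h
    · obtain rfl : w' = [] := by simpa using h
      simpa using hw
    · exact (not_run_diverge h).elim
    · exact (not_run_diverge h).elim

/-! ### List functions -/

namespace StackData

theorem one_le_sz_list (l : List α) : 1 ≤ sz l := (Nat.zero_le _).trans_lt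
  (length_lt_length_encodeList enc l)

/-- The largest size of an intermediate result of a fold. -/
def foldSup (f : β → α → β) : List α → β → ℕ
  | [], b => sz b
  | a :: l, b => max (sz b) (foldSup f l (f b a))

theorem le_foldSup (f : β → α → β) (l : List α) (b : β) : sz b ≤ foldSup f l b := by
  cases l with
  | nil => exact le_rfl
  | cons => exact le_max_left _ _

theorem foldSup_le (f : β → α → β) (N : ℕ) (l : List α) (b : β)
    (h : ∀ k, k <+: l → sz (k.foldl f b) ≤ N) : foldSup f l b ≤ N := by
  induction l generalizing b with
  | nil => exact h [] List.prefix_rfl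
  | cons a l ih =>
    refine max_le (h [] (List.nil_prefix)) (ih _ fun k hk => ?_)
    simpa using h (a :: k) (List.cons_prefix_cons.2 ⟨rfl, hk⟩)

theorem sz_le_of_prefix {k l : List α} (h : k <+: l) : sz k ≤ sz l := by
  obtain ⟨m, rfl⟩ := h
  have := sz_append k m
  have := one_le_sz_list m
  omega

theorem sz_reverse (l : List α) : sz l.reverse = sz l := by
  induction l with
  | nil => rfl
  | cons a l ih =>
    have := sz_append l.reverse [a]
    rw [sz_cons, sz_nil] at this
    rw [List.reverse_cons, sz_cons, ← ih]
    omega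

end StackData

namespace PolyFun

/-- The bound `hQ` is assumed for all lists. Applied to the prefixes of the list, it bounds every
intermediate accumulator. -/
theorem foldl {f : γ → β → α → β} {c : δ → γ} {b : δ → β} {l : δ → List α}
    (hf : PolyFun O (fun x : γ × β × α => f x.1 x.2.1 x.2.2)) (Q : Polynomial ℕ)
    (hQ : ∀ c b (l : List α), sz (l.foldl (f c) b) ≤ Q.eval (sz c + sz b + sz l))
    (hc : PolyFun O c) (hb : PolyFun O b) (hl : PolyFun O l) :
    PolyFun O (fun x => (l x).foldl (f (c x)) (b x)) := by
  have hg : PolyFun O (fun s : List α × β × γ => (s.1.caseNilCons (.inr s.2.1)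
      (fun a t => .inl (t, f s.2.2 s.2.1 a, s.2.2)) : (List α × β × γ) ⊕ β)) :=
    .listCase (c := fun (s : List α × β × γ) a t =>
      (Sum.inl (t, f s.2.2 s.2.1 a, s.2.2) : (List α × β × γ) ⊕ β)) (.fst .id) (by fun_prop) (.inl (.prodMk (by fun_prop) (.prodMk
        (hf.comp (f := fun x : (α × List α) × List α × β × γ => (x.2.2.2, x.2.2.1, x.1.1))
          (by fun_prop)) (by fun_prop))))
  have h := hg.iterate (fun s => s.1.foldl (f s.2.2) s.2.1) (fun s => s.1.length)
    (fun s => sz s.1 + foldSup (f s.2.2) s.1 s.2.1 + sz s.2.2) .X (Q + .X) ?_ ?_ ?_ ?_ ?_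
  · exact h.comp (hl.prodMk (hb.prodMk hc))
  · rintro ⟨_ | ⟨a, l⟩, b, c⟩ a' h
    · simp [List.caseNilCons] at h
    · obtain rfl := Sum.inl_injective h
      refine ⟨rfl, by simp, ?_⟩
      simp only [sz_cons]
      have : foldSup (f c) l (f c b a) ≤ foldSup (f c) (a :: l) b := le_max_right _ _
      omega
  · rintro ⟨_ | ⟨a, l⟩, b, c⟩ a' h
    · exact Sum.inr_injective h
    · simp [List.caseNilCons] at h
  · rintro ⟨l, b, c⟩
    simp only [sz_prod]
    have := le_foldSup (f c) l b
    omega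
  · rintro ⟨l, b, c⟩
    simp only [sz_prod, Polynomial.eval_X]
    have := length_le_sz l
    omega
  · rintro ⟨l, b, c⟩
    simp only [sz_prod, Polynomial.eval_X, Polynomial.eval_add]
    have := foldSup_le (f c) (Q.eval (sz l + (sz b + sz c))) l b fun k hk =>
      (hQ c b k).trans (Q.eval_le_eval_of_le (by have := sz_le_of_prefix hk; omega))
    omega

@[fun_prop]
theorem reverse {l : δ → List α} (hl : PolyFun O l) : PolyFun O (fun x => (l x).reverse) := by
  refine (foldl (f := fun (_ : Unit) (k : List α) a => a :: k) (c := fun _ => ()) (b := fun _ => [])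
    (by fun_prop) .X ?_ (const _) (const _) hl).congr fun x => by simp
  intro c b l
  have h := sz_append l.reverse b
  rw [sz_reverse] at h
  simp only [List.foldl_flip_cons_eq_append', Polynomial.eval_X]
  omega

theorem foldr {f : γ → α → β → β} {c : δ → γ} {b : δ → β} {l : δ → List α}
    (hf : PolyFun O (fun x : γ × β × α => f x.1 x.2.2 x.2.1)) (Q : Polynomial ℕ)
    (hQ : ∀ c b (l : List α), sz (l.foldr (f c) b) ≤ Q.eval (sz c + sz b + sz l))
    (hc : PolyFun O c) (hb : PolyFun O b) (hl : PolyFun O l) :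
    PolyFun O (fun x => (l x).foldr (f (c x)) (b x)) := by
  refine (foldl (f := fun c b a => f c a b) hf Q ?_ hc hb (reverse hl)).congr fun x => by simp
  intro c b l
  have := hQ c b l.reverse
  rwa [List.foldr_reverse, sz_reverse] at this

/-- Sizes of lists are determined by sizes of the entries. -/
theorem _root_.StackData.sz_map_le (f : α → β) (N : ℕ) (l : List α) (h : ∀ a ∈ l, sz (f a) ≤ N) :
    sz (l.map f) ≤ l.length * (N + 1) + 1 := by
  induction l with
  | nil => simp [sz_nil]
  | cons a l ih =>
    rw [List.map_cons, sz_cons, List.length_cons, add_mul]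
    have := ih fun b hb => h b (List.mem_cons_of_mem _ hb)
    have := h a List.mem_cons_self
    omega

theorem _root_.StackData.sz_lt_of_mem {l : List α} {a : α} (h : a ∈ l) : sz a < sz l := by
  induction l with
  | nil => simp at h
  | cons b l ih =>
    rw [sz_cons]
    rcases List.mem_cons.1 h with rfl | h
    · omega
    · have := ih h
      omega

theorem map {f : γ → α → β} {c : δ → γ} {l : δ → List α}
    (hf : PolyFun O (fun x : γ × α => f x.1 x.2)) (hc : PolyFun O c) (hl : PolyFun O l) :
    PolyFun O (fun x => (l x).map (f (c x))) := by
  obtain ⟨Q, hQ⟩ := hf.2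
  refine (foldr (f := fun c a (k : List β) => f c a :: k) (c := c) (b := fun _ => []) (l := l)
    (.cons (hf.comp (f := fun x : γ × List β × α => (x.1, x.2.2)) (by fun_prop)) (by fun_prop))
    (.X * (Q + 1) + .X) ?_ hc (const _) hl).congr fun x => ?_
  · intro c b l
    have h : l.foldr (fun a k => f c a :: k) b = l.map (f c) ++ b := by
      induction l <;> simp_all
    have h₁ := sz_append (l.map (f c)) b
    have h₂ := sz_map_le (f c) (Q.eval (sz c + sz b + sz l)) l fun a ha => (hQ (c, a)).trans
      (Q.eval_le_eval_of_le (by have := sz_lt_of_mem ha; simp only [sz_prod]; omega))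
    have h₃ := Nat.mul_le_mul_right (Q.eval (sz c + sz b + sz l) + 1)
      ((length_le_sz l).trans (by omega : _ ≤ sz c + sz b + sz l))
    simp only [Polynomial.eval_add, Polynomial.eval_mul, Polynomial.eval_X, Polynomial.eval_one, h]
    omega
  · induction l x <;> simp_all

theorem all {p : γ → α → Bool} {c : δ → γ} {l : δ → List α}
    (hf : PolyFun O (fun x : γ × α => p x.1 x.2)) (hc : PolyFun O c) (hl : PolyFun O l) :
    PolyFun O (fun x => (l x).all (p (c x))) := by
  refine (foldr (f := fun c a (b : Bool) => p c a && b) (c := c) (b := fun _ => true) (l := l)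
    (.and (hf.comp (f := fun x : γ × Bool × α => (x.1, x.2.2)) (by fun_prop)) (by fun_prop))
    1 (fun _ _ _ => by simp [sz_bool]) hc (const _) hl).congr fun x => ?_
  induction l x <;> simp_all

/-- Pointwise comparison of two lists of the same length. -/
def _root_.List.all₂' {α β : Type} (p : α → β → Bool) : List α → List β → Bool
  | [], [] => true
  | a :: l, b :: k => p a b && List.all₂' p l k
  | _, _ => false

theorem all₂ {p : α → β → Bool} {l : δ → List α} {k : δ → List β}
    (hp : PolyFun O (fun x : α × β => p x.1 x.2)) (hl : PolyFun O l) (hk : PolyFun O k) :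
    PolyFun O (fun x => (l x).all₂' p (k x)) := by
  have hg : PolyFun O (fun s : List α × List β => (s.1.caseNilCons
      (s.2.caseNilCons (.inr true) (fun _ _ => .inr false)) (fun a t => s.2.caseNilCons (.inr false)
        (fun b u => bif p a b then .inl (t, u) else .inr false)) : (List α × List β) ⊕ Bool)) := by
    refine .listCase (n := fun s : List α × List β => (s.2.caseNilCons (.inr true)
      (fun _ _ => .inr false) : (List α × List β) ⊕ Bool)) (c := fun s a t =>
      (s.2.caseNilCons (.inr false) (fun b u => bif p a b then .inl (t, u) else .inr false) :
        (List α × List β) ⊕ Bool)) (.fst .id) ?_ ?_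
    · exact .listCase (c := fun _ _ _ => (.inr false : (List α × List β) ⊕ Bool))
        (by fun_prop) (by fun_prop) (by fun_prop)
    · exact .listCase (c := fun (x : (α × List α) × List α × List β) b u =>
        (bif p x.1.1 b then .inl (x.1.2, u) else .inr false : (List α × List β) ⊕ Bool))
        (by fun_prop) (by fun_prop) (.cond (hp.comp (f := fun y : (β × List β) × (α × List α) ×
          List α × List β => (y.2.1.1, y.1.1)) (by fun_prop)) (by fun_prop) (by fun_prop))
  have h := hg.iterate (fun s => s.1.all₂' p s.2) (fun s => s.1.length) sz .X .X ?_ ?_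
    (fun _ => le_rfl) ?_ (fun _ => by simp)
  · exact h.comp (hl.prodMk hk)
  · rintro ⟨_ | ⟨a, l⟩, _ | ⟨b, k⟩⟩ s h
    · simp [List.caseNilCons] at h
    · simp [List.caseNilCons] at h
    · simp [List.caseNilCons] at h
    · simp only [List.caseNilCons] at h
      cases hp' : p a b with
      | false => simp [hp'] at h
      | true =>
        simp only [hp', cond_true] at h
        obtain rfl := Sum.inl_injective h
        simp [List.all₂', hp', sz_prod, sz_cons]
        omega
  · rintro ⟨_ | ⟨a, l⟩, _ | ⟨b, k⟩⟩ s h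
    · exact Sum.inr_injective h
    · exact Sum.inr_injective h
    · exact Sum.inr_injective h
    · simp only [List.caseNilCons] at h
      cases hp' : p a b with
      | false => simp only [hp', cond_false] at h; simpa [List.all₂', hp'] using Sum.inr_injective h
      | true => simp [hp'] at h
  · rintro ⟨l, k⟩
    simp only [sz_prod, Polynomial.eval_X]
    have := length_le_sz l
    omega


theorem zip {l : δ → List α} {k : δ → List β} (hl : PolyFun O l) (hk : PolyFun O k) :
    PolyFun O (fun x => (l x).zip (k x)) := by
  have hg : PolyFun O (fun s : List α × List β × List (α × β) => (s.1.caseNilCons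
      (.inr s.2.2) (fun a t => s.2.1.caseNilCons (.inr s.2.2)
        (fun b u => .inl (t, u, (a, b) :: s.2.2))) :
        (List α × List β × List (α × β)) ⊕ List (α × β))) := by
    refine .listCase (c := fun (s : List α × List β × List (α × β)) a t =>
        (s.2.1.caseNilCons (.inr s.2.2) (fun b u => .inl (t, u, (a, b) :: s.2.2)) :
        (List α × List β × List (α × β)) ⊕ List (α × β))) (.fst .id) (by fun_prop) ?_
    exact .listCase (c := fun (x : (α × List α) × List α × List β × List (α × β)) b u =>
        (.inl (x.1.2, u, (x.1.1, b) :: x.2.2.2) :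
          (List α × List β × List (α × β)) ⊕ List (α × β)))
        (by fun_prop) (by fun_prop) (by fun_prop)
  have h := hg.iterate (fun s => (s.1.zip s.2.1).reverse ++ s.2.2) (fun s => s.1.length) sz .X .X
    ?_ ?_ (fun _ => le_rfl) ?_ (fun _ => by simp)
  · exact (reverse (h.comp (hl.prodMk (hk.prodMk (const []))))).congr fun x => by simp
  · rintro ⟨_ | ⟨a, l⟩, _ | ⟨b, k⟩, m⟩ s h
    · simp [List.caseNilCons] at h
    · simp [List.caseNilCons] at h
    · simp [List.caseNilCons] at h
    · obtain rfl := Sum.inl_injective h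
      simp [sz_prod, sz_cons]
      omega
  · rintro ⟨_ | ⟨a, l⟩, _ | ⟨b, k⟩, m⟩ s h
    · exact Sum.inr_injective h
    · exact Sum.inr_injective h
    · exact Sum.inr_injective h
    · simp [List.caseNilCons] at h
  · rintro ⟨l, k, m⟩
    simp only [sz_prod, Polynomial.eval_X]
    have := length_le_sz l
    omega

end PolyFun

/-! ### Natural numbers -/

theorem Nat.bits_injective : Function.Injective Nat.bits := fun m n h => by
  have := congrArg (List.map fun b => cond b 1 0) h
  rwa [← Nat.digits_two_eq_bits, ← Nat.digits_two_eq_bits, Nat.digits_inj_iff] at this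

instance : StackData ℕ := .induced Nat.bits Nat.bits_injective

theorem StackData.enc_nat (n : ℕ) : enc n = encodeNat n := rfl

theorem StackData.sz_nat (n : ℕ) : sz n = 2 * n.size + 1 := by
  simp [sz, enc_nat, encodeNat, ← Nat.size_eq_bits_len, List.length_flatMap, mul_comm]

/-- The fold returns the last, most significant bit; the default `true` admits the empty word, which
represents 0. -/
theorem Nat.exists_bits_eq_iff (l : List Bool) :
    (∃ n, Nat.bits n = l) ↔ l.foldl (fun _ b => b) true = true := by
  induction l with
  | nil => simpa using ⟨0, Nat.zero_bits⟩
  | cons b l ih =>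
    cases l with
    | nil =>
      rw [List.foldl_cons, List.foldl_nil]
      constructor
      · rintro ⟨n, hn⟩
        rcases Nat.eq_zero_or_pos n with rfl | h
        · simp at hn
        · rw [← Nat.bit_bodd_div2 n, Nat.bits_append_bit _ _ (by
            intro h'
            have := Nat.bodd_add_div2 n
            cases h'' : n.bodd
            · simp [h', h''] at this; omega
            · rfl)] at hn
          have h₁ : n.div2 = 0 := Nat.bits_injective (by simpa using (List.cons.inj hn).2)
          have h₂ := Nat.bodd_add_div2 n
          rw [← (List.cons.inj hn).1]
          cases h'' : n.bodd
          · simp [h₁, h''] at h₂; omega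
          · rfl
      · rintro rfl
        exact ⟨1, Nat.one_bits⟩
    | cons c l =>
      have h : (b :: c :: l).foldl (fun _ b => b) true = (c :: l).foldl (fun _ b => b) true := rfl
      rw [h, ← ih]
      constructor
      · rintro ⟨n, hn⟩
        exact ⟨n.div2, by rw [Nat.div2_bits_eq_tail, hn]; rfl⟩
      · rintro ⟨n, hn⟩
        refine ⟨Nat.bit b n, ?_⟩
        rw [Nat.bits_append_bit, hn]
        rintro rfl
        simp at hn

instance : Guessable O ℕ := by
  refine .of_range Nat.bits (fun _ => rfl) (NPPred.congr (NPPred.of_bool (f := fun l =>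
    l.foldl (fun _ b => b) true) ?_) fun l => (Nat.exists_bits_eq_iff l).symm)
  exact .foldl (f := fun (_ : Unit) _ b => b) (by fun_prop) 1 (fun _ _ _ => by simp [sz_bool])
    (.const ()) (.const true) .id

theorem Nat.bits_eq_cons {n : ℕ} (h : n ≠ 0) : n.bits = n.bodd :: n.div2.bits := by
  conv_lhs => rw [← Nat.bit_bodd_div2 n]
  refine Nat.bits_append_bit _ _ fun h' => ?_
  have := Nat.bodd_add_div2 n
  cases h'' : n.bodd
  · simp [h', h''] at this; omega
  · rfl

theorem Nat.size_eq_succ {n : ℕ} (h : n ≠ 0) : n.size = n.div2.size + 1 := by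
  rw [← Nat.size_eq_bits_len, Nat.bits_eq_cons h, List.length_cons, Nat.size_eq_bits_len]

namespace PolyFun

theorem natView : PolyFun O (fun n : ℕ =>
    (if n = 0 then .inr () else .inl (n.bodd, n.div2) : (Bool × ℕ) ⊕ Unit)) := by
  refine .of_enc_eq fun n => ?_
  split_ifs with h
  · subst h; rfl
  · simp [enc, encodeList, Nat.bits_eq_cons h]

@[fun_prop]
theorem bodd {f : γ → ℕ} (hf : PolyFun O f) : PolyFun O (fun c => (f c).bodd) := by
  refine (sumElim (g := fun _ x => x.1) (h := fun _ _ => false) (natView.comp hf) (by fun_prop)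
    (by fun_prop)).congr fun c => ?_
  split_ifs with h <;> simp [h]

@[fun_prop]
theorem div2 {f : γ → ℕ} (hf : PolyFun O f) : PolyFun O (fun c => (f c).div2) := by
  refine (sumElim (g := fun _ x => x.2) (h := fun _ _ => 0) (natView.comp hf) (by fun_prop)
    (by fun_prop)).congr fun c => ?_
  split_ifs with h <;> simp [h]

@[fun_prop]
theorem isZero {f : γ → ℕ} (hf : PolyFun O f) : PolyFun O (fun c => decide (f c = 0)) := by
  refine (sumElim (g := fun _ x => false) (h := fun _ _ => true) (natView.comp hf) (by fun_prop)
    (by fun_prop)).congr fun c => ?_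
  split_ifs with h <;> simp [h]

@[fun_prop]
theorem xor {f g : γ → Bool} (hf : PolyFun O f) (hg : PolyFun O g) :
    PolyFun O (fun c => f c ^^ g c) :=
  (hf.cond (hg.not) hg).congr fun c => by cases f c <;> simp

/-- Schoolbook addition with a carry, comparing with the bits of the claimed sum from the lowest one
on. Since sums can be guessed, checking them is enough to compute them. -/
theorem addCheck : PolyFun O (fun s : Bool × ℕ × ℕ × ℕ =>
    decide (s.1.toNat + s.2.1 + s.2.2.1 = s.2.2.2)) := by
  have hg : PolyFun O (fun s : Bool × ℕ × ℕ × ℕ =>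
      (bif decide (s.2.2.2 = 0) then .inr (!s.1 && decide (s.2.1 = 0) && decide (s.2.2.1 = 0)) else
        bif (s.1 ^^ s.2.1.bodd ^^ s.2.2.1.bodd) ^^ s.2.2.2.bodd then .inr false else
        .inl (bif s.1 then bif s.2.1.bodd then true else s.2.2.1.bodd else
          s.2.1.bodd && s.2.2.1.bodd, s.2.1.div2, s.2.2.1.div2, s.2.2.2.div2) :
        (Bool × ℕ × ℕ × ℕ) ⊕ Bool)) := by fun_prop
  have hsz : ∀ n : ℕ, sz n.div2 ≤ sz n := fun n => by
    rw [sz_nat, sz_nat]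
    have := Nat.size_le_size (m := n.div2) (n := n) (by rw [Nat.div2_val]; omega)
    omega
  refine hg.iterate _ (fun s => s.2.2.2.size) sz .X .X ?_ ?_ (fun _ => le_rfl) ?_
    (fun _ => by simp)
  · rintro ⟨k, a, b, c⟩ s' h
    dsimp only at h
    by_cases hc : c = 0
    · simp [hc] at h
    · cases hx : ((k ^^ a.bodd ^^ b.bodd) ^^ c.bodd) with
      | true =>
        simp only [hc, decide_false, cond_false, hx, cond_true, reduceCtorEq] at h
      | false =>
        simp only [hc, decide_false, cond_false, hx] at h
        obtain rfl := Sum.inl_injective h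
        refine ⟨?_, ?_, ?_⟩
        · have ha := Nat.bodd_add_div2 a
          have hb := Nat.bodd_add_div2 b
          have hc := Nat.bodd_add_div2 c
          dsimp only
          rw [decide_eq_decide]
          cases k <;> cases h₁ : a.bodd <;> cases h₂ : b.bodd <;> cases h₃ : c.bodd <;>
            simp_all <;> omega
        · have := Nat.size_eq_succ hc
          simp only
          omega
        · simp only [sz_prod, sz_bool]
          have := hsz a
          have := hsz b
          have := hsz c
          omega
  · rintro ⟨k, a, b, c⟩ s' h
    dsimp only at h
    by_cases hc : c = 0
    · simp only [hc, decide_true, cond_true] at h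
      rw [← Sum.inr_injective h, Bool.eq_iff_iff]
      cases k <;> simp [hc]
    · cases hx : ((k ^^ a.bodd ^^ b.bodd) ^^ c.bodd) with
      | false =>
        simp only [hc, decide_false, cond_false, hx, reduceCtorEq] at h
      | true =>
        simp only [hc, decide_false, cond_false, hx, cond_true] at h
        rw [← Sum.inr_injective h, decide_eq_false_iff_not]
        have ha := Nat.bodd_add_div2 a
        have hb := Nat.bodd_add_div2 b
        have hc := Nat.bodd_add_div2 c
        dsimp only
        cases k <;> cases h₁ : a.bodd <;> cases h₂ : b.bodd <;> cases h₃ : c.bodd <;>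
            simp_all <;> omega
  · rintro ⟨k, a, b, c⟩
    simp only [sz_prod, sz_nat, Polynomial.eval_X]
    omega

theorem _root_.Nat.size_add_le (a b : ℕ) : (a + b).size ≤ a.size + b.size + 1 := by
  rw [Nat.size_le, pow_succ, pow_add]
  have ha := Nat.lt_size_self a
  have hb := Nat.lt_size_self b
  nlinarith

theorem _root_.Nat.size_mul_le (a b : ℕ) : (a * b).size ≤ a.size + b.size := by
  rw [Nat.size_le, pow_add]
  exact Nat.mul_lt_mul'' (Nat.lt_size_self a) (Nat.lt_size_self b)

@[fun_prop]
theorem natAdd {f g : γ → ℕ} (hf : PolyFun O f) (hg : PolyFun O g) :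
    PolyFun O (fun c => f c + g c) := by
  have h : PolyFun O (fun x : ℕ × ℕ => x.1 + x.2) := by
    refine .of_graph (P := fun c x => decide (Bool.toNat false + x.1 + x.2 = c) = true)
      (NPPred.of_bool (addCheck.comp (f := fun y : ℕ × ℕ × ℕ => (false, y.2.1, y.2.2, y.1))
        (by fun_prop))) ?_ (2 * .X + 1) ?_
    · simp [eq_comm]
    · intro x
      have := Nat.size_add_le x.1 x.2
      simp only [sz_nat, sz_prod, Polynomial.eval_add, Polynomial.eval_mul, Polynomial.eval_X,
        Polynomial.eval_one, Polynomial.eval_ofNat]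
      omega
  exact h.comp (hf.prodMk hg)

@[fun_prop]
theorem natMul {f g : γ → ℕ} (hf : PolyFun O f) (hg : PolyFun O g) :
    PolyFun O (fun c => f c * g c) := by
  have h : PolyFun O (fun s : ℕ × ℕ × ℕ => s.1 * s.2.1 + s.2.2) := by
    have hg : PolyFun O (fun s : ℕ × ℕ × ℕ => (bif decide (s.1 = 0) then .inr s.2.2 else
      .inl (s.1.div2, s.2.1 + s.2.1, bif s.1.bodd then s.2.2 + s.2.1 else s.2.2) :
      (ℕ × ℕ × ℕ) ⊕ ℕ)) := by fun_prop
    -- Shift and add with invariant a·b + d. Halving a removes one bit and doubling b adds at most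
    -- one, and a·b + d bounds the accumulator, so the size measure does not grow.
    refine hg.iterate _ (fun s => s.1.size)
      (fun s => 2 * (s.1.size + s.2.1.size) + 2 * (s.1 * s.2.1 + s.2.2).size + 3)
      .X (6 * .X + 6) ?_ ?_ ?_ ?_ ?_
    · rintro ⟨a, b, d⟩ s' h
      dsimp only at h
      by_cases ha : a = 0
      · simp [ha] at h
      · simp only [ha, decide_false, cond_false] at h
        obtain rfl := Sum.inl_injective h
        have h₁ : a.div2 * (b + b) + (bif a.bodd then d + b else d) = a * b + d := by
          conv_rhs => rw [← Nat.bodd_add_div2 a]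
          cases a.bodd <;> simp <;> ring
        have h₂ := Nat.size_eq_succ ha
        have h₃ : (b + b).size ≤ b.size + 1 := by
          rw [Nat.size_le, pow_succ]
          have := Nat.lt_size_self b
          omega
        refine ⟨h₁, by simp only; omega, ?_⟩
        simp only [h₁]
        omega
    · rintro ⟨a, b, d⟩ s' h
      dsimp only at h
      by_cases ha : a = 0
      · simp only [ha, decide_true, cond_true] at h
        rw [← Sum.inr_injective h]
        simp [ha]
      · simp [ha] at h
    · rintro ⟨a, b, d⟩
      simp only [sz_prod, sz_nat]
      have := Nat.size_le_size (Nat.le_add_left d (a * b))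
      omega
    · rintro ⟨a, b, d⟩
      simp only [sz_prod, sz_nat, Polynomial.eval_X]
      omega
    · rintro ⟨a, b, d⟩
      have := Nat.size_add_le (a * b) d
      have := Nat.size_mul_le a b
      simp only [sz_prod, sz_nat, Polynomial.eval_X, Polynomial.eval_add, Polynomial.eval_mul,
        Polynomial.eval_ofNat]
      omega
  exact (h.comp (hf.prodMk (hg.prodMk (const 0)))).congr fun c => by simp

-- The truth value is guessed together with a difference: x + c = y certifies `true` and (y + 1) + c
-- = x certifies `false`, so both answers have certificates.
@[fun_prop]
theorem natLe {f g : γ → ℕ} (hf : PolyFun O f) (hg : PolyFun O g) :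
    PolyFun O (fun c => decide (f c ≤ g c)) := by
  have h : PolyFun O (fun x : ℕ × ℕ => decide (x.1 ≤ x.2)) := by
    have h₁ : NPPred O (fun y : ℕ × Bool × ℕ × ℕ => decide (Bool.toNat false + y.1 +
        (bif y.2.1 then y.2.2.1 else y.2.2.2 + 1) =
          (bif y.2.1 then y.2.2.2 else y.2.2.1)) = true) :=
      NPPred.of_bool (addCheck.comp (f := fun y : ℕ × Bool × ℕ × ℕ => (false, y.1,
        (bif y.2.1 then y.2.2.1 else y.2.2.2 + 1), (bif y.2.1 then y.2.2.2 else y.2.2.1)))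
        (by fun_prop))
    refine .of_graph (NPPred.exists (P := fun (c : ℕ) (y : Bool × ℕ × ℕ) =>
      decide (Bool.toNat false + c + (bif y.1 then y.2.1 else y.2.2 + 1) =
        (bif y.1 then y.2.2 else y.2.1)) = true) h₁ .X ?_)
      (P := fun b x => ∃ c, decide (Bool.toNat false + c + (bif b then x.1 else x.2 + 1) =
        (bif b then x.2 else x.1)) = true) ?_ 1 (by simp [sz_bool])
    · rintro ⟨b, x, y⟩ c h
      refine ⟨c, h, ?_⟩
      simp only [sz_prod, sz_nat, Polynomial.eval_X]
      have : c.size ≤ x.size ∨ c.size ≤ y.size := by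
        cases b
        · exact .inl (Nat.size_le_size (by simp at h; omega))
        · exact .inr (Nat.size_le_size (by simp at h; omega))
      omega
    · rintro ⟨x, y⟩ b
      cases b
      · simp only [Bool.toNat_false, zero_add, cond_false, decide_eq_true_eq]
        rw [eq_comm, decide_eq_false_iff_not]
        constructor
        · rintro ⟨c, h⟩
          omega
        · intro h
          exact ⟨x - (y + 1), by omega⟩
      · simp only [Bool.toNat_false, zero_add, cond_true, decide_eq_true_eq]
        rw [eq_comm, decide_eq_true_eq]
        constructor
        · rintro ⟨c, h⟩
          omega
        · intro h
          exact ⟨y - x, by omega⟩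
  exact h.comp (hf.prodMk hg)

@[fun_prop]
theorem natEq {f g : γ → ℕ} (hf : PolyFun O f) (hg : PolyFun O g) :
    PolyFun O (fun c => decide (f c = g c)) :=
  ((hf.natLe hg).and (hg.natLe hf)).congr fun c => by
    rw [← Bool.decide_and, decide_eq_decide, ← le_antisymm_iff]

end PolyFun

/-! ### Integers and rational numbers -/

instance : StackData ℤ := .induced (fun z => (decide (z < 0), z.natAbs)) fun a b h => by
  simp only [Prod.mk.injEq, decide_eq_decide] at h
  omega

theorem StackData.enc_int (z : ℤ) : enc z = encodeInt z := rfl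

theorem StackData.sz_int (z : ℤ) : sz z = 2 * z.natAbs.size + 2 := by
  have : sz z = sz (decide (z < 0)) + sz z.natAbs := sz_prod (decide (z < 0), z.natAbs)
  rw [this, sz_nat, sz_bool]
  omega

instance : StackData ℚ := .induced (fun q => (q.num, q.den)) fun a b h => by
  simp only [Prod.mk.injEq] at h
  exact Rat.ext h.1 h.2

theorem StackData.enc_rat (q : ℚ) : enc q = encodeRat q := rfl

theorem StackData.sz_rat (q : ℚ) : sz q = 2 * (q.num.natAbs.size + q.den.size) + 3 := by
  have : sz q = sz q.num + sz q.den := sz_prod (q.num, q.den)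
  rw [this, sz_int, sz_nat]
  omega

namespace PolyFun

theorem intView : PolyFun O (fun z : ℤ => (decide (z < 0), z.natAbs)) := .of_enc_eq fun _ => rfl

theorem ratView : PolyFun O (fun q : ℚ => (q.num, q.den)) := .of_enc_eq fun _ => rfl

@[fun_prop]
theorem natAbs {f : γ → ℤ} (hf : PolyFun O f) : PolyFun O (fun c => (f c).natAbs) :=
  (snd intView).comp hf

@[fun_prop]
theorem toNat {f : γ → ℤ} (hf : PolyFun O f) : PolyFun O (fun c => (f c).toNat) := by
  have h : PolyFun O (fun z : ℤ => bif decide (z < 0) then 0 else z.natAbs) :=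
    ((fst intView).cond (const 0) (snd intView))
  refine (h.comp hf).congr fun c => ?_
  by_cases h : f c < 0 <;> simp [h] <;> omega

@[fun_prop]
theorem toNatNeg {f : γ → ℤ} (hf : PolyFun O f) : PolyFun O (fun c => (-f c).toNat) := by
  have h : PolyFun O (fun z : ℤ => bif decide (z < 0) then z.natAbs else 0) :=
    ((fst intView).cond (snd intView) (const 0))
  refine (h.comp hf).congr fun c => ?_
  by_cases h : f c < 0 <;> simp [h] <;> omega

@[fun_prop]
theorem natCast {f : γ → ℕ} (hf : PolyFun O f) : PolyFun O (fun c => (f c : ℤ)) := by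
  have h : PolyFun O (fun n : ℕ => (n : ℤ)) :=
    .of_run (.push 0 false) trivial 1 fun n r => ⟨1, by simp, .push' (by
      have h : enc (n : ℤ) = false :: enc n := by
        simp [enc_int, enc_nat, encodeInt]
      simp [h])⟩
  exact h.comp hf

@[fun_prop]
theorem intLe {f g : γ → ℤ} (hf : PolyFun O f) (hg : PolyFun O g) :
    PolyFun O (fun c => decide (f c ≤ g c)) := by
  have h : PolyFun O (fun c => decide ((f c).toNat + (-g c).toNat ≤ (g c).toNat + (-f c).toNat)) :=
    by fun_prop
  refine h.congr fun c => ?_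
  rw [decide_eq_decide]
  omega

@[fun_prop]
theorem intEq {f g : γ → ℤ} (hf : PolyFun O f) (hg : PolyFun O g) :
    PolyFun O (fun c => decide (f c = g c)) :=
  ((hf.intLe hg).and (hg.intLe hf)).congr fun c => by
    rw [← Bool.decide_and, decide_eq_decide, ← le_antisymm_iff]

end PolyFun

instance : Guessable O ℤ := by
  refine .of_range (fun z => (decide (z < 0), z.natAbs)) (fun _ => rfl) (NPPred.congr
    (NPPred.of_bool (f := fun x : Bool × ℕ => !(x.1 && decide (x.2 = 0))) (by fun_prop)) ?_)
  rintro ⟨b, n⟩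
  simp only [Bool.not_eq_true', Bool.and_eq_false_imp, decide_eq_false_iff_not, Prod.mk.injEq]
  constructor
  · intro h
    cases b
    · exact ⟨n, by simp, by simp⟩
    · have := h rfl
      exact ⟨-n, by simp; omega, by simp⟩
  · rintro ⟨z, hz, rfl⟩ rfl
    simp only [decide_eq_true_eq] at hz
    omega

namespace PolyFun

theorem intOfGraph {f : α → ℤ} {p : ℤ → α → Bool} (h : PolyFun O (fun x : ℤ × α => p x.1 x.2))
    (hp : ∀ a z, p z a = true ↔ z = f a) (Q : Polynomial ℕ)
    (hQ : ∀ a, (f a).natAbs.size ≤ Q.eval (sz a)) : PolyFun O f :=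
  .of_graph (P := fun z a => p z a = true) (.of_bool h) hp (2 * Q + 2) fun a => by
    rw [sz_int]
    have := hQ a
    simp only [Polynomial.eval_add, Polynomial.eval_mul, Polynomial.eval_ofNat]
    omega

@[fun_prop]
theorem intAdd {f g : γ → ℤ} (hf : PolyFun O f) (hg : PolyFun O g) :
    PolyFun O (fun c => f c + g c) := by
  have h : PolyFun O (fun x : ℤ × ℤ => x.1 + x.2) := by
    refine intOfGraph (p := fun z x => decide (x.1.toNat + x.2.toNat + (-z).toNat =
      (-x.1).toNat + (-x.2).toNat + z.toNat)) (by fun_prop) ?_ .X ?_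
    · rintro ⟨x, y⟩ z
      rw [decide_eq_true_iff]
      dsimp only
      omega
    · rintro ⟨x, y⟩
      have h₁ := Nat.size_le_size (Int.natAbs_add_le x y)
      have h₂ := Nat.size_add_le x.natAbs y.natAbs
      simp only [sz_prod, sz_int, Polynomial.eval_X]
      omega
  exact h.comp (hf.prodMk hg)

@[fun_prop]
theorem intMul {f g : γ → ℤ} (hf : PolyFun O f) (hg : PolyFun O g) :
    PolyFun O (fun c => f c * g c) := by
  have h : PolyFun O (fun x : ℤ × ℤ => x.1 * x.2) := by
    refine intOfGraph (p := fun z x => decide (z.toNat + (x.1.toNat * (-x.2).toNat +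
      (-x.1).toNat * x.2.toNat) = (-z).toNat + (x.1.toNat * x.2.toNat +
      (-x.1).toNat * (-x.2).toNat))) (by fun_prop) ?_ .X ?_
    · rintro ⟨x, y⟩ z
      rw [decide_eq_true_iff]
      dsimp only
      have hx : x = x.toNat - (-x).toNat := by omega
      have hy : y = y.toNat - (-y).toNat := by omega
      have hz : z = z.toNat - (-z).toNat := by omega
      generalize x.toNat = x₁, (-x).toNat = x₂, y.toNat = y₁, (-y).toNat = y₂, z.toNat = z₁,
        (-z).toNat = z₂ at hx hy hz ⊢
      subst hx hy hz
      rw [← Nat.cast_inj (R := ℤ)]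
      push_cast
      constructor <;> intro h <;> linarith
    · rintro ⟨x, y⟩
      have h₂ := Nat.size_mul_le x.natAbs y.natAbs
      simp only [sz_prod, sz_int, Polynomial.eval_X, Int.natAbs_mul]
      omega
  exact h.comp (hf.prodMk hg)

@[fun_prop]
theorem intNeg {f : γ → ℤ} (hf : PolyFun O f) : PolyFun O (fun c => -f c) := by
  have h : PolyFun O (fun c => (-1 : ℤ) * f c) := by fun_prop
  exact h.congr fun c => by ring

@[fun_prop]
theorem num {f : γ → ℚ} (hf : PolyFun O f) : PolyFun O (fun c => (f c).num) :=
  (fst ratView).comp hf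

@[fun_prop]
theorem den {f : γ → ℚ} (hf : PolyFun O f) : PolyFun O (fun c => (f c).den) :=
  (snd ratView).comp hf

end PolyFun

/-- The certificate is a Bézout identity u·p + 1 = v·q in natural numbers, which also excludes q =
0. Recognizing reduced fractions is what makes rational numbers guessable. -/
theorem NPPred.coprime : NPPred O (fun x : ℕ × ℕ => x.1.Coprime x.2 ∧ x.2 ≠ 0) := by
  have h : NPPred O (fun x : (ℕ × ℕ) × ℕ × ℕ =>
      decide (x.1.1 * x.2.1 + 1 = x.1.2 * x.2.2) = true) := .of_bool (by fun_prop)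
  have hsound : ∀ p q u v : ℕ, u * p + 1 = v * q → p.Coprime q ∧ q ≠ 0 := by
    intro p q u v h
    constructor
    · refine Nat.dvd_one.1 ?_
      have h₁ : p.gcd q ∣ u * p + 1 := h ▸ (Nat.gcd_dvd_right p q).mul_left v
      exact (Nat.dvd_add_right ((Nat.gcd_dvd_left p q).mul_left u)).1 h₁
    · rintro rfl
      simp at h
  have hcomplete : ∀ p q : ℕ, p.Coprime q → q ≠ 0 →
      ∃ u v : ℕ, u * p + 1 = v * q ∧ u ≤ q ∧ v ≤ p + 1 := by
    intro p q h hq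
    obtain ⟨u, hu, hv⟩ : ∃ u < q, q ∣ u * p + 1 := by
      have : NeZero q := ⟨hq⟩
      have hunit := ZMod.coe_mul_inv_eq_one p h
      -- u is the residue of -1/p modulo q, which keeps both coefficients small.
      refine ⟨(-((p : ZMod q)⁻¹)).val, ZMod.val_lt _, ?_⟩
      rw [← ZMod.natCast_eq_zero_iff]
      push_cast
      rw [ZMod.natCast_zmod_val, neg_mul, mul_comm, hunit]
      ring
    obtain ⟨v, hv⟩ := hv
    refine ⟨u, v, by rw [hv, mul_comm], hu.le, ?_⟩
    by_contra! hlt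
    have : q * (p + 2) ≤ q * v := Nat.mul_le_mul_left q hlt
    have : u * p ≤ q * p := Nat.mul_le_mul_right p hu.le
    have : 0 < q := Nat.pos_of_ne_zero hq
    nlinarith
  refine (NPPred.exists (P := fun (y : ℕ × ℕ) (x : ℕ × ℕ) =>
    decide (y.1 * x.1 + 1 = y.2 * x.2) = true) ?_ (2 * .X + 2) ?_).congr ?_
  · exact .of_bool (by fun_prop)
  · rintro ⟨p, q⟩ ⟨u, v⟩ h
    obtain ⟨h₁, h₂⟩ := hsound p q u v (by simpa using h)
    obtain ⟨u, v, h, hu, hv⟩ := hcomplete p q h₁ h₂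
    refine ⟨(u, v), by simpa using h, ?_⟩
    have h₃ := Nat.size_le_size hu
    have h₄ := Nat.size_le_size hv
    have h₅ := Nat.size_add_le p 1
    have h₆ : Nat.size 1 = 1 := Nat.size_one
    simp only [sz_prod, sz_nat, Polynomial.eval_add, Polynomial.eval_mul, Polynomial.eval_X,
      Polynomial.eval_ofNat]
    omega
  · rintro ⟨p, q⟩
    constructor
    · rintro ⟨⟨u, v⟩, h⟩
      exact hsound p q u v (by simpa using h)
    · rintro ⟨h₁, h₂⟩
      obtain ⟨u, v, h, -⟩ := hcomplete p q h₁ h₂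
      exact ⟨(u, v), by simpa using h⟩

instance : Guessable O ℚ := by
  refine .of_range (fun q => (q.num, q.den)) (fun _ => rfl) (NPPred.congr
    (NPPred.coprime.comap (f := fun x : ℤ × ℕ => (x.1.natAbs, x.2)) (by fun_prop)) ?_)
  rintro ⟨n, d⟩
  constructor
  · rintro ⟨h, hd⟩
    exact ⟨⟨n, d, hd, h⟩, rfl⟩
  · rintro ⟨q, h⟩
    obtain ⟨rfl, rfl⟩ := Prod.mk.inj h
    exact ⟨q.reduced, q.den_nz⟩

/-! ### Heights of rational numbers -/

namespace Rat

/-- The height: numerator plus denominator. -/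
def height (q : ℚ) : ℕ := q.num.natAbs + q.den

theorem height_divInt_le (a b : ℤ) (hb : b ≠ 0) : (divInt a b).height ≤ a.natAbs + b.natAbs := by
  refine Nat.add_le_add ?_ ?_
  · rcases eq_or_ne a 0 with rfl | ha
    · simp
    · exact Nat.le_of_dvd (Int.natAbs_pos.2 ha) (Int.natAbs_dvd_natAbs.2 (num_dvd a hb))
  · have := Int.natAbs_dvd_natAbs.2 (den_dvd a b)
    exact Nat.le_of_dvd (Int.natAbs_pos.2 hb) (by simpa using this)

/-- The product of the heights expands to terms dominating the unreduced numerator and denominator.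
Thus sums, like products, at most add the bit counts, so all later size estimates are additive in
the exponent. -/
theorem height_add_le (a b : ℚ) : (a + b).height ≤ a.height * b.height := by
  have h : a + b = divInt (a.num * b.den + b.num * a.den) (a.den * b.den) := by
    rw [add_def', ← divInt_ofNat]; push_cast; rfl
  rw [h]
  refine (height_divInt_le _ _ (by exact_mod_cast mul_ne_zero a.den_nz b.den_nz)).trans ?_
  have := Int.natAbs_add_le (a.num * b.den) (b.num * a.den)
  simp only [Int.natAbs_mul, Int.natAbs_natCast, height] at *
  nlinarith [Nat.zero_le (a.num.natAbs * b.num.natAbs)]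

theorem height_mul_le (a b : ℚ) : (a * b).height ≤ a.height * b.height := by
  have h : a * b = divInt (a.num * b.num) (a.den * b.den) := by
    rw [mul_def', ← divInt_ofNat]; push_cast; rfl
  rw [h]
  refine (height_divInt_le _ _ (by exact_mod_cast mul_ne_zero a.den_nz b.den_nz)).trans ?_
  simp only [Int.natAbs_mul, Int.natAbs_natCast, height] at *
  nlinarith [Nat.zero_le (a.num.natAbs * b.den), Nat.zero_le (b.num.natAbs * a.den)]

@[simp] theorem height_neg (a : ℚ) : (-a).height = a.height := by simp [height]

theorem height_le_two_pow (q : ℚ) : q.height ≤ 2 ^ sz q := by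
  have h₁ := Nat.lt_size_self q.num.natAbs
  have h₂ := Nat.lt_size_self q.den
  have h₃ : 2 ^ q.num.natAbs.size ≤ 2 ^ (q.num.natAbs.size + q.den.size) :=
    Nat.pow_le_pow_right (by norm_num) (by omega)
  have h₄ : 2 ^ q.den.size ≤ 2 ^ (q.num.natAbs.size + q.den.size) :=
    Nat.pow_le_pow_right (by norm_num) (by omega)
  have h₅ : 2 ^ (q.num.natAbs.size + q.den.size + 1) ≤ 2 ^ sz q :=
    Nat.pow_le_pow_right (by norm_num) (by rw [sz_rat]; omega)
  rw [pow_succ] at h₅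
  simp only [height]
  omega

theorem sz_le_of_height {q : ℚ} {N : ℕ} (h : q.height ≤ 2 ^ N) : sz q ≤ 4 * N + 7 := by
  have h₁ : q.num.natAbs.size ≤ N + 1 := Nat.size_le.2 (by
    have := q.den_pos; rw [pow_succ]; simp only [height] at h; omega)
  have h₂ : q.den.size ≤ N + 1 := Nat.size_le.2 (by
    have := q.den_pos; rw [pow_succ]; simp only [height] at h; omega)
  rw [sz_rat]
  omega

end Rat

namespace PolyFun

/-- A reduced fraction is guessed and checked by an integer identity, so no fraction is ever reduced
by an algorithm. -/
theorem ratOfGraph {f : α → ℚ} {p : ℚ → α → Bool} (h : PolyFun O (fun x : ℚ × α => p x.1 x.2))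
    (hp : ∀ a z, p z a = true ↔ z = f a) (Q : Polynomial ℕ)
    (hQ : ∀ a, (f a).height ≤ 2 ^ Q.eval (sz a)) : PolyFun O f :=
  .of_graph (P := fun z a => p z a = true) (.of_bool h) hp (4 * Q + 7) fun a => by
    have := Rat.sz_le_of_height (hQ a)
    simp only [Polynomial.eval_add, Polynomial.eval_mul, Polynomial.eval_ofNat]
    omega

theorem _root_.Rat.eq_iff_num_mul {q : ℚ} {a b : ℤ} (hb : b ≠ 0) :
    q.num * b = a * q.den ↔ q = a / b := by
  rw [eq_div_iff (by exact_mod_cast hb)]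
  conv_rhs => rw [← Rat.num_div_den q, div_mul_eq_mul_div, div_eq_iff (by exact_mod_cast q.den_nz)]
  norm_cast

@[fun_prop]
theorem ratAdd {f g : γ → ℚ} (hf : PolyFun O f) (hg : PolyFun O g) :
    PolyFun O (fun c => f c + g c) := by
  have h : PolyFun O (fun x : ℚ × ℚ => x.1 + x.2) := by
    refine ratOfGraph (p := fun z x => decide (z.num * ((x.1.den : ℤ) * (x.2.den : ℤ)) =
      (x.1.num * (x.2.den : ℤ) + x.2.num * (x.1.den : ℤ)) * (z.den : ℤ))) (by fun_prop) ?_ .X ?_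
    · rintro ⟨x, y⟩ z
      have hx : (x.den : ℚ) ≠ 0 := by exact_mod_cast x.den_nz
      have hy : (y.den : ℚ) ≠ 0 := by exact_mod_cast y.den_nz
      rw [decide_eq_true_iff, Rat.eq_iff_num_mul (by exact_mod_cast mul_ne_zero x.den_nz y.den_nz)]
      push_cast
      conv_rhs => rw [← Rat.num_div_den x, ← Rat.num_div_den y, div_add_div _ _ hx hy]
      rw [mul_comm (y.num : ℚ)]
    · rintro ⟨x, y⟩
      simp only [sz_prod, Polynomial.eval_X, pow_add]
      exact (Rat.height_add_le x y).trans
        (Nat.mul_le_mul x.height_le_two_pow y.height_le_two_pow)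
  exact h.comp (hf.prodMk hg)

@[fun_prop]
theorem ratMul {f g : γ → ℚ} (hf : PolyFun O f) (hg : PolyFun O g) :
    PolyFun O (fun c => f c * g c) := by
  have h : PolyFun O (fun x : ℚ × ℚ => x.1 * x.2) := by
    refine ratOfGraph (p := fun z x => decide (z.num * ((x.1.den : ℤ) * (x.2.den : ℤ)) =
      (x.1.num * x.2.num) * (z.den : ℤ))) (by fun_prop) ?_ .X ?_
    · rintro ⟨x, y⟩ z
      rw [decide_eq_true_iff, Rat.eq_iff_num_mul (by exact_mod_cast mul_ne_zero x.den_nz y.den_nz)]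
      push_cast
      conv_rhs => rw [← Rat.num_div_den x, ← Rat.num_div_den y, div_mul_div_comm]
    · rintro ⟨x, y⟩
      simp only [sz_prod, Polynomial.eval_X, pow_add]
      exact (Rat.height_mul_le x y).trans
        (Nat.mul_le_mul x.height_le_two_pow y.height_le_two_pow)
  exact h.comp (hf.prodMk hg)

@[fun_prop]
theorem ratNeg {f : γ → ℚ} (hf : PolyFun O f) : PolyFun O (fun c => -f c) := by
  have h : PolyFun O (fun c => (-1 : ℚ) * f c) := by fun_prop
  exact h.congr fun c => by ring

@[fun_prop]
theorem ratSub {f g : γ → ℚ} (hf : PolyFun O f) (hg : PolyFun O g) :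
    PolyFun O (fun c => f c - g c) := by
  have h : PolyFun O (fun c => f c + -g c) := by fun_prop
  exact h.congr fun c => by ring

@[fun_prop]
theorem ratLe {f g : γ → ℚ} (hf : PolyFun O f) (hg : PolyFun O g) :
    PolyFun O (fun c => decide (f c ≤ g c)) := by
  have h : PolyFun O (fun c => decide ((f c).num * ((g c).den : ℤ) ≤
      (g c).num * ((f c).den : ℤ))) := by fun_prop
  exact h.congr fun c => by rw [decide_eq_decide, Rat.le_iff]

@[fun_prop]
theorem intCast {f : γ → ℤ} (hf : PolyFun O f) : PolyFun O (fun c => (f c : ℚ)) := by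
  have h : PolyFun O (fun x : ℤ => (x : ℚ)) := by
    refine ratOfGraph (p := fun z x => decide (z.num * 1 = x * (z.den : ℤ))) (by fun_prop) ?_ .X ?_
    · intro x z
      rw [decide_eq_true_iff, Rat.eq_iff_num_mul one_ne_zero]
      simp
    · intro x
      have h := Nat.lt_size_self x.natAbs
      have h' : 2 ^ x.natAbs.size < 2 ^ sz x :=
        Nat.pow_lt_pow_right (by norm_num) (by rw [sz_int]; omega)
      simp only [Polynomial.eval_X, Rat.height, Rat.num_intCast, Rat.den_intCast]
      omega
  exact h.comp hf

@[fun_prop]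
theorem invSucc {f : γ → ℕ} (hf : PolyFun O f) : PolyFun O (fun c => 1 / ((f c : ℚ) + 1)) := by
  have h : PolyFun O (fun x : ℕ => 1 / ((x : ℚ) + 1)) := by
    refine ratOfGraph (p := fun z x => decide (z.num * ((x : ℤ) + 1) = 1 * (z.den : ℤ)))
      (by fun_prop) ?_ .X ?_
    · intro x z
      rw [decide_eq_true_iff, Rat.eq_iff_num_mul (by omega)]
      simp
    · intro x
      have h : 1 / ((x : ℚ) + 1) = Rat.divInt 1 (x + 1) := by
        rw [Rat.divInt_eq_div]; push_cast; rfl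
      rw [h]
      refine (Rat.height_divInt_le _ _ (by omega)).trans ?_
      have h := Nat.lt_size_self x
      have h' : 2 ^ (x.size + 1) ≤ 2 ^ sz x :=
        Nat.pow_le_pow_right (by norm_num) (by rw [sz_nat]; omega)
      rw [pow_succ] at h'
      have : 1 ≤ 2 ^ x.size := Nat.one_le_two_pow
      simp only [Polynomial.eval_X]
      omega
  exact h.comp hf

end PolyFun

/-! ### Further computable functions -/

/-- The entries of a list, each with the entries after it. -/
def List.withTails {α : Type} : List α → List (α × List α)
  | [] => []
  | a :: l => (a, l) :: withTails l

namespace PolyFun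

theorem withTails {l : δ → List α} (hl : PolyFun O l) : PolyFun O (fun x => (l x).withTails) := by
  have hg : PolyFun O (fun s : List α × List (α × List α) => (s.1.caseNilCons (.inr s.2.reverse)
      (fun a t => .inl (t, (a, t) :: s.2)) :
        (List α × List (α × List α)) ⊕ List (α × List α))) :=
    .listCase (c := fun s a t => (.inl (t, (a, t) :: s.2) :
        (List α × List (α × List α)) ⊕ List (α × List α))) (.fst .id) (by fun_prop) (by fun_prop)
  have h := hg.iterate (fun s => s.2.reverse ++ s.1.withTails) (fun s => s.1.length)
    (fun s => sz s.2 + sz s.1 ^ 2) .X (.X + .X ^ 2) ?_ ?_ ?_ ?_ ?_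
  · exact (h.comp (hl.prodMk (const []))).congr fun x => by simp
  · rintro ⟨_ | ⟨a, l⟩, m⟩ s h
    · simp [List.caseNilCons] at h
    · obtain rfl := Sum.inl_injective h
      refine ⟨by simp [List.withTails], by simp, ?_⟩
      have := one_le_sz_list l
      simp only [sz_cons, sz_prod]
      nlinarith
  · rintro ⟨_ | ⟨a, l⟩, m⟩ s h
    · simpa [List.withTails] using Sum.inr_injective h
    · simp [List.caseNilCons] at h
  · rintro ⟨l, m⟩
    have := one_le_sz_list l
    simp only [sz_prod]
    nlinarith
  · rintro ⟨l, m⟩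
    have := length_le_sz l
    simp only [sz_prod, Polynomial.eval_X]
    omega
  · rintro ⟨l, m⟩
    simp only [sz_prod, Polynomial.eval_X, Polynomial.eval_add, Polynomial.eval_pow]
    have : sz l ^ 2 ≤ (sz l + sz m) ^ 2 := Nat.pow_le_pow_left (by omega) 2
    omega

@[fun_prop]
theorem append {l k : δ → List α} (hl : PolyFun O l) (hk : PolyFun O k) :
    PolyFun O (fun x => l x ++ k x) := by
  refine (foldr (f := fun (_ : Unit) a (k : List α) => a :: k) (c := fun _ => ()) (by fun_prop)
    .X ?_ (const _) hk hl).congr fun x => by simp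
  intro c b l
  have := sz_append l b
  simp only [List.foldr_cons_eq_append', Polynomial.eval_X]
  omega

@[fun_prop]
theorem flatten {l : δ → List (List α)} (hl : PolyFun O l) :
    PolyFun O (fun x => (l x).flatten) := by
  refine (foldr (f := fun (_ : Unit) a (k : List α) => a ++ k) (c := fun _ => ()) (b := fun _ => [])
    (by fun_prop) .X ?_ (const _) (const _) hl).congr fun x => ?_
  · intro c b l
    rw [Polynomial.eval_X]
    induction l with
    | nil => simp only [List.foldr_nil]; omega
    | cons a l ih =>
      have := sz_append a (l.foldr (fun a k => a ++ k) b)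
      rw [sz_cons, List.foldr_cons]
      omega
  · induction l x <;> simp_all

theorem powLength {K : δ → ℕ} {l : δ → List α} (hK : PolyFun O K) (hl : PolyFun O l) :
    PolyFun O (fun x => K x ^ (l x).length) := by
  refine (foldr (f := fun (K : ℕ) (_ : α) r => r * K) (c := K) (b := fun _ => 1) (by fun_prop)
    (.X ^ 2 + 2 * .X + 1) ?_ hK (const _) hl).congr fun x => ?_
  · intro K b l
    have h : (l.foldr (fun _ r => r * K) b).size ≤ b.size + l.length * K.size := by
      induction l with
      | nil => simp
      | cons a l ih =>
        rw [List.foldr_cons, List.length_cons, add_mul]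
        have := Nat.size_mul_le (l.foldr (fun _ r => r * K) b) K
        omega
    have := Nat.mul_le_mul_right K.size (length_le_sz l)
    simp only [sz_nat, Polynomial.eval_add, Polynomial.eval_mul, Polynomial.eval_pow,
      Polynomial.eval_X, Polynomial.eval_one, Polynomial.eval_ofNat]
    nlinarith [Nat.zero_le (sz l), Nat.zero_le K.size, Nat.zero_le b.size]
  · induction l x with
    | nil => rfl
    | cons a l ih => rw [List.foldr_cons, ih, List.length_cons, pow_succ]

/-- Polynomially many bits suffice to exceed any bound with polynomially many bits. -/
theorem exists_large (q : Polynomial ℕ) :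
    ∃ f : α → ℕ, PolyFun O f ∧ ∀ a, 2 ^ q.eval (sz a) ≤ f a := by
  induction q using Polynomial.induction_on with
  | C c => exact ⟨fun _ => 2 ^ c, const _, fun a => by simp⟩
  | add p q hp hq =>
    obtain ⟨f, hf, h⟩ := hp
    obtain ⟨g, hg, h'⟩ := hq
    refine ⟨fun a => f a * g a, by fun_prop, fun a => ?_⟩
    rw [Polynomial.eval_add, pow_add]
    exact Nat.mul_le_mul (h a) (h' a)
  | monomial n c ih =>
    obtain ⟨f, hf, h⟩ := ih
    -- Raising to the power `sz a`, the length of the code word, multiplies the exponent of 2 by the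
    -- input size, hence raises its degree by one.
    refine ⟨fun a => f a ^ (enc a).length, powLength hf code, fun a => ?_⟩
    rw [pow_succ, ← mul_assoc, Polynomial.eval_mul, Polynomial.eval_X, pow_mul]
    exact Nat.pow_le_pow_left (h a) _

end PolyFun

/-! ### Raw problem data -/

/-- The coefficients of a linear form: integer variables, continuous variables, by levels. -/
abbrev RawForm := List (List ℚ) × List (List ℚ)

/-- The data of a multilevel problem: dimensions, bounds, objectives and constraints. -/
abbrev RawProblem :=
  List ℕ × List ℕ × List (List ℤ) × List (List ℤ) × List RawForm × List (List (RawForm × ℚ))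

/-- The coordinates of a joint decision. -/
abbrev RawPoint := List (List ℤ) × List (List ℚ)

def dot (a b : List ℚ) : ℚ := ((a.zip b).map fun x => x.1 * x.2).sum

def dot₂ (a b : List (List ℚ)) : ℚ := ((a.zip b).map fun x => dot x.1 x.2).sum

namespace RawForm

/-- The value of a linear form at a point. -/
def eval (F : RawForm) (y : RawPoint) : ℚ :=
  dot₂ F.1 (y.1.map fun r => r.map fun z : ℤ => (z : ℚ)) + dot₂ F.2 y.2

/-- Replace the first list by zeros. -/
def zeroHead (l : List (List ℚ)) : List (List ℚ) :=
  l.caseNilCons [] fun r t => (r.map fun _ => 0) :: t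

/-- The combination of the lower-level part of `F` and the integer variables of the lower levels
weighted with distinct powers of `K`, with coefficients `A` and `B`. -/
def comb (A B : ℚ) (K : ℕ) (F : RawForm) : RawForm :=
  (zeroHead (F.1.withTails.map fun x => x.1.withTails.map fun y =>
    A * y.1 + B * (K : ℚ) ^ (x.2.flatten.length + y.2.length)),
   zeroHead (F.2.map fun r => r.map fun c => A * c))

end RawForm

namespace PolyFun

@[fun_prop]
theorem listSum {l : δ → List ℚ} (hl : PolyFun O l) : PolyFun O (fun x => (l x).sum) := by
  refine (foldr (f := fun (_ : Unit) (a b : ℚ) => a + b) (c := fun _ => ()) (b := fun _ => 0)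
    (by fun_prop) (4 * .X + 7) ?_ (const _) (const _) hl).congr fun x => rfl
  intro c b l
  have h : (l.foldr (fun a b => a + b) b).height ≤ 2 ^ (sz b + sz l) := by
    induction l with
    | nil => exact b.height_le_two_pow.trans (Nat.pow_le_pow_right (by norm_num) (by omega))
    | cons a l ih =>
      refine (Rat.height_add_le _ _).trans ((Nat.mul_le_mul a.height_le_two_pow ih).trans ?_)
      rw [← pow_add]
      exact Nat.pow_le_pow_right (by norm_num) (by rw [sz_cons]; omega)
  refine (Rat.sz_le_of_height h).trans ?_
  simp only [Polynomial.eval_add, Polynomial.eval_mul, Polynomial.eval_X, Polynomial.eval_ofNat]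
  omega

@[fun_prop]
theorem dot {f g : δ → List ℚ} (hf : PolyFun O f) (hg : PolyFun O g) :
    PolyFun O (fun x => dot (f x) (g x)) :=
  listSum (map (f := fun (_ : Unit) (x : ℚ × ℚ) => x.1 * x.2) (c := fun _ => ()) (by fun_prop)
    (by fun_prop) (zip hf hg))

@[fun_prop]
theorem dot₂ {f g : δ → List (List ℚ)} (hf : PolyFun O f) (hg : PolyFun O g) :
    PolyFun O (fun x => dot₂ (f x) (g x)) :=
  listSum (map (f := fun (_ : Unit) (x : List ℚ × List ℚ) => _root_.dot x.1 x.2) (c := fun _ => ())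
    (by fun_prop) (by fun_prop) (zip hf hg))

@[fun_prop]
theorem rawEval {f : δ → RawForm} {g : δ → RawPoint} (hf : PolyFun O f) (hg : PolyFun O g) :
    PolyFun O (fun x => (f x).eval (g x)) := by
  have h' : PolyFun O (fun x : Unit × List ℤ => x.2.map fun z : ℤ => (z : ℚ)) :=
    map (O := O) (f := fun (_ : Unit) (z : ℤ) => (z : ℚ)) (c := fun _ => ())
      (l := fun x : Unit × List ℤ => x.2) (by fun_prop) (by fun_prop) (by fun_prop)
  have h : PolyFun O (fun x => (g x).1.map fun r => r.map fun z : ℤ => (z : ℚ)) :=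
    map (f := fun (_ : Unit) (r : List ℤ) => r.map fun z : ℤ => (z : ℚ)) (c := fun _ => ())
      (l := fun x => (g x).1) h' (by fun_prop) (by fun_prop)
  unfold RawForm.eval
  fun_prop

@[fun_prop]
theorem zeroHead {f : δ → List (List ℚ)} (hf : PolyFun O f) :
    PolyFun O (fun x => RawForm.zeroHead (f x)) := by
  have h' : PolyFun O (fun x : (List ℚ × List (List ℚ)) × List (List ℚ) =>
      x.1.1.map fun _ => (0 : ℚ)) :=
    map (O := O) (f := fun (_ : Unit) (_ : ℚ) => (0 : ℚ)) (c := fun _ => ())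
      (l := fun x : (List ℚ × List (List ℚ)) × List (List ℚ) => x.1.1) (by fun_prop) (by fun_prop)
      (by fun_prop)
  have h : PolyFun O (fun l : List (List ℚ) => RawForm.zeroHead l) :=
    listCase (n := fun _ => ([] : List (List ℚ))) (l := fun l : List (List ℚ) => l)
      (c := fun (_ : List (List ℚ)) (r : List ℚ) (t : List (List ℚ)) =>
        (r.map fun _ => (0 : ℚ)) :: t) .id (const _) (.cons h' (by fun_prop))
  exact h.comp hf

theorem powLengthRat {K : δ → ℕ} {l : δ → List α} {k : δ → List β} (hK : PolyFun O K)
    (hl : PolyFun O l) (hk : PolyFun O k) :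
    PolyFun O (fun x => (K x : ℚ) ^ ((l x).length + (k x).length)) := by
  have h : PolyFun O (fun x => (((K x ^ (l x).length * K x ^ (k x).length : ℕ) : ℤ) : ℚ)) :=
    intCast (natCast (natMul (powLength hK hl) (powLength hK hk)))
  exact h.congr fun x => by push_cast; rw [pow_add]

@[fun_prop]
theorem comb {A B : δ → ℚ} {K : δ → ℕ} {F : δ → RawForm} (hA : PolyFun O A) (hB : PolyFun O B)
    (hK : PolyFun O K) (hF : PolyFun O F) :
    PolyFun O (fun x => RawForm.comb (A x) (B x) (K x) (F x)) := by
  have h₁ : PolyFun O (fun x : (ℚ × ℚ × ℕ) × RawForm => x.2.1.withTails.map fun y =>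
      y.1.withTails.map fun z =>
        x.1.1 * z.1 + x.1.2.1 * (x.1.2.2 : ℚ) ^ (y.2.flatten.length + z.2.length)) := by
    refine map (O := O) (f := fun (x : (ℚ × ℚ × ℕ) × RawForm) (y : List ℚ × List (List ℚ)) =>
      y.1.withTails.map fun z =>
        x.1.1 * z.1 + x.1.2.1 * (x.1.2.2 : ℚ) ^ (y.2.flatten.length + z.2.length)) ?_ .id
        (withTails (O := O) (l := fun x : (ℚ × ℚ × ℕ) × RawForm => x.2.1) (by fun_prop))
    refine map (O := O) (f := fun (x : ((ℚ × ℚ × ℕ) × RawForm) × List ℚ × List (List ℚ))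
      (z : ℚ × List ℚ) =>
        x.1.1.1 * z.1 + x.1.1.2.1 * (x.1.1.2.2 : ℚ) ^ (x.2.2.flatten.length + z.2.length)) ?_ .id
        (withTails (O := O) (l := fun x : ((ℚ × ℚ × ℕ) × RawForm) × List ℚ × List (List ℚ) =>
          x.2.1) (by fun_prop))
    have := powLengthRat (O := O)
      (K := fun x : (((ℚ × ℚ × ℕ) × RawForm) × List ℚ × List (List ℚ)) × ℚ × List ℚ =>
        x.1.1.1.2.2) (l := fun x => x.1.2.2.flatten) (k := fun x => x.2.2)
        (by fun_prop) (by fun_prop) (by fun_prop)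
    fun_prop
  have h₂ : PolyFun O (fun x : (ℚ × ℚ × ℕ) × RawForm => x.2.2.map fun r =>
      r.map fun c => x.1.1 * c) := by
    refine map (f := fun (x : (ℚ × ℚ × ℕ) × RawForm) (r : List ℚ) => r.map fun c => x.1.1 * c)
      ?_ .id (by fun_prop)
    exact map (f := fun (x : ((ℚ × ℚ × ℕ) × RawForm) × List ℚ) c => x.1.1.1 * c) (by fun_prop) .id
      (by fun_prop)
  have h : PolyFun O (fun x : (ℚ × ℚ × ℕ) × RawForm => RawForm.comb x.1.1 x.1.2.1 x.1.2.2 x.2) :=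
    (zeroHead h₁).prodMk (zeroHead h₂)
  exact h.comp (f := fun x => ((A x, B x, K x), F x)) (by fun_prop)

end PolyFun

/-! ### The verifier -/

/-- The problem of the first lower level with an extra constraint `a ≤ b` and objective bound
`h ≤ c`, at the top-level decision of `y`. -/
abbrev rawQuery (p : RawProblem) (y : RawPoint) (a : RawForm) (b : ℚ) (h : RawForm) (c : ℚ) :
    List Bool :=
  enc (p, y.1.headD [], a, b, h, c)

open scoped Classical in
/-- Verification of a feasible point `y` of the canonical problem with value at most `Γ`. -/
noncomputable def checkFeasible (O : Language Bool) (K : ℕ) (p : RawProblem) (Γ : ℚ)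
    (y : RawPoint) : Bool :=
  (p.2.2.1.all₂' (List.all₂' fun a b => decide (a ≤ b)) y.1 &&
    y.1.all₂' (List.all₂' fun a b => decide (a ≤ b)) p.2.2.2.1) &&
  (p.2.2.2.2.2.flatten.all fun c => decide (c.1.eval y ≤ c.2)) &&
  decide ((p.2.2.2.2.1.headD ([], [])).eval y ≤ Γ) &&
  -- One question for each level i ≥ 2: the constraint is I(z) ≤ I(y) for the isolating form I, and
  -- the objective bound is -f_i(z) - K·I(z) ≤ -f_i(y) - K·I(y) on the lower-level variables. For
  -- large K the two together force I(z) = I(y) and f_i(y) ≤ f_i(z).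
  (p.2.2.2.2.1.tail.tail.all fun F => decide (rawQuery p y (.comb 0 1 K F)
    ((RawForm.comb 0 1 K F).eval y) (.comb (-1) (-(K : ℤ) : ℤ) K F)
    ((RawForm.comb (-1) (-(K : ℤ) : ℤ) K F).eval y) ∈ O)) &&
  -- The question f₁(z) ≤ f₁(y), asked as constraint and as objective bound alike. For the oracle of
  -- a class, a positive answer certifies that `p` encodes a member of it, even when there are no
  -- levels i ≥ 2.
  decide (rawQuery p y (.comb 1 0 K (p.2.2.2.2.1.tail.headD ([], [])))
    ((RawForm.comb 1 0 K (p.2.2.2.2.1.tail.headD ([], []))).eval y)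
    (.comb 1 0 K (p.2.2.2.2.1.tail.headD ([], [])))
    ((RawForm.comb 1 0 K (p.2.2.2.2.1.tail.headD ([], []))).eval y) ∈ O) &&
  -- The oracle decides only weak inequalities; optimality is expressed as the absence of an
  -- improvement by at least 1/(K+1).
  !decide (rawQuery p y (.comb 1 0 K (p.2.2.2.2.1.tail.headD ([], [])))
    ((RawForm.comb 1 0 K (p.2.2.2.2.1.tail.headD ([], []))).eval y)
    (.comb 1 0 K (p.2.2.2.2.1.tail.headD ([], [])))
    ((RawForm.comb 1 0 K (p.2.2.2.2.1.tail.headD ([], []))).eval y - 1 / ((K : ℚ) + 1)) ∈ O)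

open scoped Classical in
/-- Verification of the near-optimal robustness of `y`. -/
noncomputable def checkRobust (O : Language Bool) (K : ℕ) (p : RawProblem) (δ : ℚ)
    (y : RawPoint) : Bool :=
  decide (0 ≤ δ) && (p.2.2.2.2.2.headD []).all fun c =>
    -- The form of `c` splits into a top-level part, evaluated at y, and a lower-level part,
    -- evaluated at z. The question asks for a near-optimal z that violates the constraint by at
    -- least 1/(K+1).
    !decide (rawQuery p y (.comb 1 0 K (p.2.2.2.2.1.tail.headD ([], [])))
      ((RawForm.comb 1 0 K (p.2.2.2.2.1.tail.headD ([], []))).eval y + δ) (.comb (-1) 0 K c.1)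
      (c.1.eval y - (RawForm.comb 1 0 K c.1).eval y - c.2 - 1 / ((K : ℚ) + 1)) ∈ O)

namespace PolyFun

open scoped Classical in
@[fun_prop]
theorem rawQuery {p : δ → RawProblem} {y : δ → RawPoint} {a h : δ → RawForm} {b c : δ → ℚ}
    (hp : PolyFun O p) (hy : PolyFun O y) (ha : PolyFun O a) (hb : PolyFun O b)
    (hh : PolyFun O h) (hc : PolyFun O c) :
    PolyFun O (fun x => decide (rawQuery (p x) (y x) (a x) (b x) (h x) (c x) ∈ O)) :=
  oracle.comp (code.comp (f := fun x => (p x, (y x).1.headD [], a x, b x, h x, c x)) (by fun_prop))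

theorem allLe {f g : δ → List (List ℤ)} (hf : PolyFun O f) (hg : PolyFun O g) :
    PolyFun O (fun x => (f x).all₂' (List.all₂' fun a b => decide (a ≤ b)) (g x)) :=
  all₂ (all₂ (p := fun a b : ℤ => decide (a ≤ b)) (by fun_prop) (by fun_prop) (by fun_prop)) hf hg

@[fun_prop]
theorem checkFeasible {K : δ → ℕ} {p : δ → RawProblem} {Γ : δ → ℚ} {y : δ → RawPoint}
    (hK : PolyFun O K) (hp : PolyFun O p) (hΓ : PolyFun O Γ) (hy : PolyFun O y) :
    PolyFun O (fun x => checkFeasible O (K x) (p x) (Γ x) (y x)) := by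
  classical
  have h : PolyFun O (fun x : ℕ × RawProblem × ℚ × RawPoint =>
      _root_.checkFeasible O x.1 x.2.1 x.2.2.1 x.2.2.2) := by
    refine .and (.and (.and (.and (.and (.and ?_ ?_) ?_) ?_) ?_) ?_) ?_
    · exact allLe (by fun_prop) (by fun_prop)
    · exact allLe (by fun_prop) (by fun_prop)
    · exact all (p := fun (y : RawPoint) (c : RawForm × ℚ) => decide (c.1.eval y ≤ c.2))
        (by fun_prop) (by fun_prop) (by fun_prop)
    · fun_prop
    · exact all (p := fun (x : ℕ × RawProblem × ℚ × RawPoint) F => decide (_root_.rawQuery x.2.1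
        x.2.2.2 (.comb 0 1 x.1 F) ((RawForm.comb 0 1 x.1 F).eval x.2.2.2)
        (.comb (-1) (-(x.1 : ℤ) : ℤ) x.1 F)
        ((RawForm.comb (-1) (-(x.1 : ℤ) : ℤ) x.1 F).eval x.2.2.2) ∈ O))
        (by fun_prop) (by fun_prop) (by fun_prop)
    · fun_prop
    · fun_prop
  exact h.comp (f := fun x => (K x, p x, Γ x, y x)) (by fun_prop)

@[fun_prop]
theorem checkRobust {K : δ → ℕ} {p : δ → RawProblem} {d : δ → ℚ} {y : δ → RawPoint}
    (hK : PolyFun O K) (hp : PolyFun O p) (hd : PolyFun O d) (hy : PolyFun O y) :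
    PolyFun O (fun x => checkRobust O (K x) (p x) (d x) (y x)) := by
  classical
  have h : PolyFun O (fun x : ℕ × RawProblem × ℚ × RawPoint =>
      _root_.checkRobust O x.1 x.2.1 x.2.2.1 x.2.2.2) := by
    refine .and (by fun_prop) ?_
    exact all (p := fun (x : ℕ × RawProblem × ℚ × RawPoint) (c : RawForm × ℚ) =>
      !decide (_root_.rawQuery x.2.1 x.2.2.2
      (.comb 1 0 x.1 (x.2.1.2.2.2.2.1.tail.headD ([], [])))
      ((RawForm.comb 1 0 x.1 (x.2.1.2.2.2.2.1.tail.headD ([], []))).eval x.2.2.2 + x.2.2.1)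
      (.comb (-1) 0 x.1 c.1) (c.1.eval x.2.2.2 - (RawForm.comb 1 0 x.1 c.1).eval x.2.2.2 - c.2 -
      1 / ((x.1 : ℚ) + 1)) ∈ O)) (by fun_prop) (by fun_prop) (by fun_prop)
  exact h.comp (f := fun x => (K x, p x, d x, y x)) (by fun_prop)

end PolyFun

end

/-! ### Rational vertices of polyhedra -/

open Matrix in
/-- Either a linear function decreases along a recession direction of a pointed polyhedron, or it
is at most as large at some vertex as at a given point. -/
theorem exists_vertex_or_direction {V κ : Type*} [Fintype V] [Finite κ] (A : κ → V → ℝ)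
    (b : κ → ℝ) (f : V → ℝ) (hA : ∀ d, (∀ k, A k ⬝ᵥ d = 0) → d = 0) (x₀ : V → ℝ)
    (h₀ : ∀ k, A k ⬝ᵥ x₀ ≤ b k) :
    (∃ d, (∀ k, A k ⬝ᵥ d ≤ 0) ∧ f ⬝ᵥ d < 0) ∨
      ∃ x, (∀ k, A k ⬝ᵥ x ≤ b k) ∧ f ⬝ᵥ x ≤ f ⬝ᵥ x₀ ∧
        ∀ d, (∀ k, A k ⬝ᵥ x = b k → A k ⬝ᵥ d = 0) → d = 0 := by
  classical
  have := Fintype.ofFinite κ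
  by_contra! hcon
  obtain ⟨hdir, hver⟩ := hcon
  -- Among the points no worse than `x₀`, one with the fewest slack constraints is shown to be a
  -- vertex unless a decreasing direction exists.
  let S : Set (V → ℝ) := {x | (∀ k, A k ⬝ᵥ x ≤ b k) ∧ f ⬝ᵥ x ≤ f ⬝ᵥ x₀}
  let m : (V → ℝ) → ℕ := fun x => (Finset.univ.filter fun k => A k ⬝ᵥ x ≠ b k).card
  obtain ⟨x, hx, hmin⟩ := (measure m).wf.has_min S ⟨x₀, h₀, le_rfl⟩
  obtain ⟨d₀, hd₀, hne⟩ := hver x hx.1 hx.2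
  -- Otherwise moving along `d` until the first slack constraint becomes tight keeps the tight ones
  -- tight, does not increase `f`, and contradicts minimality.
  have key : ∀ d, (∀ k, A k ⬝ᵥ x = b k → A k ⬝ᵥ d = 0) → f ⬝ᵥ d ≤ 0 → ∀ k, A k ⬝ᵥ d ≤ 0 := by
    intro d hd hfd k₁
    by_contra! hk₁
    let T := Finset.univ.filter fun k => 0 < A k ⬝ᵥ d
    obtain ⟨k, hkT, hk⟩ := T.exists_min_image (fun k => (b k - A k ⬝ᵥ x) / (A k ⬝ᵥ d))
      ⟨k₁, by simp [T, hk₁]⟩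
    have hkd : 0 < A k ⬝ᵥ d := by simpa [T] using hkT
    set t := (b k - A k ⬝ᵥ x) / (A k ⬝ᵥ d)
    have ht : 0 ≤ t := div_nonneg (sub_nonneg.2 (hx.1 k)) hkd.le
    have hval : ∀ g : V → ℝ, g ⬝ᵥ (x + t • d) = g ⬝ᵥ x + t * g ⬝ᵥ d := fun g => by
      rw [dotProduct_add, dotProduct_smul, smul_eq_mul]
    refine hmin (x + t • d) ⟨fun l => ?_, ?_⟩ (Finset.card_lt_card ?_)
    · rw [hval]
      rcases le_or_gt (A l ⬝ᵥ d) 0 with hl | hl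
      · nlinarith [hx.1 l]
      · have := (le_div_iff₀ hl).1 (hk l (by simp [T, hl]))
        linarith
    · rw [hval]
      nlinarith [hx.2]
    · refine Finset.ssubset_iff_subset_ne.2 ⟨fun l hl => ?_, fun h => ?_⟩
      · simp only [Finset.mem_filter, Finset.mem_univ, true_and, hval] at hl ⊢
        intro h
        exact hl (by rw [hd l h, h]; ring)
      · have hxk : A k ⬝ᵥ x ≠ b k := fun h => hkd.ne' (hd k h)
        have : k ∈ Finset.univ.filter fun k => A k ⬝ᵥ x ≠ b k := by simp [hxk]
        rw [← h, Finset.mem_filter, hval] at this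
        refine this.2 ?_
        rw [div_mul_cancel₀ _ hkd.ne']
        ring
  have hneg : ∀ g : V → ℝ, g ⬝ᵥ (-d₀) = -(g ⬝ᵥ d₀) := fun g => dotProduct_neg _ _
  -- Either `d₀` or its negative decreases `f` and is a recession direction, or `f` vanishes on `d₀`
  -- and both are recession directions, which a pointed polyhedron forbids.
  rcases lt_trichotomy (f ⬝ᵥ d₀) 0 with hf | hf | hf
  · exact hf.not_ge (hdir d₀ (key d₀ hd₀ hf.le))
  · have h₁ := key d₀ hd₀ hf.le
    have h₂ := key (-d₀) (fun k hk => by rw [hneg, hd₀ k hk, neg_zero]) (by rw [hneg, hf, neg_zero])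
    refine hne (hA d₀ fun k => le_antisymm (h₁ k) ?_)
    have := h₂ k
    rw [hneg] at this
    linarith
  · have hf' : f ⬝ᵥ (-d₀) < 0 := by rw [hneg]; linarith
    exact hf'.not_ge (hdir (-d₀) (key (-d₀) (fun k hk => by rw [hneg, hd₀ k hk, neg_zero]) hf'.le))

open Matrix in
/-- A set of vectors without common nonzero orthogonal vector contains a square system with this
property. -/
theorem exists_square_subsystem {V : Type*} [Fintype V] (S : Set (V → ℝ))
    (hS : ∀ d, (∀ r ∈ S, r ⬝ᵥ d = 0) → d = 0) :
    ∃ e : V → V → ℝ, (∀ v, e v ∈ S) ∧ ∀ d, (∀ v, e v ⬝ᵥ d = 0) → d = 0 := by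
  classical
  -- A proper span would lie in the kernel of a nonzero functional, that is, be orthogonal to a
  -- nonzero vector. A basis chosen inside `S` then gives the square system.
  have hspan : Submodule.span ℝ S = ⊤ := by
    by_contra h
    obtain ⟨f, hf, hle⟩ := Submodule.exists_le_ker_of_lt_top _ (lt_top_iff_ne_top.2 h)
    have hval : ∀ r : V → ℝ, f r = r ⬝ᵥ fun v => f (Pi.single v 1) := fun r => by
      rw [f.pi_apply_eq_sum_univ r, dotProduct]
      refine Finset.sum_congr rfl fun v _ => ?_
      rw [smul_eq_mul]
      congr 2
      funext w
      simp [Pi.single_apply, eq_comm]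
    have := hS (fun v => f (Pi.single v 1)) fun r hr => by
      rw [← hval]
      exact hle (Submodule.subset_span hr)
    refine hf (LinearMap.ext fun r => ?_)
    rw [hval, this, dotProduct_zero, LinearMap.zero_apply]
  obtain ⟨B, hB, hsp, hli⟩ := exists_linearIndependent ℝ S
  let bas := Module.Basis.mk hli (by rw [Subtype.range_coe, hsp, hspan])
  let e := (Pi.basisFun ℝ V).indexEquiv bas
  refine ⟨fun v => e v, fun v => hB (e v).2, fun d hd => ?_⟩
  have h : ∀ r ∈ Submodule.span ℝ B, r ⬝ᵥ d = 0 := by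
    intro r hr
    induction hr using Submodule.span_induction with
    | mem r hr => simpa using hd (e.symm ⟨r, hr⟩)
    | zero => exact zero_dotProduct _
    | add r s _ _ hr hs => rw [add_dotProduct, hr, hs, add_zero]
    | smul a r _ hr => rw [smul_dotProduct, hr, smul_zero]
  exact dotProduct_self_eq_zero.1 (h d (by rw [hsp, hspan]; trivial))

/-- Clearing the denominators of a vector of rational numbers. -/
theorem exists_clear_denominators {ι : Type*} [Fintype ι] (r : ι → ℚ) {H : ℕ}
    (hr : ∀ i, (r i).height ≤ H) :
    ∃ (D : ℕ) (z : ι → ℤ), 0 < D ∧ (∀ i, (z i : ℚ) = D * r i) ∧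
      ∀ i, (z i).natAbs ≤ H ^ (Fintype.card ι + 1) := by
  classical
  have hD : (∏ i, (r i).den) ≤ H ^ Fintype.card ι := by
    refine (Finset.prod_le_prod' fun i _ => (Nat.le_add_left _ _).trans (hr i)).trans ?_
    simp
  have hz : ∀ i, ∃ c : ℕ, ∏ i, (r i).den = (r i).den * c := fun i =>
    Finset.dvd_prod_of_mem _ (Finset.mem_univ i)
  choose c hc using hz
  refine ⟨∏ i, (r i).den, fun i => c i * (r i).num, Finset.prod_pos fun i _ => (r i).den_pos,
    fun i => ?_, fun i => ?_⟩
  · rw [hc i]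
    push_cast
    rw [mul_comm ((r i).den : ℚ), mul_assoc, Rat.den_mul_eq_num]
  · rw [Int.natAbs_mul, Int.natAbs_natCast, pow_succ]
    refine Nat.mul_le_mul (le_trans ?_ hD) ((Nat.le_add_right _ _).trans (hr i))
    rw [hc i]
    exact Nat.le_mul_of_pos_left _ (r i).den_pos

open Matrix in
/-- The solution of a square system with integer coefficients of bounded absolute value. -/
theorem exists_rat_solution {V : Type*} [Fintype V] [DecidableEq V] (M : Matrix V V ℤ) (c : V → ℤ)
    (H : ℕ) (hM : ∀ u v, (M u v).natAbs ≤ H) (hc : ∀ u, (c u).natAbs ≤ H) (x : V → ℝ)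
    (hx : M.map (fun z => (z : ℝ)) *ᵥ x = fun v => (c v : ℝ)) (hdet : M.det ≠ 0) :
    ∃ y : V → ℚ, (∀ v, x v = y v) ∧
      ∀ v, (y v).height ≤ 2 * ((Fintype.card V).factorial * H ^ Fintype.card V) := by
  have hb : ∀ N : Matrix V V ℤ, (∀ u v, (N u v).natAbs ≤ H) →
      N.det.natAbs ≤ (Fintype.card V).factorial * H ^ Fintype.card V := by
    intro N hN
    have := Matrix.det_le (A := N) (abv := AbsoluteValue.abs) (x := (H : ℤ)) fun i j => by
      have := hN i j
      rw [AbsoluteValue.abs_apply, Int.abs_eq_natAbs]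
      exact_mod_cast this
    rw [AbsoluteValue.abs_apply, Int.abs_eq_natAbs, nsmul_eq_mul] at this
    exact_mod_cast this
  have hcr : ∀ v, (M.det : ℝ) * x v = M.cramer c v := by
    intro v
    have h₁ : (M.map (fun z => (z : ℝ))).adjugate *ᵥ (M.map (fun z => (z : ℝ)) *ᵥ x) =
        (M.map (fun z => (z : ℝ))).adjugate *ᵥ fun v => (c v : ℝ) := by rw [hx]
    rw [mulVec_mulVec, adjugate_mul, smul_mulVec, one_mulVec] at h₁
    have h₂ := congrFun h₁ v
    have hdet' : (M.map (fun z => (z : ℝ))).det = M.det := ((Int.castRingHom ℝ).map_det M).symm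
    have hadj : (M.map (fun z => (z : ℝ))).adjugate = M.adjugate.map (fun z => (z : ℝ)) :=
      ((Int.castRingHom ℝ).map_adjugate M).symm
    rw [Pi.smul_apply, smul_eq_mul, hdet', hadj] at h₂
    rw [h₂, cramer_eq_adjugate_mulVec]
    simp [mulVec, dotProduct]
  refine ⟨fun v => Rat.divInt (M.cramer c v) M.det, fun v => ?_, fun v => ?_⟩
  · have : (M.det : ℝ) ≠ 0 := by exact_mod_cast hdet
    simp only [Rat.divInt_eq_div]
    rw [Rat.cast_div, Rat.cast_intCast, Rat.cast_intCast, eq_div_iff this, mul_comm]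
    exact hcr v
  · refine (Rat.height_divInt_le _ _ hdet).trans ?_
    rw [two_mul]
    refine Nat.add_le_add ?_ (hb M hM)
    rw [cramer_apply]
    refine hb _ fun u w => ?_
    rw [updateCol_apply]
    split_ifs
    exacts [hc u, hM u w]

/-- The number of bits for the vertices of a polyhedron of dimension at most `T`, described by
rational numbers of height at most `2 ^ T`. -/
noncomputable def vertexBits : Polynomial ℕ := .X ^ 3 + 3 * .X ^ 2 + 1

theorem eval_vertexBits (T : ℕ) : vertexBits.eval T = T ^ 3 + 3 * T ^ 2 + 1 := by
  simp [vertexBits]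

-- The sign constraints of the orthant of `x₀` make the polyhedron pointed without losing `x₀`;
-- recession directions of the smaller polyhedron are recession directions of the original one. A
-- vertex solves a square system of tight rows, and after clearing denominators Cramer's rule bounds
-- its coordinates by determinants.
open Matrix in
theorem exists_small_vertex {V κ : Type*} [Fintype V] [Finite κ] (A : κ → V → ℚ) (b : κ → ℚ)
    (f : V → ℝ) (T : ℕ) (hT : 0 < T) (hV : Fintype.card V ≤ T)
    (hA : ∀ k v, (A k v).height ≤ 2 ^ T) (hb : ∀ k, (b k).height ≤ 2 ^ T) (x₀ : V → ℝ)
    (h₀ : ∀ k, (fun v => (A k v : ℝ)) ⬝ᵥ x₀ ≤ b k) :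
    (∃ d, (∀ k, (fun v => (A k v : ℝ)) ⬝ᵥ d ≤ 0) ∧ f ⬝ᵥ d < 0) ∨
      ∃ x : V → ℚ, (∀ k, (fun v => (A k v : ℝ)) ⬝ᵥ (fun v => (x v : ℝ)) ≤ b k) ∧
        f ⬝ᵥ (fun v => (x v : ℝ)) ≤ f ⬝ᵥ x₀ ∧ ∀ v, (x v).height ≤ 2 ^ vertexBits.eval T := by
  classical
  let σ : V → ℚ := fun v => if 0 ≤ x₀ v then -1 else 1
  let A' : κ ⊕ V → V → ℚ := Sum.elim A fun v => Pi.single v (σ v)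
  let b' : κ ⊕ V → ℚ := Sum.elim b fun _ => 0
  have hsign : ∀ v (x : V → ℝ), (fun w => ((Pi.single v (σ v) : V → ℚ) w : ℝ)) ⬝ᵥ x = σ v * x v := by
    intro v x
    rw [dotProduct, Finset.sum_eq_single v] <;> simp +contextual
  have hσ : ∀ v, (σ v : ℝ) ≠ 0 := fun v => by
    simp only [σ]
    split_ifs <;> norm_num
  rcases exists_vertex_or_direction (fun k v => (A' k v : ℝ)) (fun k => (b' k : ℝ)) f
    (fun d hd => funext fun v => by
      have := hd (.inr v)
      simp only [A', Sum.elim_inr, hsign] at this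
      exact (mul_eq_zero.1 this).resolve_left (hσ v)) x₀ (by
      rintro (k | v)
      · exact h₀ k
      · simp only [A', b', Sum.elim_inr, hsign, Rat.cast_zero, σ]
        split_ifs with h
        · push_cast; linarith
        · push_cast; linarith) with ⟨d, hd, hfd⟩ | ⟨x, hx, hfx, hker⟩
  · exact .inl ⟨d, fun k => hd (.inl k), hfd⟩
  have hA' : ∀ k v, (A' k v).height ≤ 2 ^ T := by
    have h2 : 2 ^ 1 ≤ 2 ^ T := Nat.pow_le_pow_right (by norm_num) hT
    rintro (k | u) v
    · exact hA k v
    · simp only [A', Sum.elim_inr, Pi.single_apply, σ]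
      refine le_trans ?_ h2
      split_ifs <;> norm_num [Rat.height]
  have hb' : ∀ k, (b' k).height ≤ 2 ^ T := by
    rintro (k | u)
    · exact hb k
    · simp only [b', Sum.elim_inr]
      exact (by norm_num [Rat.height] : Rat.height 0 ≤ 1).trans Nat.one_le_two_pow
  obtain ⟨e, he, hsq⟩ := exists_square_subsystem
    {r | ∃ k, (fun v => (A' k v : ℝ)) ⬝ᵥ x = b' k ∧ r = fun v => (A' k v : ℝ)}
    fun d hd => hker d fun k hk => hd _ ⟨k, hk, rfl⟩
  choose k hk hek using he
  have hclear : ∀ u, ∃ (D : ℕ) (z : Option V → ℤ), 0 < D ∧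
      (∀ i, (z i : ℚ) = D * Option.elim i (b' (k u)) (A' (k u))) ∧
      ∀ i, (z i).natAbs ≤ (2 ^ T) ^ (Fintype.card (Option V) + 1) := fun u =>
    exists_clear_denominators _ fun i => by
      cases i
      exacts [hb' _, hA' _ _]
  choose D z hD hz hzH using hclear
  have hzR : ∀ u i, (z u i : ℝ) = D u * ((Option.elim i (b' (k u)) (A' (k u)) : ℚ) : ℝ) :=
    fun u i => by exact_mod_cast congrArg (fun q : ℚ => (q : ℝ)) (hz u i)
  let M : Matrix V V ℤ := fun u v => z u (some v)
  have hMx : ∀ (y : V → ℝ) u, (M.map (fun z => (z : ℝ)) *ᵥ y) u = D u * (e u ⬝ᵥ y) := by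
    intro y u
    simp only [mulVec, dotProduct, hek, Finset.mul_sum, ← mul_assoc]
    exact Finset.sum_congr rfl fun v _ => by rw [map_apply, hzR]; rfl
  have hDR : ∀ u, (D u : ℝ) ≠ 0 := fun u => by exact_mod_cast (hD u).ne'
  have hdet : M.det ≠ 0 := by
    intro h0
    have : (M.map (fun z => (z : ℝ))).det = 0 := by
      refine ((Int.castRingHom ℝ).map_det M).symm.trans ?_
      rw [h0, map_zero]
    obtain ⟨d, hd, hMd⟩ := exists_mulVec_eq_zero_iff.2 this
    refine hd (hsq d fun u => ?_)
    have := congrFun hMd u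
    rw [hMx] at this
    exact (mul_eq_zero.1 this).resolve_left (hDR u)
  obtain ⟨y, hxy, hy⟩ := exists_rat_solution M (fun u => z u none) _ (fun u v => hzH u _)
    (fun u => hzH u _) x (funext fun u => by
      rw [hMx, hek u, hk u, hzR]; rfl) hdet
  have hxy' : x = fun v => (y v : ℝ) := funext hxy
  rw [hxy'] at hx hfx
  refine .inr ⟨y, fun k => hx (.inl k), hfx, fun v => (hy v).trans ?_⟩
  rw [Fintype.card_option, eval_vertexBits]
  set n := Fintype.card V
  calc 2 * (n.factorial * ((2 ^ T) ^ (n + 1 + 1)) ^ n)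
      ≤ 2 ^ 1 * ((2 ^ n) ^ n * ((2 ^ T) ^ (n + 1 + 1)) ^ n) := by
        rw [pow_one]
        exact Nat.mul_le_mul_left _ (Nat.mul_le_mul_right _
          (n.factorial_le_pow.trans (Nat.pow_le_pow_left n.lt_two_pow_self.le _)))
    _ = 2 ^ (1 + (n * n + T * (n + 1 + 1) * n)) := by simp only [pow_add, pow_mul]
    _ ≤ 2 ^ (T ^ 3 + 3 * T ^ 2 + 1) := by
        refine Nat.pow_le_pow_right (by norm_num) ?_
        have h1 : n * n ≤ T * T := Nat.mul_le_mul hV hV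
        have h2 : T * (n + 1 + 1) * n ≤ T * (T + 1 + 1) * T := by gcongr
        nlinarith

/-! ### Real numbers that are rational of bounded height -/

theorem Rat.height_sum_le {ι : Type*} (s : Finset ι) (f : ι → ℚ) {H : ℕ}
    (h : ∀ i ∈ s, (f i).height ≤ H) : (∑ i ∈ s, f i).height ≤ H ^ s.card := by
  classical
  induction s using Finset.induction_on with
  | empty => simp [Rat.height]
  | insert a s ha ih =>
    rw [Finset.sum_insert ha, Finset.card_insert_of_notMem ha, pow_succ, mul_comm]
    exact (Rat.height_add_le _ _).trans (Nat.mul_le_mul (h a (Finset.mem_insert_self _ _))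
      (ih fun i hi => h i (Finset.mem_insert_of_mem hi)))

/-- The real number is rational of height at most `2 ^ N`. -/
def IsSmall (N : ℕ) (x : ℝ) : Prop := ∃ q : ℚ, x = q ∧ q.height ≤ 2 ^ N

namespace IsSmall

variable {M N : ℕ} {x y : ℝ}

theorem mono (h : IsSmall M x) (hMN : M ≤ N) : IsSmall N x :=
  let ⟨q, hq, hH⟩ := h
  ⟨q, hq, hH.trans (Nat.pow_le_pow_right (by norm_num) hMN)⟩

theorem add (hx : IsSmall M x) (hy : IsSmall N y) : IsSmall (M + N) (x + y) := by
  obtain ⟨p, rfl, hp⟩ := hx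
  obtain ⟨q, rfl, hq⟩ := hy
  refine ⟨p + q, by push_cast; rfl, (Rat.height_add_le p q).trans ?_⟩
  rw [pow_add]
  exact Nat.mul_le_mul hp hq

theorem mul (hx : IsSmall M x) (hy : IsSmall N y) : IsSmall (M + N) (x * y) := by
  obtain ⟨p, rfl, hp⟩ := hx
  obtain ⟨q, rfl, hq⟩ := hy
  refine ⟨p * q, by push_cast; rfl, (Rat.height_mul_le p q).trans ?_⟩
  rw [pow_add]
  exact Nat.mul_le_mul hp hq

theorem neg (hx : IsSmall N x) : IsSmall N (-x) := by
  obtain ⟨p, rfl, hp⟩ := hx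
  exact ⟨-p, by push_cast; rfl, by rwa [Rat.height_neg]⟩

theorem sub (hx : IsSmall M x) (hy : IsSmall N y) : IsSmall (M + N) (x - y) :=
  sub_eq_add_neg x y ▸ hx.add hy.neg

theorem sum {ι : Type*} (s : Finset ι) (f : ι → ℝ) (h : ∀ i ∈ s, IsSmall N (f i)) :
    IsSmall (N * s.card) (∑ i ∈ s, f i) := by
  choose! q hq hH using h
  refine ⟨∑ i ∈ s, q i, ?_, ?_⟩
  · rw [Finset.sum_congr rfl hq]
    push_cast
    rfl
  · rw [pow_mul]
    exact Rat.height_sum_le s q hH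

theorem of_rat {q : ℚ} (h : q.height ≤ 2 ^ N) : IsSmall N (q : ℝ) := ⟨q, rfl, h⟩

theorem abs_lt (h : IsSmall N x) : |x| < 2 ^ N := by
  obtain ⟨q, rfl, hq⟩ := h
  have h₁ : |q| ≤ q.num.natAbs := by
    rw [← Rat.num_div_den q, abs_div, Nat.abs_cast]
    refine (div_le_self (abs_nonneg _) (by exact_mod_cast q.den_pos)).trans ?_
    rw [Rat.num_div_den, ← Int.cast_abs, Int.abs_eq_natAbs]
    simp
  have h₂ : q.num.natAbs < 2 ^ N := by
    have := q.den_pos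
    rw [Rat.height] at hq
    omega
  have h₃ : |q| < (2 ^ N : ℕ) := h₁.trans_lt (by exact_mod_cast h₂)
  exact_mod_cast h₃

/-- The gap principle: a strict inequality between small rationals holds with a margin, so weak
inequalities with slack 1/(K+1) can replace strict ones. -/
theorem inv_le (h : IsSmall N x) (hx : 0 < x) : 1 / (2 : ℝ) ^ N ≤ x := by
  obtain ⟨q, rfl, hq⟩ := h
  have hq0 : 0 < q := by exact_mod_cast hx
  have hden : q.den ≤ 2 ^ N := (Nat.le_add_left _ _).trans hq
  have h1 : (1 : ℝ) ≤ q * q.den := by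
    have : (1 : ℚ) ≤ q * q.den := by
      rw [Rat.mul_den_eq_num]
      exact_mod_cast Rat.num_pos.2 hq0
    exact_mod_cast this
  rw [div_le_iff₀ (by positivity)]
  have : (q.den : ℝ) ≤ 2 ^ N := by exact_mod_cast hden
  exact h1.trans (by gcongr)

end IsSmall

/-! ### Linear forms -/

namespace LinForm

variable {s : ℕ} {d : LevelDims s}

theorem eval_congr {c : LinForm d} {y z : JointPoint d} (hint : y.int = z.int)
    (hcont : ∀ j, c.cCont j = 0 ∨ y.cont j = z.cont j) : c.eval y = c.eval z := by
  unfold eval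
  refine Finset.sum_congr rfl fun j _ => ?_
  rw [hint]
  rcases hcont j with h | h <;> simp [h]

theorem eval_eq_dotProduct (c : LinForm d) (y : JointPoint d) :
    c.eval y = (∑ v : Σ j, Fin (d.nInt j), (c.cInt v.1 v.2 : ℝ) * (y.int v.1 v.2 : ℝ)) +
      (fun v : Σ j, Fin (d.nCont j) => (c.cCont v.1 v.2 : ℝ)) ⬝ᵥ fun v => y.cont v.1 v.2 := by
  rw [eval, Finset.sum_add_distrib, dotProduct, Fintype.sum_sigma, Fintype.sum_sigma]

/-- All coefficients have height at most `2 ^ N`. -/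
def BoundedBy (c : LinForm d) (N : ℕ) : Prop :=
  (∀ j k, (c.cInt j k).height ≤ 2 ^ N) ∧ ∀ j k, (c.cCont j k).height ≤ 2 ^ N

theorem BoundedBy.mono {c : LinForm d} {M N : ℕ} (h : c.BoundedBy M) (hMN : M ≤ N) :
    c.BoundedBy N :=
  ⟨fun j k => (h.1 j k).trans (Nat.pow_le_pow_right (by norm_num) hMN),
    fun j k => (h.2 j k).trans (Nat.pow_le_pow_right (by norm_num) hMN)⟩

end LinForm

/-- All coordinates are rational of height at most `2 ^ N`. -/
def JointPoint.BoundedBy {s : ℕ} {d : LevelDims s} (y : JointPoint d) (N : ℕ) : Prop :=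
  (∀ j k, IsSmall N (y.int j k)) ∧ ∀ j k, IsSmall N (y.cont j k)

/-- The total number of variables. -/
def LevelDims.total {s : ℕ} (d : LevelDims s) : ℕ :=
  Fintype.card (Σ j, Fin (d.nInt j)) + Fintype.card (Σ j, Fin (d.nCont j))

theorem LinForm.BoundedBy.isSmall_eval {s : ℕ} {d : LevelDims s} {c : LinForm d}
    {y : JointPoint d} {M N T : ℕ} (hc : c.BoundedBy M) (hy : y.BoundedBy N) (hd : d.total ≤ T) :
    IsSmall ((M + N) * T) (c.eval y) := by
  rw [eval_eq_dotProduct]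
  refine ((IsSmall.sum _ _ fun v _ => (IsSmall.of_rat (hc.1 v.1 v.2)).mul (hy.1 v.1 v.2)).add
    (IsSmall.sum _ _ fun v _ => (IsSmall.of_rat (hc.2 v.1 v.2)).mul (hy.2 v.1 v.2))).mono ?_
  rw [← mul_add]
  exact Nat.mul_le_mul_left _ hd

/-- The number of bits for the continuous coordinates of vertices. -/
noncomputable def pointBits : Polynomial ℕ := vertexBits.comp (.X + 2 * .X ^ 2)

theorem le_eval_pointBits (T : ℕ) : T ≤ pointBits.eval T := by
  rw [pointBits, Polynomial.eval_comp, eval_vertexBits]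
  simp only [Polynomial.eval_add, Polynomial.eval_X, Polynomial.eval_mul, Polynomial.eval_ofNat,
    Polynomial.eval_pow]
  nlinarith [Nat.zero_le (T + 2 * T ^ 2), Nat.zero_le ((T + 2 * T ^ 2) ^ 3)]

/-- Minimizing a linear function over the continuous variables of finitely many linear
constraints. -/
theorem exists_bounded_point {s : ℕ} {d : LevelDims s} (rows : List (LinForm d × ℚ))
    (g : LinForm d) {T : ℕ} (hT : 0 < T) (hd : d.total ≤ T)
    (hrows : ∀ r ∈ rows, r.1.BoundedBy T ∧ r.2.height ≤ 2 ^ T) (y : JointPoint d)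
    (hint : ∀ j k, IsSmall T (y.int j k)) (hy : ∀ r ∈ rows, r.1.eval y ≤ r.2) :
    (∀ M : ℝ, ∃ z : JointPoint d, z.int = y.int ∧ (∀ r ∈ rows, r.1.eval z ≤ r.2) ∧ g.eval z ≤ M) ∨
      ∃ z : JointPoint d, z.int = y.int ∧ (∀ r ∈ rows, r.1.eval z ≤ r.2) ∧
        g.eval z ≤ g.eval y ∧ z.BoundedBy (pointBits.eval T) := by
  -- The fixed integer variables are moved to the right-hand side, at a cost of at most T products
  -- of 2T bits each.
  have hrhs : ∀ r : {r // r ∈ rows}, IsSmall (T + 2 * T ^ 2)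
      (r.1.2 - ∑ v : Σ j, Fin (d.nInt j), (r.1.1.cInt v.1 v.2 : ℝ) * (y.int v.1 v.2 : ℝ)) := by
    intro r
    refine ((IsSmall.of_rat (hrows r.1 r.2).2).sub (IsSmall.sum _ _ fun v _ =>
      (IsSmall.of_rat ((hrows r.1 r.2).1.1 v.1 v.2)).mul (hint v.1 v.2))).mono ?_
    have : (Finset.univ : Finset (Σ j, Fin (d.nInt j))).card ≤ T := (Nat.le_add_right _ _).trans hd
    nlinarith
  choose b hb hbT using hrhs
  have hmono : 2 ^ T ≤ 2 ^ (T + 2 * T ^ 2) := Nat.pow_le_pow_right (by norm_num) (by omega)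
  have : Finite {r // r ∈ rows} := rows.finite_toSet.to_subtype
  have hlp := exists_small_vertex (κ := {r // r ∈ rows})
    (fun r (v : Σ j, Fin (d.nCont j)) => r.1.1.cCont v.1 v.2) b
    (fun v => (g.cCont v.1 v.2 : ℝ)) (T + 2 * T ^ 2) (by omega)
    (((Nat.le_add_left _ _).trans hd).trans (by omega))
    (fun r v => ((hrows r.1 r.2).1.2 v.1 v.2).trans hmono) hbT (fun v => y.cont v.1 v.2)
    (fun r => by
      have := hy r.1 r.2
      rw [LinForm.eval_eq_dotProduct] at this
      rw [← hb r]
      linarith)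
  rcases hlp with ⟨e, he, hge⟩ | ⟨x, hx, hgx, hxT⟩
  · refine .inl fun M => ?_
    set c := (fun v : Σ j, Fin (d.nCont j) => (g.cCont v.1 v.2 : ℝ)) ⬝ᵥ e
    -- The slope `c` is negative, so this distance along the recession direction takes `g` down to
    -- `M`.
    let t := max 0 ((M - g.eval y) / c)
    have hval : ∀ f : LinForm d, f.eval ⟨y.int, fun j k => y.cont j k + t * e ⟨j, k⟩⟩ =
        f.eval y + t * (fun v : Σ j, Fin (d.nCont j) => (f.cCont v.1 v.2 : ℝ)) ⬝ᵥ e := by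
      intro f
      simp only [LinForm.eval_eq_dotProduct, dotProduct, mul_add, Finset.sum_add_distrib,
        Finset.mul_sum]
      rw [add_assoc]
      congr 2
      exact Finset.sum_congr rfl fun v _ => by ring
    have ht : 0 ≤ t := le_max_left _ _
    refine ⟨⟨y.int, fun j k => y.cont j k + t * e ⟨j, k⟩⟩, rfl, fun r hr => ?_, ?_⟩
    · rw [hval]
      nlinarith [hy r hr, he ⟨r, hr⟩]
    · rw [hval]
      have h1 : (M - g.eval y) / c ≤ t := le_max_right _ _
      rw [div_le_iff_of_neg hge] at h1
      linarith
  · refine .inr ⟨⟨y.int, fun j k => x ⟨j, k⟩⟩, rfl, fun r hr => ?_, ?_, fun j k => ?_, fun j k => ?_⟩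
    · have := hx ⟨r, hr⟩
      rw [← hb] at this
      rw [LinForm.eval_eq_dotProduct]
      linarith
    · rw [LinForm.eval_eq_dotProduct, LinForm.eval_eq_dotProduct]
      linarith
    · exact (hint j k).mono (le_eval_pointBits T)
    · refine ⟨x ⟨j, k⟩, rfl, ?_⟩
      rw [pointBits, Polynomial.eval_comp]
      simpa using hxT ⟨j, k⟩

namespace MIMLP

variable {s : ℕ} {P : MIMLP s}

/-! ### The structure of feasible decisions -/

theorem feas_iff {i : Fin (s + 1)} {y : JointPoint P.dims} : P.Feas i y ↔
    P.InBox i (y.int i) ∧ P.SatisfiesCons i y ∧ ∀ j : Fin (s + 1), j.val = i.val + 1 →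
      P.Feas j y ∧ ∀ z, P.AgreeBefore j y z → P.Feas j z → (P.obj j).eval y ≤ (P.obj j).eval z := by
  rw [Feas]

theorem SatisfiesCons.congr {i : Fin (s + 1)} {y z : JointPoint P.dims} (hint : y.int = z.int)
    (hcont : ∀ j, i ≤ j → y.cont j = z.cont j) (hy : P.SatisfiesCons i y) :
    P.SatisfiesCons i z := fun c hc => by
  rw [← LinForm.eval_congr hint fun j => ?_]
  · exact hy c hc
  · rcases lt_or_ge j i with h | h
    exacts [.inl (P.cons_cont i c hc j h), .inr (hcont j h)]

theorem eval_obj_congr {i : Fin (s + 1)} {y z : JointPoint P.dims} (hint : y.int = z.int)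
    (hcont : ∀ j, i ≤ j → y.cont j = z.cont j) : (P.obj i).eval y = (P.obj i).eval z :=
  LinForm.eval_congr hint fun j =>
    (lt_or_ge j i).imp (fun h => P.obj_cont i j h) (fun h => hcont j h)

/-- Feasibility for a level does not depend on the continuous variables of the levels before. -/
theorem Feas.congr {i : Fin (s + 1)} {y z : JointPoint P.dims} (hint : y.int = z.int)
    (hcont : ∀ j, i ≤ j → y.cont j = z.cont j) (hy : P.Feas i y) : P.Feas i z := by
  rw [feas_iff] at hy ⊢
  refine ⟨hint ▸ hy.1, hy.2.1.congr hint hcont, fun j hj => ?_⟩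
  have hij : i ≤ j := Fin.le_def.2 (by omega)
  obtain ⟨hyj, hopt⟩ := hy.2.2 j hj
  refine ⟨hyj.congr hint fun k hk => hcont k (hij.trans hk), fun w hw hwj => ?_⟩
  -- The competitor `w` of `z` becomes a competitor of `y` by taking over the continuous variables
  -- of `y` before level `j`, to which level `j` is insensitive by recursion.
  let w' : JointPoint P.dims := ⟨w.int, fun k => if k < j then y.cont k else w.cont k⟩
  have h1 : ∀ k, j ≤ k → w.cont k = w'.cont k := fun k hk => (if_neg hk.not_gt).symm
  have := hopt w' (fun k hk => ⟨by rw [hint]; exact (hw k hk).1, (if_pos hk).symm⟩)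
    (Feas.congr (y := w) rfl h1 hwj)
  rwa [eval_obj_congr hint fun k hk => hcont k (hij.trans hk),
    ← eval_obj_congr (y := w) (z := w') rfl h1] at this
termination_by s - i.val
decreasing_by all_goals omega

theorem Feas.mono {i j : Fin (s + 1)} {y : JointPoint P.dims} (hy : P.Feas i y) (hij : i ≤ j) :
    P.Feas j y := by
  rcases hij.eq_or_lt with rfl | h
  · exact hy
  · have hlt : i.val < j.val := h
    exact ((feas_iff.1 hy).2.2 ⟨i.val + 1, by omega⟩ rfl).1.mono (Fin.le_def.2 (by simpa using hlt))
termination_by s - i.val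
decreasing_by all_goals omega

/-- Optimality in terms of the integer variables of the levels before. -/
theorem Feas.obj_le {i j : Fin (s + 1)} {y z : JointPoint P.dims} (hy : P.Feas i y) (hij : i < j)
    (hz : P.Feas j z) (hint : ∀ k, k < j → y.int k = z.int k) :
    (P.obj j).eval y ≤ (P.obj j).eval z := by
  have hlt : i.val < j.val := hij
  have hy' : P.Feas ⟨j.val - 1, by omega⟩ y := hy.mono (Fin.le_def.2 (by simp; omega))
  let z' : JointPoint P.dims := ⟨z.int, fun k => if k < j then y.cont k else z.cont k⟩
  have h1 : ∀ k, j ≤ k → z.cont k = z'.cont k := fun k hk => (if_neg hk.not_gt).symm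
  rw [eval_obj_congr (y := z) (z := z') rfl h1]
  exact ((feas_iff.1 hy').2.2 j (by simp; omega)).2 z'
    (fun k hk => ⟨hint k hk, (if_pos hk).symm⟩) (Feas.congr (y := z) rfl h1 hz)

theorem Feas.obj_eq {i j : Fin (s + 1)} {y z : JointPoint P.dims} (hy : P.Feas i y)
    (hz : P.Feas i z) (hij : i < j) (hint : y.int = z.int) :
    (P.obj j).eval y = (P.obj j).eval z :=
  (hy.obj_le hij (hz.mono hij.le) fun k _ => by rw [hint]).antisymm
    (hz.obj_le hij (hy.mono hij.le) fun k _ => by rw [hint])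

theorem Feas.inBox {i j : Fin (s + 1)} {y : JointPoint P.dims} (hy : P.Feas i y) (hij : i ≤ j) :
    P.InBox j (y.int j) := (feas_iff.1 (hy.mono hij)).1

theorem Feas.satisfiesCons {i j : Fin (s + 1)} {y : JointPoint P.dims} (hy : P.Feas i y)
    (hij : i ≤ j) : P.SatisfiesCons j y := (feas_iff.1 (hy.mono hij)).2.1

/-- A sufficient condition for feasibility: all constraints hold and the objective values of the
levels below are attained by feasible decisions with the same integer variables. -/
theorem feas_of_forall {i : Fin (s + 1)} {y : JointPoint P.dims}
    (hbox : ∀ j, i ≤ j → P.InBox j (y.int j)) (hcons : ∀ j, i ≤ j → P.SatisfiesCons j y)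
    (hobj : ∀ j, i < j → ∃ z, P.Feas i z ∧ z.int = y.int ∧ (P.obj j).eval y ≤ (P.obj j).eval z) :
    P.Feas i y := by
  rw [feas_iff]
  refine ⟨hbox i le_rfl, hcons i le_rfl, fun j hj => ⟨?_, fun w hw hwj => ?_⟩⟩
  · have hij : i < j := Fin.lt_def.2 (by omega)
    refine feas_of_forall (fun k hk => hbox k (hij.le.trans hk))
      (fun k hk => hcons k (hij.le.trans hk)) fun k hk => ?_
    obtain ⟨z, hz, hzy, hle⟩ := hobj k (hij.trans hk)
    exact ⟨z, hz.mono hij.le, hzy, hle⟩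
  · have hij : i < j := Fin.lt_def.2 (by omega)
    obtain ⟨z, hz, hzy, hle⟩ := hobj j hij
    exact hle.trans (hz.obj_le hij hwj fun k hk => by rw [hzy]; exact (hw k hk).1)
termination_by s - i.val
decreasing_by all_goals omega

/-! ### Feasible decisions of polynomial size -/

/-- All data of the problem have at most `L` bits. -/
structure BoundedBy (P : MIMLP s) (L : ℕ) : Prop where
  pos : 0 < L
  total : P.dims.total ≤ L
  lo : ∀ j k, (P.lo j k).natAbs < 2 ^ L
  hi : ∀ j k, (P.hi j k).natAbs < 2 ^ L
  obj : ∀ i, (P.obj i).BoundedBy L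
  cons : ∀ i, ∀ c ∈ P.cons i, c.1.BoundedBy L ∧ c.2.height ≤ 2 ^ L

theorem BoundedBy.isSmall_int {L : ℕ} (hP : P.BoundedBy L) {y : JointPoint P.dims}
    (hbox : ∀ i, P.InBox i (y.int i)) (j) (k) : IsSmall L (y.int j k) := by
  refine ⟨(y.int j k : ℚ), by push_cast; rfl, ?_⟩
  have h1 := hbox j k
  have h2 := hP.lo j k
  have h3 := hP.hi j k
  simp only [Rat.height, Rat.num_intCast, Rat.den_intCast]
  omega

/-- Minimization over the feasible decisions with given integer variables, with additional linear
constraints. -/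
theorem Feas.exists_bounded {L T : ℕ} (hP : P.BoundedBy L) (hLT : L ≤ T) {i : Fin (s + 1)}
    {y : JointPoint P.dims} (hy : P.Feas i y) (hbox : ∀ i, P.InBox i (y.int i))
    (hobj : ∀ j, i < j → IsSmall T ((P.obj j).eval y)) (g : LinForm P.dims)
    (extra : List (LinForm P.dims × ℚ))
    (hextra : ∀ r ∈ extra, r.1.BoundedBy T ∧ r.2.height ≤ 2 ^ T)
    (hyx : ∀ r ∈ extra, r.1.eval y ≤ r.2) :
    (∀ M : ℝ, ∃ z : JointPoint P.dims, z.int = y.int ∧ P.Feas i z ∧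
      (∀ r ∈ extra, r.1.eval z ≤ r.2) ∧ g.eval z ≤ M) ∨
      ∃ z : JointPoint P.dims, z.int = y.int ∧ P.Feas i z ∧ (∀ r ∈ extra, r.1.eval z ≤ r.2) ∧
        g.eval z ≤ g.eval y ∧ z.BoundedBy (pointBits.eval T) := by
  choose! q hq hqT using hobj
  -- With fixed integer variables, optimality of level j is the single linear constraint f_j ≤ q_j,
  -- where q_j is the optimal value attained at `y`.
  let rows := ((List.finRange (s + 1)).flatMap fun j => if i ≤ j then P.cons j else []) ++
    ((List.finRange (s + 1)).flatMap fun j => if i < j then [(P.obj j, q j)] else []) ++ extra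
  have hmem : ∀ r, r ∈ rows ↔ ((∃ j, i ≤ j ∧ r ∈ P.cons j) ∨ ∃ j, i < j ∧ r = (P.obj j, q j)) ∨
      r ∈ extra := by
    intro r
    simp only [rows, List.mem_append, List.mem_flatMap, List.mem_finRange, true_and]
    refine or_congr_left (or_congr ?_ ?_)
    · refine exists_congr fun j => ?_
      split_ifs with h <;> simp [h]
    · refine exists_congr fun j => ?_
      split_ifs with h <;> simp [h]
  have h2 : 2 ^ L ≤ 2 ^ T := Nat.pow_le_pow_right (by norm_num) hLT
  have hrowsT : ∀ r ∈ rows, r.1.BoundedBy T ∧ r.2.height ≤ 2 ^ T := by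
    intro r hr
    rcases (hmem r).1 hr with (⟨j, hj, hr⟩ | ⟨j, hj, rfl⟩) | hr
    · exact ⟨(hP.cons j r hr).1.mono hLT, (hP.cons j r hr).2.trans h2⟩
    · exact ⟨(hP.obj j).mono hLT, hqT j hj⟩
    · exact hextra r hr
  have hyrows : ∀ r ∈ rows, r.1.eval y ≤ r.2 := by
    intro r hr
    rcases (hmem r).1 hr with (⟨j, hj, hr⟩ | ⟨j, hj, rfl⟩) | hr
    · exact hy.satisfiesCons hj r hr
    · exact (hq j hj).le
    · exact hyx r hr
  have hfeas : ∀ z : JointPoint P.dims, z.int = y.int → (∀ r ∈ rows, r.1.eval z ≤ r.2) →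
      P.Feas i z ∧ ∀ r ∈ extra, r.1.eval z ≤ r.2 := by
    intro z hzy hz
    refine ⟨feas_of_forall (fun j _ => hzy ▸ hbox j)
      (fun j hj r hr => hz r ((hmem r).2 (.inl (.inl ⟨j, hj, hr⟩)))) fun j hj =>
        ⟨y, hy, hzy.symm, ?_⟩, fun r hr => hz r ((hmem r).2 (.inr hr))⟩
    rw [hq j hj]
    exact hz (P.obj j, q j) ((hmem _).2 (.inl (.inr ⟨j, hj, rfl⟩)))
  rcases exists_bounded_point rows g (hP.pos.trans_le hLT) (hP.total.trans hLT) hrowsT y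
    (fun j k => (hP.isSmall_int hbox j k).mono hLT) hyrows with h | ⟨z, hzy, hz, hg, hzT⟩
  · refine .inl fun M => ?_
    obtain ⟨z, hzy, hz, hg⟩ := h M
    exact ⟨z, hzy, (hfeas z hzy hz).1, (hfeas z hzy hz).2, hg⟩
  · exact .inr ⟨z, hzy, (hfeas z hzy hz).1, (hfeas z hzy hz).2, hg, hzT⟩

/-- The number of bits for the optimal values of the last `r` levels. -/
noncomputable def optBits : ℕ → Polynomial ℕ
  | 0 => .X
  | r + 1 => ((.X + pointBits) * .X).comp (optBits r)

theorem eval_optBits_succ (r L : ℕ) : (optBits (r + 1)).eval L =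
    ((optBits r).eval L + pointBits.eval ((optBits r).eval L)) * (optBits r).eval L := by
  simp [optBits]

theorem le_eval_optBits (r : ℕ) {L : ℕ} (hL : 0 < L) : L ≤ (optBits r).eval L := by
  induction r with
  | zero => simp [optBits]
  | succ r ih =>
    rw [eval_optBits_succ]
    nlinarith [Nat.zero_le (pointBits.eval ((optBits r).eval L))]

theorem eval_optBits_le_succ (r : ℕ) {L : ℕ} (hL : 0 < L) :
    (optBits r).eval L ≤ (optBits (r + 1)).eval L := by
  rw [eval_optBits_succ]
  have := le_eval_optBits r hL
  nlinarith [Nat.zero_le (pointBits.eval ((optBits r).eval L))]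

/-- Optimal objective values are rational numbers of polynomial size. -/
theorem Feas.isSmall_obj {L : ℕ} (hP : P.BoundedBy L) {i j : Fin (s + 1)} {y : JointPoint P.dims}
    (hy : P.Feas i y) (hbox : ∀ i, P.InBox i (y.int i)) (hij : i < j) :
    IsSmall ((optBits (s - i.val)).eval L) ((P.obj j).eval y) := by
  have hlt : i.val < j.val := hij
  obtain ⟨r, hr⟩ : ∃ r, s - i.val = r + 1 := ⟨s - i.val - 1, by omega⟩
  let i' : Fin (s + 1) := ⟨i.val + 1, by omega⟩
  have hr' : s - i'.val = r := by simp only [i']; omega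
  have hii' : i < i' := Fin.lt_def.2 (by simp [i'])
  have ih : ∀ k, i' < k → IsSmall ((optBits r).eval L) ((P.obj k).eval y) := fun k hk =>
    hr' ▸ (hy.mono hii'.le).isSmall_obj hP hbox hk
  rw [hr]
  rcases (show i' ≤ j from Fin.le_def.2 (by simpa [i'] using hlt)).eq_or_lt with h | h
  · rw [← h]
    -- Minimize the objective of the next level, the optimal values further down being small
    -- already. Unboundedness contradicts optimality of `y`, and a small point no worse than `y`
    -- attains its value.
    rcases (hy.mono hii'.le).exists_bounded hP (le_eval_optBits r hP.pos) hbox ih (P.obj i') []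
      (by simp) (by simp) with hM | ⟨z, hzy, hz, -, hle, hzT⟩
    · obtain ⟨z, hzy, hz, -, hle⟩ := hM ((P.obj i').eval y - 1)
      have := hy.obj_le hii' hz fun k _ => by rw [hzy]
      linarith
    · rw [(hy.obj_le hii' hz fun k _ => by rw [hzy]).antisymm hle, eval_optBits_succ]
      exact ((hP.obj i').mono (le_eval_optBits r hP.pos)).isSmall_eval hzT
        (hP.total.trans (le_eval_optBits r hP.pos))
  · exact (ih j h).mono (eval_optBits_le_succ r hP.pos)
termination_by s - i.val
decreasing_by all_goals omega

end MIMLP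

section

open StackProgram StackData

/-! ### Lists given by functions -/

theorem enc_ofFn {α : Type} [StackData α] {n : ℕ} (f : Fin n → α) :
    enc (List.ofFn f) = encodeFamily fun i => enc (f i) := by
  have h : (List.ofFn fun i => enc (f i)) = (List.ofFn f).map enc := by
    rw [List.map_ofFn]; rfl
  rw [encodeFamily, h]
  show encodeList enc _ = _
  simp only [encodeList, List.flatMap_map, id]

theorem sz_ofFn {α : Type} [StackData α] {n : ℕ} (f : Fin n → α) :
    sz (List.ofFn f) = ∑ i, (sz (f i) + 1) + 1 := by
  induction n with
  | zero => simp [sz_nil]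
  | succ n ih => rw [List.ofFn_succ, sz_cons, ih, Fin.sum_univ_succ]; omega

theorem List.withTails_ofFn {α : Type} {n : ℕ} (f : Fin n → α) :
    (List.ofFn f).withTails = List.ofFn fun i => (f i, (List.ofFn f).drop (i.val + 1)) := by
  induction n with
  | zero => rfl
  | succ n ih =>
    rw [List.ofFn_succ, List.withTails, ih, List.ofFn_succ]
    simp

theorem List.all₂'_ofFn {α β : Type} (p : α → β → Bool) {n : ℕ} (f : Fin n → α) (g : Fin n → β) :
    (List.ofFn f).all₂' p (List.ofFn g) = true ↔ ∀ i, p (f i) (g i) = true := by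
  induction n with
  | zero => simp [List.all₂']
  | succ n ih => simp [List.ofFn_succ, List.all₂', ih, Fin.forall_fin_succ]

theorem List.exists_ofFn_of_all₂' {α β : Type} {p : α → β → Bool} {n : ℕ} {f : Fin n → α}
    {l : List β} (h : (List.ofFn f).all₂' p l = true) : ∃ g : Fin n → β, l = List.ofFn g := by
  induction n generalizing l with
  | zero =>
    cases l with
    | nil => exact ⟨Fin.elim0, rfl⟩
    | cons b l => simp [List.all₂'] at h
  | succ n ih =>
    cases l with
    | nil => simp [List.ofFn_succ, List.all₂'] at h
    | cons b l =>
      rw [List.ofFn_succ, List.all₂', Bool.and_eq_true] at h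
      obtain ⟨g, rfl⟩ := ih h.2
      exact ⟨Fin.cons b g, by simp [List.ofFn_succ]⟩

theorem List.getD_ofFn {α : Type} {n : ℕ} (f : Fin n → α) (i : Fin n) (a : α) :
    (List.ofFn f).getD i a = f i := by
  simp [List.getD_eq_getElem?_getD]

/-- Truncation by `zip` agrees with padding by a neutral default, so guessed coordinate lists of a
wrong length still denote a decision. -/
theorem List.sum_zip_ofFn {α β : Type} {n : ℕ} (f : Fin n → α) (l : List β) (g : α → β → ℚ)
    (b : β) (hg : ∀ a, g a b = 0) :
    (((List.ofFn f).zip l).map fun x => g x.1 x.2).sum = ∑ i, g (f i) (l.getD i b) := by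
  induction n generalizing l with
  | zero => simp
  | succ n ih =>
    rw [List.ofFn_succ, Fin.sum_univ_succ]
    cases l with
    | nil => simp [hg]
    | cons c l => simpa using ih (fun i => f i.succ) l

theorem dot₂_ofFn {n : ℕ} {m : Fin n → ℕ} (f : ∀ j, Fin (m j) → ℚ) (l : List (List ℚ)) :
    dot₂ (List.ofFn fun j => List.ofFn (f j)) l =
      ∑ j, ∑ k, f j k * (l.getD j []).getD k 0 := by
  rw [dot₂, List.sum_zip_ofFn _ _ _ [] (by simp [dot])]
  exact Finset.sum_congr rfl fun j _ =>
    List.sum_zip_ofFn _ _ (fun a b => a * b) 0 fun a => mul_zero a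

/-! ### Raw data of problems -/

variable {s : ℕ} {d : LevelDims s}

/-- The coefficients of a linear form as lists. -/
def LinForm.raw (c : LinForm d) : RawForm :=
  (List.ofFn fun j => List.ofFn (c.cInt j), List.ofFn fun j => List.ofFn (c.cCont j))

/-- The data of a problem as lists. -/
def MIMLP.raw (P : MIMLP s) : RawProblem :=
  (List.ofFn P.dims.nInt, List.ofFn P.dims.nCont, List.ofFn fun j => List.ofFn (P.lo j),
    List.ofFn fun j => List.ofFn (P.hi j), List.ofFn fun i => (P.obj i).raw,
    List.ofFn fun i => (P.cons i).map fun c => (c.1.raw, c.2))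

theorem LinForm.enc_raw (c : LinForm d) : enc c.raw = c.encode := by
  show enc (List.ofFn _) ++ enc (List.ofFn _) = _
  simp only [enc_ofFn, LinForm.encode, enc_rat]

theorem MIMLP.enc_raw (P : MIMLP s) : enc P.raw = P.encode := by
  show enc (List.ofFn _) ++ (enc (List.ofFn _) ++ (enc (List.ofFn _) ++ (enc (List.ofFn _) ++
    (enc (List.ofFn _) ++ enc (List.ofFn _))))) = _
  have h : ∀ i, enc ((P.cons i).map fun c => (c.1.raw, c.2)) =
      encodeList (fun c => c.1.encode ++ encodeRat c.2) (P.cons i) := by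
    intro i
    show encodeList enc _ = _
    have : ∀ c : LinForm P.dims × ℚ, enc (c.1.raw, c.2) = c.1.encode ++ encodeRat c.2 := fun c => by
      rw [← LinForm.enc_raw]; rfl
    simp [encodeList, List.flatMap_map, this]
  simp only [enc_ofFn, MIMLP.encode, enc_nat, enc_int, LinForm.enc_raw, h,
    List.append_assoc]

theorem LinForm.raw_injective : Function.Injective (LinForm.raw (d := d)) := by
  rintro ⟨a, b⟩ ⟨a', b'⟩ h
  simp only [LinForm.raw, Prod.mk.injEq] at h
  have h1 : a = a' := funext fun j => List.ofFn_injective (congrFun (List.ofFn_injective h.1) j)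
  have h2 : b = b' := funext fun j => List.ofFn_injective (congrFun (List.ofFn_injective h.2) j)
  rw [h1, h2]

theorem MIMLP.raw_injective : Function.Injective (MIMLP.raw (s := s)) := by
  rintro ⟨⟨nI, nC⟩, lo, hi, obj, cons, h1, h2⟩ ⟨⟨nI', nC'⟩, lo', hi', obj', cons', h1', h2'⟩ h
  simp only [MIMLP.raw, Prod.mk.injEq] at h
  obtain ⟨hI, hC, hlo, hhi, hobj, hcons⟩ := h
  obtain rfl := List.ofFn_injective hI
  obtain rfl := List.ofFn_injective hC
  obtain rfl : lo = lo' :=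
    funext fun j => List.ofFn_injective (congrFun (List.ofFn_injective hlo) j)
  obtain rfl : hi = hi' :=
    funext fun j => List.ofFn_injective (congrFun (List.ofFn_injective hhi) j)
  obtain rfl : obj = obj' :=
    funext fun j => LinForm.raw_injective (congrFun (List.ofFn_injective hobj) j)
  obtain rfl : cons = cons' := by
    refine funext fun j => List.map_injective_iff.2 ?_ (congrFun (List.ofFn_injective hcons) j)
    rintro ⟨c, q⟩ ⟨c', q'⟩ h
    simp only [Prod.mk.injEq] at h
    rw [LinForm.raw_injective h.1, h.2]
  rfl

/-- The joint decision with the given coordinates. -/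
def JointPoint.ofRaw (d : LevelDims s) (Y : RawPoint) : JointPoint d where
  int j k := (Y.1.getD j []).getD k 0
  cont j k := (((Y.2.getD j []).getD k 0 : ℚ) : ℝ)

theorem LinForm.eval_raw (c : LinForm d) (Y : RawPoint) :
    ((c.raw.eval Y : ℚ) : ℝ) = c.eval (.ofRaw d Y) := by
  have h : ∀ (l : List (List ℤ)) (j k : ℕ),
      ((l.map fun r => r.map fun z : ℤ => (z : ℚ)).getD j []).getD k 0 =
        (((l.getD j []).getD k 0 : ℤ) : ℚ) := by
    intro l j k
    have : ([] : List ℚ) = ([] : List ℤ).map fun z : ℤ => (z : ℚ) := rfl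
    rw [this, List.getD_map (f := fun r : List ℤ => r.map fun z : ℤ => (z : ℚ)),
      ← Int.cast_zero, List.getD_map (f := fun z : ℤ => (z : ℚ))]
  rw [LinForm.raw, RawForm.eval, dot₂_ofFn, dot₂_ofFn, LinForm.eval, Finset.sum_add_distrib]
  simp only [h, JointPoint.ofRaw]
  push_cast
  rfl

/-- The lists of coordinates of a rational decision. -/
theorem JointPoint.ofRaw_ofFn (d : LevelDims s) (x : ∀ j, Fin (d.nInt j) → ℤ)
    (q : ∀ j, Fin (d.nCont j) → ℚ) :
    JointPoint.ofRaw d (List.ofFn fun j => List.ofFn (x j), List.ofFn fun j => List.ofFn (q j)) =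
      ⟨x, fun j k => q j k⟩ := by
  simp only [JointPoint.ofRaw, List.getD_ofFn]

/-! ### Parts and combinations of linear forms -/

/-- The exponents of the isolating weights. -/
def LevelDims.weight (d : LevelDims s) (j : Fin (s + 1)) (k : Fin (d.nInt j)) : ℕ :=
  ((List.ofFn d.nInt).drop (j.val + 1)).sum + (d.nInt j - (k.val + 1))

namespace LinForm

/-- The part of a linear form with the variables of the lower levels. -/
def lower (c : LinForm d) : LinForm d where
  cInt j k := if j = 0 then 0 else c.cInt j k
  cCont j k := if j = 0 then 0 else c.cCont j k

/-- The part of a linear form with the variables of the top level. -/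
def upper (c : LinForm d) : LinForm d where
  cInt j k := if j = 0 then c.cInt j k else 0
  cCont j k := if j = 0 then c.cCont j k else 0

/-- The integer variables of the lower levels, weighted with distinct powers of `K`. -/
def isolating (d : LevelDims s) (K : ℕ) : LinForm d where
  cInt j k := if j = 0 then 0 else (K : ℚ) ^ d.weight j k
  cCont _ _ := 0

/-- A combination of the lower part and the isolating form. -/
def comb (A B : ℚ) (K : ℕ) (c : LinForm d) : LinForm d where
  cInt j k := if j = 0 then 0 else A * c.cInt j k + B * (K : ℚ) ^ d.weight j k
  cCont j k := if j = 0 then 0 else A * c.cCont j k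

theorem isLower_comb (A B : ℚ) (K : ℕ) (c : LinForm d) : (comb A B K c).IsLower :=
  ⟨funext fun _ => rfl, funext fun _ => rfl⟩

theorem eval_upper_add_lower (c : LinForm d) (y : JointPoint d) :
    c.upper.eval y + c.lower.eval y = c.eval y := by
  simp only [eval, ← Finset.sum_add_distrib]
  refine Finset.sum_congr rfl fun j _ => ?_
  by_cases h : j = 0 <;> simp [upper, lower, h]

theorem eval_upper_congr {c : LinForm d} {y z : JointPoint d} (hint : y.int 0 = z.int 0)
    (hcont : c.cCont 0 = 0 ∨ y.cont 0 = z.cont 0) : c.upper.eval y = c.upper.eval z := by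
  unfold eval
  refine Finset.sum_congr rfl fun j _ => ?_
  by_cases h : j = 0
  · subst h
    rcases hcont with h | h <;> simp [upper, hint, h]
  · simp [upper, h]

theorem eval_comb (A B : ℚ) (K : ℕ) (c : LinForm d) (y : JointPoint d) :
    (comb A B K c).eval y = A * c.lower.eval y + B * (isolating d K).eval y := by
  simp only [eval, Finset.mul_sum, ← Finset.sum_add_distrib]
  refine Finset.sum_congr rfl fun j _ => ?_
  by_cases h : j = 0
  · simp [comb, lower, isolating, h]
  · simp only [comb, lower, isolating, h, if_false, mul_add, Finset.mul_sum, Rat.cast_zero,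
      zero_mul, Finset.sum_const_zero, add_zero, Rat.cast_add, Rat.cast_mul, add_mul,
      Finset.sum_add_distrib, mul_assoc]
    ring

theorem BoundedBy.upper {c : LinForm d} {N : ℕ} (h : c.BoundedBy N) : c.upper.BoundedBy N := by
  have h0 : Rat.height 0 ≤ 2 ^ N := by
    simpa [Rat.height] using Nat.one_le_two_pow
  constructor <;> intro j k <;> simp only [LinForm.upper] <;> split_ifs
  exacts [h.1 j k, h0, h.2 j k, h0]

theorem BoundedBy.lower {c : LinForm d} {N : ℕ} (h : c.BoundedBy N) : c.lower.BoundedBy N := by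
  have h0 : Rat.height 0 ≤ 2 ^ N := by
    simpa [Rat.height] using Nat.one_le_two_pow
  constructor <;> intro j k <;> simp only [LinForm.lower] <;> split_ifs
  exacts [h0, h.1 j k, h0, h.2 j k]

theorem raw_comb (A B : ℚ) (K : ℕ) (c : LinForm d) :
    (comb A B K c).raw = RawForm.comb A B K c.raw := by
  have hz : ∀ f : Fin (s + 1) → List ℚ, RawForm.zeroHead (List.ofFn f) =
      List.ofFn fun j => if j = 0 then (f j).map fun _ => 0 else f j := by
    intro f
    rw [List.ofFn_succ, List.ofFn_succ]
    simp [RawForm.zeroHead, List.caseNilCons]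
  rw [RawForm.comb, raw, raw]
  simp only [List.withTails_ofFn, List.map_ofFn, hz, Function.comp_def]
  congr 1
  · congr 1
    funext j
    by_cases h : j = 0
    · simp [comb, h]
    · simp only [comb, h, if_false]
      congr 1
      funext k
      congr 3
      rw [List.length_drop, List.length_ofFn, List.length_flatten, List.map_drop, List.map_ofFn]
      simp [LevelDims.weight, Function.comp_def]
  · congr 1
    funext j
    by_cases h : j = 0
    · simp [comb, h]
    · simp [comb, h]

theorem eval_isolating (K : ℕ) (y : JointPoint d) : (isolating d K).eval y =
    ((∑ j, ∑ k, if j = 0 then 0 else (K : ℤ) ^ d.weight j k * y.int j k : ℤ) : ℝ) := by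
  rw [eval]
  push_cast
  refine Finset.sum_congr rfl fun j _ => ?_
  by_cases h : j = 0 <;> simp [isolating, h]

end LinForm

/-- A vanishing combination of distinct powers of `K` with small coefficients is trivial. -/
theorem eq_zero_of_sum_pow_eq_zero {ι : Type*} [Fintype ι] (e : ι → ℕ) (he : Function.Injective e)
    (K : ℕ) (x : ι → ℤ) (hx : ∀ i, |x i| < K) (h : ∑ i, (K : ℤ) ^ e i * x i = 0) : x = 0 := by
  classical
  by_contra hne
  obtain ⟨i₀, hi₀⟩ := Function.ne_iff.1 hne
  -- Take the nonzero coefficient with the smallest exponent. All other terms are divisible by the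
  -- next power of K, so K divides this coefficient, which is smaller than K in absolute value.
  obtain ⟨i, hi, hmin⟩ := (Finset.univ.filter fun i => x i ≠ 0).exists_min_image e
    ⟨i₀, by simpa using hi₀⟩
  have hi' : x i ≠ 0 := by simpa using hi
  have hK : (0 : ℤ) < K := (abs_nonneg _).trans_lt (hx i)
  rw [← Finset.add_sum_erase _ _ (Finset.mem_univ i)] at h
  have hdvd : (K : ℤ) ^ (e i + 1) ∣ ∑ j ∈ Finset.univ.erase i, (K : ℤ) ^ e j * x j := by
    refine Finset.dvd_sum fun j hj => ?_
    by_cases hj0 : x j = 0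
    · simp [hj0]
    · refine Dvd.dvd.mul_right (pow_dvd_pow _ ?_) _
      have h1 := hmin j (by simpa using hj0)
      have h2 : e i ≠ e j := fun hij => Finset.ne_of_mem_erase hj (he hij).symm
      omega
  have h2 : (K : ℤ) ^ (e i + 1) ∣ (K : ℤ) ^ e i * x i := by
    rw [eq_neg_of_add_eq_zero_left h]
    exact hdvd.neg_right
  rw [pow_succ] at h2
  exact hi' (Int.eq_zero_of_abs_lt_dvd (Int.dvd_of_mul_dvd_mul_left (pow_pos hK _).ne' h2) (hx i))

/-- The weight of an integer variable is the number of integer variables after it, ordered by level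
and then by index. In the proof `S j` counts those of the levels from `j` on. -/
theorem LevelDims.weight_injective (d : LevelDims s) :
    Function.Injective fun v : Σ j, Fin (d.nInt j) => d.weight v.1 v.2 := by
  let S : ℕ → ℕ := fun j => ((List.ofFn d.nInt).drop j).sum
  have hS : ∀ j : Fin (s + 1), S j.val = d.nInt j + S (j.val + 1) := by
    intro j
    simp only [S]
    rw [List.drop_eq_getElem_cons (by rw [List.length_ofFn]; exact j.2), List.sum_cons,
      List.getElem_ofFn]
  have hanti : Antitone S := antitone_nat_of_succ_le fun j => by
    by_cases h : j < s + 1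
    · have := hS ⟨j, h⟩
      simp only at this
      omega
    · simp only [S]
      rw [List.drop_eq_nil_of_le (by rw [List.length_ofFn]; omega)]
      exact Nat.zero_le _
  have hw : ∀ j k, d.weight j k + k.val + 1 = S j.val := by
    intro j k
    have := k.2
    have := hS j
    simp only [LevelDims.weight, S] at *
    omega
  have hlt : ∀ (j j' : Fin (s + 1)) k k', j < j' → d.weight j' k' < d.weight j k := by
    intro j j' k k' h
    have h1 := hanti (show j.val + 1 ≤ j'.val from h)
    have h2 := hw j k
    have h3 := hw j' k'
    have h4 := hS j
    have := k.2
    omega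
  rintro ⟨j, k⟩ ⟨j', k'⟩ h
  simp only at h
  rcases lt_trichotomy j j' with hj | rfl | hj
  · exact absurd h (hlt _ _ _ _ hj).ne'
  · have h1 := hw j k
    have h2 := hw j k'
    rw [show k = k' from Fin.ext (by omega)]
  · exact absurd h (hlt _ _ _ _ hj).ne

/-- The isolating form determines the integer variables. -/
theorem LinForm.int_eq_of_eval_isolating_eq {K : ℕ} {y z : JointPoint d} (h0 : y.int 0 = z.int 0)
    (hK : ∀ j k, |y.int j k - z.int j k| < K)
    (h : (isolating d K).eval y = (isolating d K).eval z) : y.int = z.int := by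
  rw [eval_isolating, eval_isolating, Int.cast_inj, ← sub_eq_zero] at h
  simp only [← Finset.sum_sub_distrib] at h
  have := eq_zero_of_sum_pow_eq_zero (fun v : Σ j, Fin (d.nInt j) => d.weight v.1 v.2)
    d.weight_injective K (fun v => y.int v.1 v.2 - z.int v.1 v.2) (fun v => hK v.1 v.2) (by
      rw [Fintype.sum_sigma, ← h]
      refine Finset.sum_congr rfl fun j _ => Finset.sum_congr rfl fun k _ => ?_
      by_cases hj : j = 0
      · subst hj
        simp [h0]
      · simp only [hj, if_false]
        ring)
  funext j k
  exact sub_eq_zero.1 (congrFun this ⟨j, k⟩)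

end

theorem Rat.finite_height_le (H : ℕ) : {q : ℚ | q.height ≤ H}.Finite := by
  refine Set.Finite.of_injOn (f := fun q : ℚ => (q.num, q.den))
    (t := Set.Icc (-(H : ℤ)) H ×ˢ Set.Iic H) (fun q hq => ?_) (fun p _ q _ h => ?_)
    ((Set.finite_Icc _ _).prod (Set.finite_Iic _))
  · simp only [Set.mem_ofPred_eq, Rat.height, Set.mem_prod, Set.mem_Icc, Set.mem_Iic] at hq ⊢
    omega
  · simp only [Prod.mk.injEq] at h
    exact Rat.ext h.1 h.2

namespace MIMLP

variable {n : ℕ} {P : MIMLP (n + 1)}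

/-! ### Certificates for feasibility and robustness -/

/-- The conditions checked for a feasible point of the canonical problem, in terms of the first
lower level. -/
structure Certified (P : MIMLP (n + 1)) (K : ℕ) (Γ : ℚ) (y : JointPoint P.dims) : Prop where
  box : ∀ i, P.InBox i (y.int i)
  cons : ∀ i, P.SatisfiesCons i y
  obj : (P.obj 0).eval y ≤ Γ
  isolating : ∀ i, 1 < i → ∃ z, z.int 0 = y.int 0 ∧ P.Feas 1 z ∧
    (LinForm.isolating P.dims K).eval z ≤ (LinForm.isolating P.dims K).eval y ∧
    -(P.obj i).lower.eval z - K * (LinForm.isolating P.dims K).eval z ≤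
      -(P.obj i).lower.eval y - K * (LinForm.isolating P.dims K).eval y
  opt : ∀ z, z.int 0 = y.int 0 → P.Feas 1 z →
    (P.obj 1).lower.eval y - 1 / (K + 1) < (P.obj 1).lower.eval z
  attained : ∃ z, z.int 0 = y.int 0 ∧ P.Feas 1 z ∧
    (P.obj 1).lower.eval z ≤ (P.obj 1).lower.eval y

/-- The conditions checked for the near-optimal robustness. -/
def CertifiedRobust (P : MIMLP (n + 1)) (K : ℕ) (δ : ℚ) (y : JointPoint P.dims) : Prop :=
  ∀ c ∈ P.cons 0, ∀ z, z.int 0 = y.int 0 → P.Feas 1 z →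
    (P.obj 1).lower.eval z ≤ (P.obj 1).lower.eval y + δ →
      c.1.upper.eval y + c.1.lower.eval z < c.2 + 1 / (K + 1)

/-- Bits for the values of the first lower level, including a tolerance. -/
noncomputable def valueBits (n : ℕ) : Polynomial ℕ := optBits (n + 1) + 2 * .X ^ 2 + .X

/-- Bits for linear functions at vertices of the first lower level. -/
noncomputable def lowerBits (n : ℕ) : Polynomial ℕ :=
  (.X + pointBits.comp (valueBits n)) * .X

/-- Bits for the precision of the certificates. -/
noncomputable def gapBits (n : ℕ) : Polynomial ℕ :=
  lowerBits n + 2 * .X ^ 2 + valueBits n + .X + 2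

/-- Bits for the coordinates of solutions. -/
noncomputable def solutionBits (n : ℕ) : Polynomial ℕ :=
  pointBits.comp (valueBits n + lowerBits n + .X)

theorem eval_valueBits (n W : ℕ) :
    (valueBits n).eval W = (optBits (n + 1)).eval W + 2 * W ^ 2 + W := by simp [valueBits]

theorem eval_lowerBits (n W : ℕ) :
    (lowerBits n).eval W = (W + pointBits.eval ((valueBits n).eval W)) * W := by simp [lowerBits]

theorem eval_gapBits (n W : ℕ) : (gapBits n).eval W =
    (lowerBits n).eval W + 2 * W ^ 2 + (valueBits n).eval W + W + 2 := by simp [gapBits]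

theorem eval_solutionBits (n W : ℕ) : (solutionBits n).eval W =
    pointBits.eval ((valueBits n).eval W + (lowerBits n).eval W + W) := by simp [solutionBits]

theorem eval_obj_eq_upper_add_lower {i : Fin (n + 2)} (hi : 0 < i) {y z : JointPoint P.dims}
    (hint : z.int 0 = y.int 0) :
    (P.obj i).eval z = (P.obj i).upper.eval y + (P.obj i).lower.eval z := by
  rw [← LinForm.eval_upper_add_lower, LinForm.eval_upper_congr hint (.inl (P.obj_cont i 0 hi))]

theorem Feas.inBox_all {y z : JointPoint P.dims} (hz : P.Feas 1 z) (hint : z.int 0 = y.int 0)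
    (hy : P.InBox 0 (y.int 0)) (i : Fin (n + 2)) : P.InBox i (z.int i) := by
  rcases Fin.eq_zero_or_eq_succ i with rfl | ⟨i, rfl⟩
  · rwa [hint]
  · exact hz.inBox (Fin.le_def.2 (by simp))

theorem feas_zero_iff {y : JointPoint P.dims} : P.Feas 0 y ↔
    P.InBox 0 (y.int 0) ∧ P.SatisfiesCons 0 y ∧ P.Feas 1 y ∧
      ∀ z, z.int 0 = y.int 0 → P.Feas 1 z → (P.obj 1).eval y ≤ (P.obj 1).eval z := by
  constructor
  · intro h
    refine ⟨h.inBox le_rfl, h.satisfiesCons le_rfl, h.mono (Fin.zero_le _), fun z hz hz1 =>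
      h.obj_le (by simp) hz1 fun k hk => ?_⟩
    obtain rfl : k = 0 := by simpa [Fin.lt_one_iff] using hk
    exact hz.symm
  · rintro ⟨h1, h2, h3, h4⟩
    rw [feas_iff]
    refine ⟨h1, h2, fun j hj => ?_⟩
    obtain rfl : j = 1 := Fin.ext (by simpa using hj)
    exact ⟨h3, fun z hz hz1 => h4 z (hz 0 (by simp)).1.symm hz1⟩

/-- The lower levels do not see the continuous top-level variables, so z need agree with y only in
the integer ones if the top-level part of each constraint is evaluated at y. This is the form in
which the oracle can be asked. -/
theorem nearOptFeas_iff {δ : ℚ} {y : JointPoint P.dims} : P.NearOptFeas δ y ↔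
    P.Feas 0 y ∧ ∀ z, z.int 0 = y.int 0 → P.Feas 1 z →
      (P.obj 1).eval z ≤ (P.obj 1).eval y + δ → ∀ c ∈ P.cons 0,
        c.1.upper.eval y + c.1.lower.eval z ≤ c.2 := by
  have h01 : (0 : Fin (n + 2)) < 1 := by simp
  constructor
  · rintro ⟨h, hr⟩
    refine ⟨h, fun z hz hz1 hle c hc => ?_⟩
    let z' : JointPoint P.dims := ⟨z.int, fun k => if k < 1 then y.cont k else z.cont k⟩
    have hzz : ∀ k, 1 ≤ k → z.cont k = z'.cont k := fun k hk => (if_neg hk.not_gt).symm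
    have hz0 : y.cont 0 = z'.cont 0 := by simp [z']
    have := hr z' (fun k hk => ?_) (Feas.congr (y := z) rfl hzz hz1)
      (by rwa [← eval_obj_congr (y := z) (z := z') rfl hzz]) c hc
    · rw [← LinForm.eval_upper_add_lower, ← LinForm.eval_upper_congr (y := y) (z := z') hz.symm
        (.inr hz0)] at this
      rwa [LinForm.eval_congr (c := c.1.lower) (y := z) (z := z') rfl fun j => ?_]
      by_cases hj : j = 0
      · exact .inl (funext fun k => by simp [LinForm.lower, hj])
      · exact .inr (hzz j (Fin.one_le_of_ne_zero hj))
    · obtain rfl : k = 0 := by simpa [Fin.lt_one_iff] using hk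
      exact ⟨hz.symm, hz0⟩
  · rintro ⟨h, hr⟩
    refine ⟨h, fun z hz hz1 hle c hc => ?_⟩
    have h0 := hz 0 h01
    rw [← LinForm.eval_upper_add_lower, ← LinForm.eval_upper_congr h0.1 (.inr h0.2)]
    exact hr z h0.1.symm hz1 hle c hc

variable {W K : ℕ}

/-- Maximization of a linear function of the lower levels over near-optimal decisions. -/
theorem Feas.exists_bounded_lower (hP : P.BoundedBy W) {z : JointPoint P.dims}
    (hz : P.Feas 1 z) (hbox : ∀ i, P.InBox i (z.int i)) {v : ℝ}
    (hv : IsSmall ((valueBits n).eval W) v) (hzv : (P.obj 1).eval z ≤ v) (c : LinForm P.dims) :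
    (∀ M : ℝ, ∃ z' : JointPoint P.dims, z'.int = z.int ∧ P.Feas 1 z' ∧ (P.obj 1).eval z' ≤ v ∧
      M ≤ c.lower.eval z') ∨
    ∃ z' : JointPoint P.dims, z'.int = z.int ∧ P.Feas 1 z' ∧ (P.obj 1).eval z' ≤ v ∧
      c.lower.eval z ≤ c.lower.eval z' ∧
      z'.BoundedBy (pointBits.eval ((valueBits n).eval W)) := by
  obtain ⟨q, rfl, hq⟩ := hv
  have h1 := le_eval_optBits (n + 1) hP.pos
  have h2 := eval_optBits_le_succ n hP.pos
  have h3 := eval_valueBits n W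
  have hval : ∀ x, (LinForm.comb (-1) 0 0 c).eval x = -c.lower.eval x := fun x => by
    rw [LinForm.eval_comb]
    push_cast
    ring
  rcases hz.exists_bounded hP (T := (valueBits n).eval W) (by omega) hbox
    (fun j hj => (hz.isSmall_obj hP hbox hj).mono (by simp; omega)) (.comb (-1) 0 0 c)
    [(P.obj 1, q)] (by simpa using ⟨(hP.obj 1).mono (by omega), hq⟩) (by simpa using hzv)
    with h | ⟨z', hint, hz', hx, hg, hb⟩
  · refine .inl fun M => ?_
    obtain ⟨z', hint, hz', hx, hg⟩ := h (-M)
    rw [hval] at hg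
    exact ⟨z', hint, hz', by simpa using hx, by linarith⟩
  · rw [hval, hval] at hg
    exact .inr ⟨z', hint, hz', by simpa using hx, by linarith, hb⟩

theorem isSmall_lower (hP : P.BoundedBy W) {z : JointPoint P.dims} {c : LinForm P.dims}
    (hc : c.BoundedBy W) (hz : z.BoundedBy (pointBits.eval ((valueBits n).eval W))) :
    IsSmall ((lowerBits n).eval W) (c.eval z) := by
  rw [eval_lowerBits]
  exact hc.isSmall_eval hz hP.total

theorem one_div_succ_le {N : ℕ} {x : ℝ} (hx : IsSmall N x) (h0 : 0 < x) (hK : 2 ^ N ≤ K) :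
    1 / ((K : ℝ) + 1) ≤ x := by
  refine le_trans ?_ (hx.inv_le h0)
  have : (2 : ℝ) ^ N ≤ K := by exact_mod_cast hK
  exact one_div_le_one_div_of_le (by positivity) (by linarith)

/-- The isolating conditions give, for each level below the first, a feasible z with the integer
variables of y and f_j(y) ≤ f_j(z), which is what `feas_of_forall` needs. Optimality at level 1
follows because a better z could be replaced by one better by at least 1/(K+1). -/
theorem Certified.feas (hP : P.BoundedBy W) {Γ : ℚ} {y : JointPoint P.dims} (hy : y.BoundedBy W)
    (hK : 2 ^ (gapBits n).eval W ≤ K) (h : P.Certified K Γ y) : P.Feas 0 y := by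
  have hW := hP.pos
  have hopt := eval_optBits_le_succ n hW
  have hopt' := le_eval_optBits n hW
  have hvb := eval_valueBits n W
  have hgb := eval_gapBits n W
  have hpow : ∀ {N}, N + 1 ≤ (gapBits n).eval W → 2 * 2 ^ N ≤ K := fun hN =>
    ((pow_succ' 2 _).symm.le.trans (Nat.pow_le_pow_right (by norm_num) hN)).trans hK
  have hyobj : ∀ i, IsSmall (2 * W ^ 2) ((P.obj i).eval y) := fun i =>
    ((hP.obj i).isSmall_eval hy hP.total).mono (by nlinarith)
  have h1 : P.Feas 1 y := by
    refine feas_of_forall (fun j _ => h.box j) (fun j _ => h.cons j) fun j hj => ?_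
    obtain ⟨z, hz0, hz, hI, hle⟩ := h.isolating j hj
    have hzbox := hz.inBox_all hz0 (h.box 0)
    have hj0 : 0 < j := (Fin.zero_le _).trans_lt hj
    have e1 := eval_obj_eq_upper_add_lower hj0 hz0
    have e2 := eval_obj_eq_upper_add_lower (P := P) hj0 (y := y) rfl
    -- If I(z) < I(y), the difference is at least 1 by integrality, and the second inequality forces
    -- f_j(z) - f_j(y) ≥ K. But f_j(z) is an optimal value, since j > 1, and y is small, so both
    -- values are below K/2 in absolute value.
    have hIeq : (LinForm.isolating P.dims K).eval z = (LinForm.isolating P.dims K).eval y := by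
      refine hI.antisymm (not_lt.1 fun hlt => ?_)
      have hstep : (LinForm.isolating P.dims K).eval z + 1 ≤
          (LinForm.isolating P.dims K).eval y := by
        rw [LinForm.eval_isolating, LinForm.eval_isolating] at hlt ⊢
        exact_mod_cast hlt
      have hzs := (abs_lt.1 (hz.isSmall_obj hP hzbox hj).abs_lt).2
      have hys := (abs_lt.1 (hyobj j).abs_lt).1
      have p1 : ((2 : ℝ) ^ (optBits n).eval W) * 2 ≤ K := by
        have := hpow (N := (optBits n).eval W) (by omega)
        rw [mul_comm]
        exact_mod_cast this
      have p2 : ((2 : ℝ) ^ (2 * W ^ 2)) * 2 ≤ K := by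
        have := hpow (N := 2 * W ^ 2) (by omega)
        rw [mul_comm]
        exact_mod_cast this
      have hn : n + 1 - (1 : Fin (n + 2)).val = n := by simp
      rw [hn] at hzs
      nlinarith [Nat.cast_nonneg (α := ℝ) K]
    have hint : z.int = y.int := LinForm.int_eq_of_eval_isolating_eq hz0 (fun j k => ?_) hIeq
    · exact ⟨z, hz, hint, by rw [e1, e2]; rw [hIeq] at hle; linarith⟩
    · have b1 := hzbox j k
      have b2 := h.box j k
      have b3 := hP.lo j k
      have b4 := hP.hi j k
      have : 2 * 2 ^ W ≤ K := hpow (N := W) (by omega)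
      rw [abs_lt]
      zify at b3 b4 this
      rw [abs_lt] at b3 b4
      constructor <;> linarith
  refine feas_zero_iff.2 ⟨h.box 0, h.cons 0, h1, fun z hz0 hz => ?_⟩
  by_contra! hlt
  have hzbox := hz.inBox_all hz0 (h.box 0)
  have key : ∀ z', z'.int = z.int → P.Feas 1 z' →
      (P.obj 1).eval y - 1 / (K + 1) < (P.obj 1).eval z' := by
    intro z' hint hz'
    have hz0' : z'.int 0 = y.int 0 := by rw [hint, hz0]
    have := h.opt z' hz0' hz'
    rw [eval_obj_eq_upper_add_lower (by simp) hz0',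
      eval_obj_eq_upper_add_lower (P := P) (by simp) (y := y) rfl]
    linarith
  rcases hz.exists_bounded hP (T := (valueBits n).eval W) (by omega) hzbox
    (fun j hj => (hz.isSmall_obj hP hzbox hj).mono (by simp; omega)) (P.obj 1) [] (by simp)
    (by simp) with hM | ⟨z', hint, hz', -, hle, hb⟩
  · obtain ⟨z', hint, hz', -, hle⟩ := hM ((P.obj 1).eval y - 1 / (K + 1))
    exact (key z' hint hz').not_ge hle
  · have hs : IsSmall ((gapBits n).eval W) ((P.obj 1).eval y - (P.obj 1).eval z') :=
      ((hyobj 1).sub (isSmall_lower hP (hP.obj 1) hb)).mono (by omega)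
    have := one_div_succ_le hs (by linarith) hK
    linarith [key z' hint hz']

/-- With the integer variables of a violating z fixed, the lower-level part of the constraint is
either unbounded on the near-optimal decisions or at least as large at a small point. Either way
some violation is at least 1/(K+1). -/
theorem CertifiedRobust.nearOptFeas (hP : P.BoundedBy W) {Γ δ : ℚ} {y : JointPoint P.dims}
    (hy : y.BoundedBy W) (hδ : δ.height ≤ 2 ^ W) (hK : 2 ^ (gapBits n).eval W ≤ K)
    (h : P.Certified K Γ y) (hr : P.CertifiedRobust K δ y) : P.NearOptFeas δ y := by
  refine nearOptFeas_iff.2 ⟨h.feas hP hy hK, fun z hz0 hz hle c hc => ?_⟩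
  by_contra! hlt
  have hvb := eval_valueBits n W
  have hgb := eval_gapBits n W
  have hv : IsSmall ((valueBits n).eval W) ((P.obj 1).eval y + δ) :=
    (((hP.obj 1).isSmall_eval hy hP.total).add (.of_rat hδ)).mono (by
      have : (W + W) * W = 2 * W ^ 2 := by ring
      omega)
  have key : ∀ z', z'.int = z.int → P.Feas 1 z' → (P.obj 1).eval z' ≤ (P.obj 1).eval y + δ →
      c.1.upper.eval y + c.1.lower.eval z' < c.2 + 1 / (K + 1) := by
    intro z' hint hz' hle'
    have hz0' : z'.int 0 = y.int 0 := by rw [hint, hz0]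
    refine hr c hc z' hz0' hz' ?_
    rw [eval_obj_eq_upper_add_lower (by simp) hz0',
      eval_obj_eq_upper_add_lower (P := P) (by simp) (y := y) rfl] at hle'
    linarith
  rcases hz.exists_bounded_lower hP (hz.inBox_all hz0 (h.box 0)) hv hle c.1 with
    hM | ⟨z', hint, hz', hle', hcz, hb⟩
  · obtain ⟨z', hint, hz', hle', hcz⟩ := hM (c.2 + 1 / (K + 1) - c.1.upper.eval y)
    linarith [key z' hint hz' hle']
  · have hs : IsSmall ((gapBits n).eval W) (c.1.upper.eval y + c.1.lower.eval z' - c.2) :=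
      (((((hP.cons 0 c hc).1.upper).isSmall_eval hy hP.total).add
        (isSmall_lower hP (hP.cons 0 c hc).1.lower hb)).sub
        (.of_rat (hP.cons 0 c hc).2)).mono (by
          have : (W + W) * W = 2 * W ^ 2 := by ring
          omega)
    have := one_div_succ_le hs (by linarith) hK
    linarith [key z' hint hz' hle']

/-- Completeness holds for every `K`: y is its own witness in all positive questions. -/
theorem Feas.certified {Γ : ℚ} {y : JointPoint P.dims} (hy : P.Feas 0 y)
    (hΓ : (P.obj 0).eval y ≤ Γ) (K : ℕ) : P.Certified K Γ y := by
  have h := feas_zero_iff.1 hy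
  refine ⟨fun i => hy.inBox (Fin.zero_le i), fun i => hy.satisfiesCons (Fin.zero_le i), hΓ,
    fun i _ => ⟨y, rfl, h.2.2.1, le_rfl, le_rfl⟩, fun z hz0 hz => ?_,
    ⟨y, rfl, h.2.2.1, le_rfl⟩⟩
  have := h.2.2.2 z hz0 hz
  rw [eval_obj_eq_upper_add_lower (by simp) hz0,
    eval_obj_eq_upper_add_lower (P := P) (by simp) (y := y) rfl] at this
  have : (0 : ℝ) < 1 / (K + 1) := by positivity
  linarith

theorem NearOptFeas.certifiedRobust {δ : ℚ} {y : JointPoint P.dims} (hy : P.NearOptFeas δ y)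
    (K : ℕ) : P.CertifiedRobust K δ y := by
  intro c hc z hz0 hz hle
  have := (nearOptFeas_iff.1 hy).2 z hz0 hz (by
    rw [eval_obj_eq_upper_add_lower (by simp) hz0,
      eval_obj_eq_upper_add_lower (P := P) (by simp) (y := y) rfl]
    linarith) c hc
  have : (0 : ℝ) < 1 / (K + 1) := by positivity
  linarith

/-- Feasible decisions can be chosen of polynomial size, subject to further constraints. -/
theorem Feas.exists_solution (hP : P.BoundedBy W) {Γ : ℚ} (hΓ : Γ.height ≤ 2 ^ W)
    {y : JointPoint P.dims} (hy : P.Feas 0 y) (hyΓ : (P.obj 0).eval y ≤ Γ)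
    (extra : List (LinForm P.dims × ℚ))
    (hextra : ∀ r ∈ extra, r.1.BoundedBy W ∧ r.2.height ≤ 2 ^ ((lowerBits n).eval W + W))
    (hyx : ∀ r ∈ extra, r.1.eval y ≤ r.2) :
    ∃ z : JointPoint P.dims, z.int = y.int ∧ P.Feas 0 z ∧ (P.obj 0).eval z ≤ Γ ∧
      (∀ r ∈ extra, r.1.eval z ≤ r.2) ∧ z.BoundedBy ((solutionBits n).eval W) := by
  have hW := hP.pos
  have hopt := le_eval_optBits (n + 1) hW
  have hvb := eval_valueBits n W
  have hbox := fun i => hy.inBox (Fin.zero_le i)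
  have hpow : ∀ {M N : ℕ}, M ≤ N → 2 ^ M ≤ 2 ^ N := Nat.pow_le_pow_right (by norm_num)
  -- Only a small feasible point is wanted: the objective is the zero form, which rules out the
  -- unbounded alternative, and the bound Γ is one of the extra constraints.
  rcases hy.exists_bounded hP (T := (valueBits n).eval W + (lowerBits n).eval W + W) (by omega) hbox
    (fun j hj => (hy.isSmall_obj hP hbox hj).mono (by simp; omega)) ⟨0, 0⟩ ((P.obj 0, Γ) :: extra)
    (by
      rintro r (_ | ⟨_, hr⟩)
      · exact ⟨(hP.obj 0).mono (by omega), hΓ.trans (hpow (by omega))⟩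
      · exact ⟨(hextra r hr).1.mono (by omega), (hextra r hr).2.trans (hpow (by omega))⟩)
    (by
      rintro r (_ | ⟨_, hr⟩)
      exacts [hyΓ, hyx r hr]) with h | ⟨z, hint, hz, hx, -, hb⟩
  · obtain ⟨z, -, -, -, h⟩ := h (-1)
    have h0 : (⟨0, 0⟩ : LinForm P.dims).eval z = 0 := by simp [LinForm.eval]
    linarith
  · refine ⟨z, hint, hz, hx (P.obj 0, Γ) List.mem_cons_self, fun r hr => hx r (List.mem_cons_of_mem _ hr), ?_⟩
    rwa [eval_solutionBits]

/-- The near-optimal set depends on y only through the integer part of its top level and the value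
f₁(y), and both are kept when the integer variables are. Robustness against a constraint is then a
bound on its top-level part by its right-hand side minus the largest lower-level value `q c`, a
small rational; these bounds are the extra constraints. -/
theorem NearOptFeas.exists_solution (hP : P.BoundedBy W) {Γ δ : ℚ} (hΓ : Γ.height ≤ 2 ^ W)
    (hδ : δ.height ≤ 2 ^ W) (hδ0 : 0 ≤ δ) {y : JointPoint P.dims} (hy : P.NearOptFeas δ y)
    (hyΓ : (P.obj 0).eval y ≤ Γ) :
    ∃ z : JointPoint P.dims, P.NearOptFeas δ z ∧ (P.obj 0).eval z ≤ Γ ∧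
      z.BoundedBy ((solutionBits n).eval W) := by
  obtain ⟨hy0, hrob⟩ := nearOptFeas_iff.1 hy
  have hvb := eval_valueBits n W
  have hbox := fun i => hy0.inBox (Fin.zero_le i)
  have hv : IsSmall ((valueBits n).eval W) ((P.obj 1).eval y + δ) :=
    ((hy0.isSmall_obj hP hbox (by simp)).add (.of_rat hδ)).mono (by simp; omega)
  have hsmall : ∀ c ∈ P.cons 0, ∀ z, z.int 0 = y.int 0 → P.Feas 1 z →
      (P.obj 1).eval z ≤ (P.obj 1).eval y + δ → ∃ z', z'.int 0 = y.int 0 ∧ P.Feas 1 z' ∧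
      (P.obj 1).eval z' ≤ (P.obj 1).eval y + δ ∧ c.1.lower.eval z ≤ c.1.lower.eval z' ∧
      IsSmall ((lowerBits n).eval W) (c.1.lower.eval z') := by
    intro c hc z hz0 hz hle
    rcases hz.exists_bounded_lower hP (hz.inBox_all hz0 (hbox 0)) hv hle c.1 with
      hM | ⟨z', hint, hz', hle', hcz, hb⟩
    · obtain ⟨z', hint, hz', hle', hcz⟩ := hM (c.2 - c.1.upper.eval y + 1)
      have := hrob z' (by rw [hint, hz0]) hz' hle' c hc
      linarith
    · exact ⟨z', by rw [hint, hz0], hz', hle', hcz,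
        isSmall_lower hP (hP.cons 0 c hc).1.lower hb⟩
  have hmax : ∀ c ∈ P.cons 0, ∃ q : ℚ, q.height ≤ 2 ^ (lowerBits n).eval W ∧
      c.1.upper.eval y ≤ c.2 - q ∧ ∀ z, z.int 0 = y.int 0 → P.Feas 1 z →
        (P.obj 1).eval z ≤ (P.obj 1).eval y + δ → c.1.lower.eval z ≤ q := by
    intro c hc
    -- The values attained at small height form a finite set dominating all others, so a maximum
    -- exists without any compactness argument.
    let Q : Set ℚ := {q | q.height ≤ 2 ^ (lowerBits n).eval W ∧ ∃ z, z.int 0 = y.int 0 ∧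
      P.Feas 1 z ∧ (P.obj 1).eval z ≤ (P.obj 1).eval y + δ ∧ c.1.lower.eval z = q}
    have hQ : ∀ z, z.int 0 = y.int 0 → P.Feas 1 z →
        (P.obj 1).eval z ≤ (P.obj 1).eval y + δ → ∃ q ∈ Q, c.1.lower.eval z ≤ q := by
      intro z hz0 hz hle
      obtain ⟨z', hz0', hz', hle', hcz, q, hq, hqH⟩ := hsmall c hc z hz0 hz hle
      exact ⟨q, ⟨hqH, z', hz0', hz', hle', hq⟩, hq ▸ hcz⟩
    -- As δ ≥ 0, y itself is near-optimal and the set is nonempty.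
    obtain ⟨q₀, hq₀, -⟩ := hQ y rfl (hy0.mono (Fin.zero_le _)) (by
      have : (0 : ℝ) ≤ δ := by exact_mod_cast hδ0
      linarith)
    obtain ⟨q, ⟨hqH, z, hz0, hz, hle, hq⟩, hqmax⟩ := Set.exists_max_image Q id
      ((Rat.finite_height_le _).subset fun q hq => hq.1) ⟨q₀, hq₀⟩
    refine ⟨q, hqH, ?_, fun z hz0 hz hle => ?_⟩
    · have := hrob z hz0 hz hle c hc
      rw [hq] at this
      linarith
    · obtain ⟨q', hq', hle'⟩ := hQ z hz0 hz hle
      exact hle'.trans (by exact_mod_cast hqmax q' hq')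
  choose! q hqH hq hqmax using hmax
  obtain ⟨z, hint, hz, hzΓ, hx, hb⟩ := hy0.exists_solution hP hΓ hyΓ
    ((P.cons 0).map fun c => (c.1.upper, c.2 - q c)) (by
      intro r hr
      obtain ⟨c, hc, rfl⟩ := List.mem_map.1 hr
      refine ⟨(hP.cons 0 c hc).1.upper, ?_⟩
      rw [sub_eq_add_neg, pow_add, mul_comm]
      refine (Rat.height_add_le _ _).trans (Nat.mul_le_mul (hP.cons 0 c hc).2 ?_)
      rw [Rat.height_neg]
      exact hqH c hc) (by
      intro r hr
      obtain ⟨c, hc, rfl⟩ := List.mem_map.1 hr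
      simpa using hq c hc)
  refine ⟨z, nearOptFeas_iff.2 ⟨hz, fun w hw0 hw hle c hc => ?_⟩, hzΓ, hb⟩
  have h1 := hx _ (List.mem_map.2 ⟨c, hc, rfl⟩)
  -- y and z have the same integer variables, hence the same optimal value of level 1 and the same
  -- near-optimal decisions.
  have h2 := hqmax c hc w (by rw [hw0, hint]) hw (by rwa [hy0.obj_eq hz (by simp) hint.symm])
  push_cast at h1
  linarith

end MIMLP

section

open StackProgram StackData MIMLP

/-! ### Sizes of raw data -/

theorem sz_lt_sz_ofFn {α : Type} [StackData α] {n : ℕ} (f : Fin n → α) (i : Fin n) :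
    sz (f i) < sz (List.ofFn f) := by
  have := Finset.single_le_sum (f := fun i => sz (f i) + 1) (fun _ _ => Nat.zero_le _)
    (Finset.mem_univ i)
  rw [sz_ofFn]
  omega

theorem le_sz_ofFn {α : Type} [StackData α] {n : ℕ} (f : Fin n → α) : n ≤ sz (List.ofFn f) := by
  have := length_le_sz (List.ofFn f)
  rw [List.length_ofFn] at this
  omega

theorem sum_le_sz_ofFn {α : Type} [StackData α] {n : ℕ} {m : Fin n → ℕ} (f : ∀ j, Fin (m j) → α) :
    ∑ j, m j ≤ sz (List.ofFn fun j => List.ofFn (f j)) := by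
  rw [sz_ofFn]
  exact (Finset.sum_le_sum fun j _ => (le_sz_ofFn (f j)).trans (Nat.le_succ _)).trans
    (Nat.le_succ _)

theorem sz_ofFn_le {α : Type} [StackData α] {n B : ℕ} (f : Fin n → α) (h : ∀ i, sz (f i) ≤ B) :
    sz (List.ofFn f) ≤ n * (B + 1) + 1 := by
  rw [sz_ofFn]
  have := Finset.sum_le_card_nsmul Finset.univ (fun i => sz (f i) + 1) (B + 1)
    fun i _ => Nat.succ_le_succ (h i)
  rw [Finset.card_univ, Fintype.card_fin, smul_eq_mul] at this
  omega

theorem sz_ofFn_ofFn_le {α : Type} [StackData α] {n B W : ℕ} {m : Fin n → ℕ}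
    (f : ∀ j, Fin (m j) → α) (h : ∀ j k, sz (f j k) ≤ B) (hm : ∑ j, m j ≤ W) :
    sz (List.ofFn fun j => List.ofFn (f j)) ≤ n * (W * (B + 1) + 2) + 1 :=
  sz_ofFn_le _ fun j => (sz_ofFn_le (f j) (h j)).trans (Nat.succ_le_succ (Nat.mul_le_mul_right _
    ((Finset.single_le_sum (fun _ _ => Nat.zero_le _) (Finset.mem_univ j)).trans hm)))

theorem sz_getD_getD_lt {α : Type} [StackData α] (l : List (List α)) (j k : ℕ) (b : α) :
    (l.getD j []).getD k b = b ∨ sz ((l.getD j []).getD k b) < sz l := by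
  by_cases hj : j < l.length
  · rw [List.getD_eq_getElem _ _ hj]
    by_cases hk : k < l[j].length
    · rw [List.getD_eq_getElem _ _ hk]
      exact .inr ((sz_lt_of_mem (List.getElem_mem hk)).trans (sz_lt_of_mem (List.getElem_mem hj)))
    · exact .inl (List.getD_eq_default _ _ (not_lt.1 hk))
  · rw [List.getD_eq_default _ _ (not_lt.1 hj)]
    exact .inl rfl

theorem natAbs_lt_two_pow_sz (z : ℤ) : z.natAbs < 2 ^ sz z :=
  z.natAbs.lt_size_self.trans_le (Nat.pow_le_pow_right (by norm_num) (by rw [sz_int]; omega))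

theorem isSmall_intCast (z : ℤ) : IsSmall (sz z) (z : ℝ) := by
  refine ⟨z, by push_cast; rfl, ?_⟩
  have := natAbs_lt_two_pow_sz z
  simp only [Rat.height, Rat.num_intCast, Rat.den_intCast]
  omega

theorem sz_int_le_of_isSmall {z : ℤ} {N : ℕ} (h : IsSmall N (z : ℝ)) : sz z ≤ 4 * N + 7 := by
  obtain ⟨q, hq, hN⟩ := h
  obtain rfl : (z : ℚ) = q := by exact_mod_cast hq
  simp only [Rat.height, Rat.num_intCast, Rat.den_intCast] at hN
  have : z.natAbs.size ≤ N := Nat.size_le.2 (by omega)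
  rw [sz_int]
  omega

section

variable {s : ℕ} {d : LevelDims s}

theorem JointPoint.boundedBy_ofRaw (d : LevelDims s) (Y : RawPoint) :
    (JointPoint.ofRaw d Y).BoundedBy (sz Y) := by
  have hY : sz Y = sz Y.1 + sz Y.2 := sz_prod Y
  refine ⟨fun j k => ?_, fun j k => ?_⟩
  · simp only [JointPoint.ofRaw]
    rcases sz_getD_getD_lt Y.1 j k 0 with h | h
    · rw [h]
      exact ⟨0, by simp, by simpa [Rat.height] using Nat.one_le_two_pow⟩
    · exact (isSmall_intCast _).mono (by omega)
  · simp only [JointPoint.ofRaw]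
    rcases sz_getD_getD_lt Y.2 j k 0 with h | h
    · rw [h]
      exact ⟨0, rfl, by simpa [Rat.height] using Nat.one_le_two_pow⟩
    · exact (IsSmall.of_rat (Rat.height_le_two_pow _)).mono (by omega)

theorem JointPoint.BoundedBy.mono {y : JointPoint d} {M N : ℕ} (h : y.BoundedBy M) (hMN : M ≤ N) :
    y.BoundedBy N :=
  ⟨fun j k => (h.1 j k).mono hMN, fun j k => (h.2 j k).mono hMN⟩

theorem LevelDims.total_eq (d : LevelDims s) : d.total = ∑ j, d.nInt j + ∑ j, d.nCont j := by
  simp [LevelDims.total, Fintype.card_sigma]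

/-- Rational decisions with small coordinates are given by small lists. -/
theorem JointPoint.BoundedBy.exists_raw {z : JointPoint d} {N W : ℕ} (hz : z.BoundedBy N)
    (hd : d.total ≤ W) : ∃ Y : RawPoint, JointPoint.ofRaw d Y = z ∧
      Y.1 = List.ofFn (fun j => List.ofFn (z.int j)) ∧
      sz Y ≤ 2 * ((s + 1) * (W * (4 * N + 7 + 1) + 2) + 1) := by
  choose q hq hqN using hz.2
  rw [LevelDims.total_eq] at hd
  refine ⟨(List.ofFn fun j => List.ofFn (z.int j), List.ofFn fun j => List.ofFn (q j)), ?_, rfl, ?_⟩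
  · rw [JointPoint.ofRaw_ofFn]
    obtain ⟨x, c⟩ := z
    simp only [JointPoint.mk.injEq, true_and]
    exact funext fun j => funext fun k => (hq j k).symm
  · rw [sz_prod, two_mul]
    exact Nat.add_le_add
      (sz_ofFn_ofFn_le _ (fun j k => sz_int_le_of_isSmall (hz.1 j k)) (by omega))
      (sz_ofFn_ofFn_le _ (fun j k => Rat.sz_le_of_height (hqN j k)) (by omega))

theorem LinForm.boundedBy_raw (c : LinForm d) : c.BoundedBy (sz c.raw) := by
  have h : sz c.raw = sz (List.ofFn fun j => List.ofFn (c.cInt j)) +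
      sz (List.ofFn fun j => List.ofFn (c.cCont j)) := sz_prod c.raw
  refine ⟨fun j k => (Rat.height_le_two_pow _).trans (Nat.pow_le_pow_right (by norm_num) ?_),
    fun j k => (Rat.height_le_two_pow _).trans (Nat.pow_le_pow_right (by norm_num) ?_)⟩
  · have h1 := sz_lt_sz_ofFn (c.cInt j) k
    have h2 := sz_lt_sz_ofFn (fun j => List.ofFn (c.cInt j)) j
    omega
  · have h1 := sz_lt_sz_ofFn (c.cCont j) k
    have h2 := sz_lt_sz_ofFn (fun j => List.ofFn (c.cCont j)) j
    omega

theorem MIMLP.boundedBy_raw {P : MIMLP s} {W : ℕ} (hW : sz P.raw ≤ W) : P.BoundedBy W := by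
  have h : sz P.raw = sz (List.ofFn P.dims.nInt) + (sz (List.ofFn P.dims.nCont) +
      (sz (List.ofFn fun j => List.ofFn (P.lo j)) + (sz (List.ofFn fun j => List.ofFn (P.hi j)) +
      (sz (List.ofFn fun i => (P.obj i).raw) +
        sz (List.ofFn fun i => (P.cons i).map fun c => (c.1.raw, c.2)))))) := by
    simp only [MIMLP.raw, sz_prod]
  have hpos := one_le_sz_list (List.ofFn P.dims.nInt)
  refine ⟨by omega, ?_, fun j k => ?_, fun j k => ?_, fun i => ?_, fun i c hc => ?_⟩
  · rw [LevelDims.total_eq]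
    have h1 := sum_le_sz_ofFn P.lo
    have h2 := sum_le_sz_ofFn (P.obj 0).cCont
    have h3 := sz_lt_sz_ofFn (fun i => (P.obj i).raw) 0
    have h4 : sz (P.obj 0).raw = sz (List.ofFn fun j => List.ofFn ((P.obj 0).cInt j)) +
      sz (List.ofFn fun j => List.ofFn ((P.obj 0).cCont j)) := sz_prod (P.obj 0).raw
    omega
  · refine (natAbs_lt_two_pow_sz _).trans_le (Nat.pow_le_pow_right (by norm_num) ?_)
    have h1 := sz_lt_sz_ofFn (P.lo j) k
    have h2 := sz_lt_sz_ofFn (fun j => List.ofFn (P.lo j)) j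
    omega
  · refine (natAbs_lt_two_pow_sz _).trans_le (Nat.pow_le_pow_right (by norm_num) ?_)
    have h1 := sz_lt_sz_ofFn (P.hi j) k
    have h2 := sz_lt_sz_ofFn (fun j => List.ofFn (P.hi j)) j
    omega
  · refine (P.obj i).boundedBy_raw.mono ?_
    have h1 := sz_lt_sz_ofFn (fun i => (P.obj i).raw) i
    omega
  · have h1 := sz_lt_sz_ofFn (fun i => (P.cons i).map fun c => (c.1.raw, c.2)) i
    have h2 : sz (c.1.raw, c.2) < sz ((P.cons i).map fun c => (c.1.raw, c.2)) :=
      sz_lt_of_mem (List.mem_map_of_mem hc)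
    rw [sz_prod] at h2
    dsimp only at h2
    refine ⟨c.1.boundedBy_raw.mono (by omega), (Rat.height_le_two_pow _).trans
      (Nat.pow_le_pow_right (by norm_num) (by omega))⟩

end

/-! ### Correctness of the verifier -/

section

variable {n : ℕ} {C : Set (MIMLP (n + 1))} {P : MIMLP (n + 1)} {Y : RawPoint}

/-- The concatenated code is prefix-free, so a query word determines the problem, the top-level
decision and both forms. -/
theorem rawQuery_mem_iff {p : RawProblem} {a h : RawForm} {b c : ℚ} :
    rawQuery p Y a b h c ∈ firstLowerProblemModified C ↔ ∃ P ∈ C, p = P.raw ∧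
      ∃ (x : Fin (P.dims.nInt 0) → ℤ) (a' h' : LinForm P.dims), Y.1.headD [] = List.ofFn x ∧
        P.InBox 0 x ∧ a = a'.raw ∧ h = h'.raw ∧ a'.IsLower ∧ h'.IsLower ∧
        ∃ y, y.int 0 = x ∧ P.Feas 1 y ∧ a'.eval y ≤ (b : ℝ) ∧ h'.eval y ≤ (c : ℝ) := by
  have henc : ∀ (P : MIMLP (n + 1)) (x : Fin (P.dims.nInt 0) → ℤ) (a : LinForm P.dims) (b : ℚ)
      (h : LinForm P.dims) (γ : ℚ), P.encode ++ encodeFamily (fun k => encodeInt (x k)) ++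
        a.encode ++ encodeRat b ++ h.encode ++ encodeRat γ =
      enc (P.raw, List.ofFn x, a.raw, b, h.raw, γ) := by
    intro P x a b h γ
    show _ = enc P.raw ++ (enc (List.ofFn x) ++ (enc a.raw ++ (enc b ++ (enc h.raw ++ enc γ))))
    simp only [MIMLP.enc_raw, LinForm.enc_raw, enc_ofFn, enc_rat, enc_int, List.append_assoc]
  constructor
  · rintro ⟨P, hP, x, a', b', h', γ, hx, ha, hh, hw, hy⟩
    rw [henc] at hw
    have := enc_injective hw
    simp only [Prod.mk.injEq] at this
    obtain ⟨rfl, h1, rfl, rfl, rfl, rfl⟩ := this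
    exact ⟨P, hP, rfl, x, a', h', h1, hx, rfl, rfl, ha, hh, hy⟩
  · rintro ⟨P, hP, rfl, x, a', h', h1, hx, rfl, rfl, ha, hh, hy⟩
    refine ⟨P, hP, x, a', b, h', c, hx, ha, hh, ?_, hy⟩
    rw [henc, rawQuery, h1]

theorem rawQuery_comb_mem_iff (hP : P ∈ C) {x : Fin (P.dims.nInt 0) → ℤ}
    (hY : Y.1.headD [] = List.ofFn x) (hx : P.InBox 0 x) (A B A' B' : ℚ) (K : ℕ)
    (f g : LinForm P.dims) (b c : ℚ) :
    rawQuery P.raw Y (.comb A B K f.raw) b (.comb A' B' K g.raw) c ∈ firstLowerProblemModified C ↔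
      ∃ z, z.int 0 = x ∧ P.Feas 1 z ∧
        A * f.lower.eval z + B * (LinForm.isolating P.dims K).eval z ≤ b ∧
        A' * g.lower.eval z + B' * (LinForm.isolating P.dims K).eval z ≤ c := by
  simp only [← LinForm.eval_comb, ← LinForm.raw_comb]
  rw [rawQuery_mem_iff]
  constructor
  · rintro ⟨P', -, hPP, x', a', h', hx', -, ha, hh, -, -, z, hz⟩
    obtain rfl := MIMLP.raw_injective hPP
    obtain rfl := LinForm.raw_injective ha
    obtain rfl := LinForm.raw_injective hh
    obtain rfl := List.ofFn_injective (hY.symm.trans hx')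
    exact ⟨z, hz⟩
  · rintro ⟨z, hz⟩
    exact ⟨P, hP, rfl, x, _, _, hY, hx, rfl, rfl, f.isLower_comb _ _ _, g.isLower_comb _ _ _, z, hz⟩

theorem eval_comb_raw (A B : ℚ) (K : ℕ) (f : LinForm P.dims) (Y : RawPoint) :
    (((RawForm.comb A B K f.raw).eval Y : ℚ) : ℝ) = A * f.lower.eval (.ofRaw P.dims Y) +
      B * (LinForm.isolating P.dims K).eval (.ofRaw P.dims Y) := by
  rw [← LinForm.raw_comb, LinForm.eval_raw, LinForm.eval_comb]

/-- The comparison with the bounds fails on lists of different lengths, so it also forces the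
guessed integer lists into the right shape. This matters because the first of them is copied into
the queries. -/
theorem box_check_iff : (P.raw.2.2.1.all₂' (List.all₂' fun a b => decide (a ≤ b)) Y.1 &&
      Y.1.all₂' (List.all₂' fun a b => decide (a ≤ b)) P.raw.2.2.2.1) = true ↔
    Y.1 = List.ofFn (fun j => List.ofFn ((JointPoint.ofRaw P.dims Y).int j)) ∧
      ∀ i, P.InBox i ((JointPoint.ofRaw P.dims Y).int i) := by
  have hx : ∀ x : ∀ j, Fin (P.dims.nInt j) → ℤ, Y.1 = List.ofFn (fun j => List.ofFn (x j)) →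
      (JointPoint.ofRaw P.dims Y).int = x := by
    intro x h
    simp only [JointPoint.ofRaw, h, List.getD_ofFn]
  have hiff : ∀ x : ∀ j, Fin (P.dims.nInt j) → ℤ,
      ((P.raw.2.2.1.all₂' (List.all₂' fun a b => decide (a ≤ b))
        (List.ofFn (fun j => List.ofFn (x j))) &&
      (List.ofFn (fun j => List.ofFn (x j))).all₂' (List.all₂' fun a b => decide (a ≤ b))
        P.raw.2.2.2.1) = true ↔ ∀ i, P.InBox i (x i)) := by
    intro x
    simp only [MIMLP.raw, Bool.and_eq_true, List.all₂'_ofFn, decide_eq_true_iff, MIMLP.InBox]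
    exact ⟨fun h i k => ⟨h.1 i k, h.2 i k⟩, fun h => ⟨fun i k => (h i k).1, fun i k => (h i k).2⟩⟩
  constructor
  · intro h
    obtain ⟨g, hg⟩ := List.exists_ofFn_of_all₂' (Bool.and_eq_true_iff.1 h).1
    have h' := (Bool.and_eq_true_iff.1 h).1
    rw [hg, MIMLP.raw, List.all₂'_ofFn] at h'
    choose x hgx using fun i => List.exists_ofFn_of_all₂' (h' i)
    have hY : Y.1 = List.ofFn (fun j => List.ofFn (x j)) := hg.trans (congrArg _ (funext hgx))
    rw [hx x hY]
    rw [hY] at h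
    exact ⟨hY, (hiff x).1 h⟩
  · rintro ⟨hY, h⟩
    rw [hY]
    exact (hiff _).2 h

theorem raw_obj_headD (P : MIMLP (n + 1)) :
    P.raw.2.2.2.2.1.headD ([], []) = (P.obj 0).raw := by
  simp [MIMLP.raw, List.ofFn_succ]

theorem raw_obj_tail_headD (P : MIMLP (n + 1)) :
    P.raw.2.2.2.2.1.tail.headD ([], []) = (P.obj 1).raw := by
  simp [MIMLP.raw, List.ofFn_succ]

theorem checkFeasible_raw_iff (hP : P ∈ C) (K : ℕ) (Γ : ℚ) :
    checkFeasible (firstLowerProblemModified C) K P.raw Γ Y = true ↔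
      Y.1 = List.ofFn (fun j => List.ofFn ((JointPoint.ofRaw P.dims Y).int j)) ∧
        P.Certified K Γ (.ofRaw P.dims Y) := by
  set y := JointPoint.ofRaw P.dims Y with hy
  have hcons : (P.raw.2.2.2.2.2.flatten.all fun c => decide (c.1.eval Y ≤ c.2)) = true ↔
      ∀ i, P.SatisfiesCons i y := by
    simp only [MIMLP.raw, List.all_eq_true, List.mem_flatten, List.mem_ofFn, decide_eq_true_iff]
    constructor
    · intro h i c hc
      have := h (c.1.raw, c.2) ⟨_, ⟨i, rfl⟩, List.mem_map_of_mem hc⟩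
      rw [hy, ← LinForm.eval_raw]
      exact_mod_cast this
    · rintro h _ ⟨_, ⟨i, rfl⟩, hc⟩
      obtain ⟨c, hc', rfl⟩ := List.mem_map.1 hc
      have := h i c hc'
      rw [hy, ← LinForm.eval_raw] at this
      exact_mod_cast this
  have hobj : (P.obj 0).raw.eval Y ≤ Γ ↔ (P.obj 0).eval y ≤ Γ := by
    rw [hy, ← LinForm.eval_raw, Rat.cast_le]
  have hhead : Y.1 = List.ofFn (fun j => List.ofFn (y.int j)) →
      Y.1.headD [] = List.ofFn (y.int 0) := by
    intro h
    rw [h, List.ofFn_succ]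
    rfl
  have htail : P.raw.2.2.2.2.1.tail.tail = List.ofFn fun i : Fin n => (P.obj i.succ.succ).raw := by
    simp only [MIMLP.raw, List.ofFn_succ, List.tail_cons]
  have hsucc : ∀ p : Fin (n + 2) → Prop, (∀ i : Fin n, p i.succ.succ) ↔ ∀ i, 1 < i → p i := by
    intro p
    simp only [Fin.forall_fin_succ (n := n + 1), Fin.forall_fin_succ (n := n)]
    simp [Fin.lt_def]
  classical
  unfold checkFeasible
  rw [Bool.and_eq_true_iff, Bool.and_eq_true_iff, Bool.and_eq_true_iff, Bool.and_eq_true_iff,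
    Bool.and_eq_true_iff, box_check_iff, hcons, decide_eq_true_iff, raw_obj_headD, hobj,
    raw_obj_tail_headD, decide_eq_true_iff, Bool.not_eq_true', decide_eq_false_iff_not, htail]
  rw [List.all_eq_true, List.forall_mem_ofFn_iff]
  simp only [decide_eq_true_iff]
  rw [hsucc fun i => rawQuery P.raw Y (.comb 0 1 K (P.obj i).raw)
    ((RawForm.comb 0 1 K (P.obj i).raw).eval Y) (.comb (-1) (-(K : ℤ) : ℤ) K (P.obj i).raw)
    ((RawForm.comb (-1) (-(K : ℤ) : ℤ) K (P.obj i).raw).eval Y) ∈ firstLowerProblemModified C]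
  constructor
  · rintro ⟨⟨⟨⟨⟨⟨hsh, hbox⟩, hc⟩, ho⟩, hi⟩, hq⟩, hn⟩
    simp only [rawQuery_comb_mem_iff hP (hhead hsh) (hbox 0), eval_comb_raw, ← hy] at hi
    rw [rawQuery_comb_mem_iff hP (hhead hsh) (hbox 0), eval_comb_raw, ← hy] at hq
    rw [rawQuery_comb_mem_iff hP (hhead hsh) (hbox 0), Rat.cast_sub, eval_comb_raw, ← hy] at hn
    push_cast at hi hq hn
    refine ⟨hsh, hbox, hc, ho, fun i hi1 => ?_, fun z hz0 hz => ?_, ?_⟩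
    · obtain ⟨z, hz0, hz, h1, h2⟩ := hi i hi1
      exact ⟨z, hz0, hz, by linarith, by linarith⟩
    · by_contra! hlt
      have : (0 : ℝ) < 1 / (K + 1) := by positivity
      exact hn ⟨z, hz0, hz, by linarith, by linarith⟩
    · obtain ⟨z, hz0, hz, h1, -⟩ := hq
      exact ⟨z, hz0, hz, by linarith⟩
  · rintro ⟨hsh, hbox, hc, ho, hi, hopt, hatt⟩
    refine ⟨⟨⟨⟨⟨⟨hsh, hbox⟩, hc⟩, ho⟩, fun i hi1 => ?_⟩, ?_⟩, ?_⟩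
    · rw [rawQuery_comb_mem_iff hP (hhead hsh) (hbox 0), eval_comb_raw, eval_comb_raw, ← hy]
      obtain ⟨z, hz0, hz, h1, h2⟩ := hi i hi1
      push_cast
      exact ⟨z, hz0, hz, by linarith, by linarith⟩
    · rw [rawQuery_comb_mem_iff hP (hhead hsh) (hbox 0), eval_comb_raw, ← hy]
      obtain ⟨z, hz0, hz, h1⟩ := hatt
      push_cast
      exact ⟨z, hz0, hz, by linarith, by linarith⟩
    · rw [rawQuery_comb_mem_iff hP (hhead hsh) (hbox 0), Rat.cast_sub, eval_comb_raw, ← hy]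
      push_cast
      rintro ⟨z, hz0, hz, h1, h2⟩
      have := hopt z hz0 hz
      linarith

theorem checkRobust_raw_iff (hP : P ∈ C)
    (hY : Y.1 = List.ofFn (fun j => List.ofFn ((JointPoint.ofRaw P.dims Y).int j)))
    (hbox : P.InBox 0 ((JointPoint.ofRaw P.dims Y).int 0)) (K : ℕ) (δ : ℚ) :
    checkRobust (firstLowerProblemModified C) K P.raw δ Y = true ↔
      0 ≤ δ ∧ P.CertifiedRobust K δ (.ofRaw P.dims Y) := by
  set y := JointPoint.ofRaw P.dims Y with hy
  have hhead : Y.1.headD [] = List.ofFn (y.int 0) := by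
    rw [hY, List.ofFn_succ]
    rfl
  have hcons : P.raw.2.2.2.2.2.headD [] = (P.cons 0).map fun c => (c.1.raw, c.2) := by
    simp [MIMLP.raw, List.ofFn_succ]
  classical
  unfold checkRobust
  rw [Bool.and_eq_true_iff, decide_eq_true_iff, raw_obj_tail_headD, hcons, List.all_map,
    List.all_eq_true]
  refine and_congr_right fun _ => forall_congr' fun c => forall_congr' fun _ => ?_
  have hcy := LinForm.eval_raw c.1 Y
  rw [← LinForm.eval_upper_add_lower, ← hy] at hcy
  rw [Function.comp_apply, Bool.not_eq_true', decide_eq_false_iff_not,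
    rawQuery_comb_mem_iff hP hhead hbox, Rat.cast_add, Rat.cast_sub, Rat.cast_sub, Rat.cast_sub,
    eval_comb_raw, eval_comb_raw, ← hy, hcy]
  push_cast
  constructor
  · intro h z hz0 hz hle
    by_contra! hlt
    exact h ⟨z, hz0, hz, by linarith, by linarith⟩
  · rintro h ⟨z, hz0, hz, h1, h2⟩
    have := h z hz0 hz (by linarith)
    linarith

/-- The positive question about level 1 has a yes answer only for words built from a problem in `C`,
and such a word determines the problem. -/
theorem exists_raw_of_checkFeasible {p : RawProblem} {K : ℕ} {Γ : ℚ}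
    (h : checkFeasible (firstLowerProblemModified C) K p Γ Y = true) : ∃ P ∈ C, p = P.raw := by
  classical
  unfold checkFeasible at h
  rw [Bool.and_eq_true_iff, Bool.and_eq_true_iff, decide_eq_true_iff, rawQuery_mem_iff] at h
  obtain ⟨P, hP, rfl, -⟩ := h.1.2
  exact ⟨P, hP, rfl⟩

/-! ### Membership in the polynomial hierarchy -/

/-- The size of verified solutions. -/
noncomputable def rawSolutionBits (n : ℕ) : Polynomial ℕ :=
  2 * (((n + 1 : ℕ) + 1) * (.X * (4 * solutionBits n + 7 + 1) + 2) + 1)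

theorem eval_rawSolutionBits (n W : ℕ) : (rawSolutionBits n).eval W =
    2 * ((n + 1 + 1) * (W * (4 * (solutionBits n).eval W + 7 + 1) + 2) + 1) := by
  simp [rawSolutionBits]

theorem canonicalProblem_mem_classNP (C : Set (MIMLP (n + 1))) :
    canonicalProblem C ∈ ClassNP (firstLowerProblemModified C) := by
  set O := firstLowerProblemModified C
  -- K is computed from the guessed point as well as the input: soundness has to cover guesses of
  -- any size, and the gap depends on their bits.
  obtain ⟨K, hK, hKle⟩ :=
    PolyFun.exists_large (O := O) (α := RawPoint × RawProblem × ℚ) (gapBits n)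
  have hsound : ∀ Y a, checkFeasible O (K (Y, a)) a.1 a.2 Y = true → ∃ P ∈ C, a.1 = P.raw ∧
      ∃ y, P.Feas 0 y ∧ (P.obj 0).eval y ≤ a.2 := by
    rintro Y ⟨p, Γ⟩ h
    obtain ⟨P, hP, rfl⟩ := exists_raw_of_checkFeasible h
    obtain ⟨-, hc⟩ := (checkFeasible_raw_iff hP _ _).1 h
    have hsz : sz (Y, P.raw, Γ) = sz Y + (sz P.raw + sz Γ) := by simp only [sz_prod]
    exact ⟨P, hP, rfl, _, hc.feas (W := sz (Y, P.raw, Γ)) (P.boundedBy_raw (by omega))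
      ((JointPoint.boundedBy_ofRaw _ Y).mono (by omega)) (hKle _), hc.obj⟩
  have hcomplete : ∀ P ∈ C, ∀ Γ : ℚ, ∀ y, P.Feas 0 y → (P.obj 0).eval y ≤ Γ → ∃ Y,
      checkFeasible O (K (Y, P.raw, Γ)) P.raw Γ Y = true ∧
        sz Y ≤ (rawSolutionBits n).eval (sz (P.raw, Γ)) := by
    intro P hP Γ y hy hyΓ
    have hsz : sz (P.raw, Γ) = sz P.raw + sz Γ := sz_prod _
    have hPW : P.BoundedBy (sz (P.raw, Γ)) := MIMLP.boundedBy_raw (by omega)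
    obtain ⟨z, -, hz, hzΓ, -, hb⟩ := hy.exists_solution hPW ((Rat.height_le_two_pow Γ).trans
      (Nat.pow_le_pow_right (by norm_num) (by omega))) hyΓ [] (by simp) (by simp)
    obtain ⟨Y, rfl, hY, hYs⟩ := hb.exists_raw hPW.total
    exact ⟨Y, (checkFeasible_raw_iff hP _ _).2 ⟨hY, hz.certified hzΓ _⟩,
      by rwa [eval_rawSolutionBits]⟩
  have hpoly : PolyFun O fun x : RawPoint × RawProblem × ℚ =>
      checkFeasible O (K x) x.2.1 x.2.2 x.1 := by fun_prop
  refine mem_classNP (α := RawProblem × ℚ)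
    (P := fun a => ∃ Y, checkFeasible O (K (Y, a)) a.1 a.2 Y = true)
    (NPPred.exists (P := fun Y a => checkFeasible O (K (Y, a)) a.1 a.2 Y = true) (.of_bool hpoly)
      (rawSolutionBits n) fun a Y h => ?_) fun w => ?_
  · obtain ⟨P, hP, ha, y, hy, hyΓ⟩ := hsound Y a h
    obtain ⟨p, Γ⟩ := a
    obtain rfl : p = P.raw := ha
    exact hcomplete P hP Γ y hy hyΓ
  · constructor
    · rintro ⟨P, hP, Γ, rfl, y, hy, hyΓ⟩
      obtain ⟨Y, hY, -⟩ := hcomplete P hP Γ y hy hyΓ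
      refine ⟨(P.raw, Γ), ?_, Y, hY⟩
      rw [← MIMLP.enc_raw]
      rfl
    · rintro ⟨⟨p, Γ⟩, rfl, Y, hY⟩
      obtain ⟨P, hP, rfl, y, hy, hyΓ⟩ := hsound Y _ hY
      refine ⟨P, hP, Γ, ?_, y, hy, hyΓ⟩
      rw [← MIMLP.enc_raw]
      rfl

theorem nearOptRobustProblem_mem_classNP (C : Set (MIMLP (n + 1))) :
    nearOptRobustProblem C ∈ ClassNP (firstLowerProblemModified C) := by
  set O := firstLowerProblemModified C
  obtain ⟨K, hK, hKle⟩ :=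
    PolyFun.exists_large (O := O) (α := RawPoint × RawProblem × ℚ × ℚ) (gapBits n)
  let check : RawPoint → RawProblem × ℚ × ℚ → Bool := fun Y a =>
    checkFeasible O (K (Y, a)) a.1 a.2.2 Y && checkRobust O (K (Y, a)) a.1 a.2.1 Y
  have hsound : ∀ Y a, check Y a = true → ∃ P ∈ C, a.1 = P.raw ∧ 0 ≤ a.2.1 ∧
      ∃ y, P.NearOptFeas a.2.1 y ∧ (P.obj 0).eval y ≤ a.2.2 := by
    rintro Y ⟨p, δ, Γ⟩ h
    obtain ⟨h1, h2⟩ := Bool.and_eq_true_iff.1 h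
    obtain ⟨P, hP, rfl⟩ := exists_raw_of_checkFeasible h1
    obtain ⟨hY, hc⟩ := (checkFeasible_raw_iff hP _ _).1 h1
    obtain ⟨hδ, hr⟩ := (checkRobust_raw_iff hP hY (hc.box 0) _ _).1 h2
    have hsz : sz (Y, P.raw, δ, Γ) = sz Y + (sz P.raw + (sz δ + sz Γ)) := by simp only [sz_prod]
    exact ⟨P, hP, rfl, hδ, _, hr.nearOptFeas (W := sz (Y, P.raw, δ, Γ))
      (P.boundedBy_raw (by omega)) ((JointPoint.boundedBy_ofRaw _ Y).mono (by omega))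
      ((Rat.height_le_two_pow δ).trans (Nat.pow_le_pow_right (by norm_num) (by omega))) (hKle _) hc,
      hc.obj⟩
  have hcomplete : ∀ P ∈ C, ∀ δ Γ : ℚ, 0 ≤ δ → ∀ y, P.NearOptFeas δ y → (P.obj 0).eval y ≤ Γ →
      ∃ Y, check Y (P.raw, δ, Γ) = true ∧
        sz Y ≤ (rawSolutionBits n).eval (sz (P.raw, δ, Γ)) := by
    intro P hP δ Γ hδ y hy hyΓ
    have hsz : sz (P.raw, δ, Γ) = sz P.raw + (sz δ + sz Γ) := by simp only [sz_prod]
    have hPW : P.BoundedBy (sz (P.raw, δ, Γ)) := MIMLP.boundedBy_raw (by omega)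
    obtain ⟨z, hz, hzΓ, hb⟩ := hy.exists_solution hPW
      ((Rat.height_le_two_pow Γ).trans (Nat.pow_le_pow_right (by norm_num) (by omega)))
      ((Rat.height_le_two_pow δ).trans (Nat.pow_le_pow_right (by norm_num) (by omega))) hδ hyΓ
    obtain ⟨Y, rfl, hY, hYs⟩ := hb.exists_raw hPW.total
    have hc := hz.1.certified hzΓ (K (Y, P.raw, δ, Γ))
    exact ⟨Y, Bool.and_eq_true_iff.2 ⟨(checkFeasible_raw_iff hP _ _).2 ⟨hY, hc⟩,
      (checkRobust_raw_iff hP hY (hc.box 0) _ _).2 ⟨hδ, hz.certifiedRobust _⟩⟩,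
      by rwa [eval_rawSolutionBits]⟩
  have hpoly : PolyFun O fun x : RawPoint × RawProblem × ℚ × ℚ => check x.1 x.2 :=
    .and (f := fun x : RawPoint × RawProblem × ℚ × ℚ =>
      checkFeasible O (K x) x.2.1 x.2.2.2 x.1) (by fun_prop) (by fun_prop)
  refine mem_classNP (α := RawProblem × ℚ × ℚ) (P := fun a => ∃ Y, check Y a = true)
    (NPPred.exists (P := fun Y a => check Y a = true) (.of_bool hpoly) (rawSolutionBits n)
      fun a Y h => ?_) fun w => ?_
  · obtain ⟨P, hP, ha, hδ, y, hy, hyΓ⟩ := hsound Y a h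
    obtain ⟨p, δ, Γ⟩ := a
    obtain rfl : p = P.raw := ha
    exact hcomplete P hP δ Γ hδ y hy hyΓ
  · constructor
    · rintro ⟨P, hP, δ, Γ, hδ, rfl, y, hy, hyΓ⟩
      obtain ⟨Y, hY, -⟩ := hcomplete P hP δ Γ hδ y hy hyΓ
      refine ⟨(P.raw, δ, Γ), ?_, Y, hY⟩
      rw [← MIMLP.enc_raw, List.append_assoc]
      rfl
    · rintro ⟨⟨p, δ, Γ⟩, rfl, Y, hY⟩
      obtain ⟨P, hP, rfl, hδ, y, hy, hyΓ⟩ := hsound Y _ hY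
      refine ⟨P, hP, δ, Γ, hδ, ?_, y, hy, hyΓ⟩
      rw [← MIMLP.enc_raw, List.append_assoc]
      rfl

end

end

/-! ### The theorem. -/

theorem theorem3 (s : ℕ) (hs : 1 ≤ s) (C : Set (MIMLP s))
    (hC : FirstLowerInSigmaPStar s C) :
    nearOptRobustProblem C ∈ SigmaP (s + 1) ∧ canonicalProblem C ∈ SigmaP (s + 1) := by
  -- For s = n + 1 the class `SigmaP (s + 1)` unfolds to NP relative to an oracle from `SigmaP s`.
  obtain ⟨n, rfl⟩ : ∃ n, s = n + 1 := ⟨s - 1, by omega⟩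
  exact ⟨⟨_, hC.2, nearOptRobustProblem_mem_classNP C⟩, ⟨_, hC.2, canonicalProblem_mem_classNP C⟩⟩
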